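/- Let $d\ge 1$, let $p,q\in(1,\infty]$ with $\frac1p+\frac1q\le 1$, and let $M,G\in[0,\infty)$. There is a constant $C<\infty$, depending only on $d,p,q,M,G$, such that the following holds for all $T,\kappa_1,\kappa_2,\delta>0$. Let $u_1,u_2\in L^1((0,T);W^{1,p}(\mathbb R^d)^d)$ be vector fields and let $\theta_1^0,\theta_2^0\in L^1\cap L^q(\mathbb R^d)$. For $i=1,2$ let $\theta_i\in L^\infty((0,T);L^1\cap L^q(\mathbb R^d))\cap L^1((0,T);W^{1,1}(\mathbb R^d))$ be a distributional solution of $$\partial_t\theta_i+\nabla\cdot(u_i\theta_i)=\kappa_i\Delta\theta_i\ \text{ in }(0,T)\times\mathbb R^d,\qquad \theta_i(0,\cdot)=\theta_i^0,$$ that is, $$\int_0^T\!\!\int_{\mathbb R^d}\theta_i\,(\partial_t\varphi+u_i\cdot\nabla\varphi+\kappa_i\Delta\varphi)\,dx\,dt+\int_{\mathbb R^d}\theta_i^0\,\varphi(0,\cdot)\,dx=0\qquad\text{for all }\varphi\in C_c^\infty([0,T)\times\mathbb R^d).$$ Suppose that $\|\theta_i\|_{L^\infty(L^1)}\le M$ and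 $\|\theta_i\|_{L^\infty(L^q)}\le M$ for $i=1,2$, and that $\|\nabla u_1\|_{L^1(L^p)}\le G$. Then $$\sup_{0\le t\le T}\mathcal D_\delta(\theta_1(t,\cdot),\theta_2(t,\cdot))\le C\left(\mathcal D_\delta(\theta_1^0,\theta_2^0)+1+\frac{\|u_1-u_2\|_{L^1(L^p)}+|\kappa_1-\kappa_2|\,\|\nabla\theta_2\|_{L^1(L^1)}}{\delta}\right).$$ Here $L^r(X)$ stands for $L^r((0,T);X(\mathbb R^d))$, and for integrable $f,g$ the Kantorovich–Rubinstein distance is $$\mathcal D_\delta(f,g)=\inf_\pi\iint_{\mathbb R^d\times\mathbb R^d}\log\Bigl(\frac{|x-y|}{\delta}+1\Bigr)\,d\pi(x,y)\in[0,\infty],$$ where the infimum is over all measures $\pi$ on $\mathbb R^d\times\mathbb R^d$ with marginals $(f-g)^+\,dx$ and $(f-g)^-\,dx$ (it is $\infty$ if there is none, i.e. if $\int f\ne\int g$). The supremum over $t$ is the essential supremum over $(0,T)$ for arbitrary representatives $\theta_i$, and also the pointwise supremum over $[0,T]$ for any representatives with $\theta_i(t,\cdot)\in L^1(\mathbb R^d)$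 for all $t\in[0,T]$ that are continuous in time in the sense of distributions on $\mathbb R^d$. -/

import Mathlib

open MeasureTheory Set
open scoped ENNReal NNReal

namespace AdvDiff

noncomputable section

/-- The Euclidean space `ℝᵈ`. -/
abbrev Space (d : ℕ) : Type := EuclideanSpace ℝ (Fin d)

/-- Space-time Lebesgue measure on `(0,T) × ℝᵈ`. -/
def spaceTime (d : ℕ) (T : ℝ) : Measure (ℝ × Space d) :=
  (volume.restrict (Ioo 0 T)).prod volume

/-- The norm of `L¹((0,T); Lᵖ(ℝᵈ))`. -/
def normL1Lp {d : ℕ} {F : Type} [NormedAddCommGroup F] (T : ℝ) (p : ℝ≥0∞)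
    (f : ℝ → Space d → F) : ℝ≥0∞ :=
  ∫⁻ t in Ioo 0 T, eLpNorm (f t) p volume

/-- The norm of `L^∞((0,T); L^q(ℝᵈ))`. -/
def normLinftyLq {d : ℕ} {F : Type} [NormedAddCommGroup F] (T : ℝ) (q : ℝ≥0∞)
    (f : ℝ → Space d → F) : ℝ≥0∞ :=
  essSup (fun t => eLpNorm (f t) q volume) (volume.restrict (Ioo 0 T))

/-- `Df` is the weak (distributional) derivative of the locally integrable function `f`,
where `Df x : ℝᵈ → F` is the linear map `v ↦ ∂ᵥ f (x)`. -/
structure HasWeakFDeriv {d : ℕ} {F : Type} [NormedAddCommGroup F] [NormedSpace ℝ F]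
    (f : Space d → F) (Df : Space d → Space d →L[ℝ] F) : Prop where
  locallyIntegrable : LocallyIntegrable f volume
  locallyIntegrable_deriv : LocallyIntegrable Df volume
  integral_eq : ∀ φ : Space d → ℝ, ContDiff ℝ (⊤ : ℕ∞) φ → HasCompactSupport φ → ∀ v : Space d,
    ∫ x, (fderiv ℝ φ x v) • f x = - ∫ x, φ x • Df x v

/-- `f ∈ L¹((0,T); W^{1,p}(ℝᵈ))`, and `Df` is its weak spatial derivative. -/
structure MemL1W1p {d : ℕ} {F : Type} [NormedAddCommGroup F] [NormedSpace ℝ F]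
    (T : ℝ) (p : ℝ≥0∞) (f : ℝ → Space d → F) (Df : ℝ → Space d → Space d →L[ℝ] F) : Prop where
  aestronglyMeasurable :
    AEStronglyMeasurable (fun z : ℝ × Space d => f z.1 z.2) (spaceTime d T)
  aestronglyMeasurable_deriv :
    AEStronglyMeasurable (fun z : ℝ × Space d => Df z.1 z.2) (spaceTime d T)
  norm_lt_top : normL1Lp T p f < ⊤
  norm_deriv_lt_top : normL1Lp T p Df < ⊤
  hasWeakFDeriv : ∀ᵐ t ∂(volume.restrict (Ioo 0 T)), HasWeakFDeriv (f t) (Df t)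

/-- `θ` is a distributional solution in `L^∞((0,T); L^q_loc)` of
`∂ₜθ + ∇·(uθ) = κ Δθ` on `(0,T) × ℝᵈ` with initial datum `θ₀`. The test functions in
`C_c^∞([0,T) × ℝᵈ)` are the restrictions of smooth compactly supported functions on `ℝ × ℝᵈ`
that vanish near and after time `T`. -/
structure IsDistribSolution {d : ℕ} (T : ℝ) (q : ℝ≥0∞) (κ : ℝ) (u : ℝ → Space d → Space d)
    (θ₀ : Space d → ℝ) (θ : ℝ → Space d → ℝ) : Prop where
  aestronglyMeasurable :
    AEStronglyMeasurable (fun z : ℝ × Space d => θ z.1 z.2) (spaceTime d T)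
  locally_bounded : ∀ K : Set (Space d), IsCompact K →
    essSup (fun t => eLpNorm (θ t) q (volume.restrict K)) (volume.restrict (Ioo 0 T)) < ⊤
  weak_eq : ∀ φ : ℝ × Space d → ℝ, ContDiff ℝ (⊤ : ℕ∞) φ → HasCompactSupport φ →
    tsupport φ ⊆ Iio T ×ˢ univ →
    (∫ z, θ z.1 z.2 *
        (deriv (fun s => φ (s, z.2)) z.1
          + fderiv ℝ (fun y => φ (z.1, y)) z.2 (u z.1 z.2)
          + κ * Laplacian.laplacian (fun y => φ (z.1, y)) z.2) ∂(spaceTime d T))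
      + ∫ x, θ₀ x * φ (0, x) = 0

/-- The optimal transportation cost between two measures for the cost function `c`: the infimum
of `∫ c dπ` over all couplings `π` (it is `∞` if there is none, i.e. for different masses). -/
def transportCost {d : ℕ} (c : Space d → Space d → ℝ≥0∞) (μ ν : Measure (Space d)) : ℝ≥0∞ :=
  ⨅ (π : Measure (Space d × Space d)) (_ : π.fst = μ ∧ π.snd = ν), ∫⁻ z, c z.1 z.2 ∂π

/-- The logarithmic cost `log (|x - y| / δ + 1)`. -/
def logCost {d : ℕ} (δ : ℝ) (x y : Space d) : ℝ≥0∞ :=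
  ENNReal.ofReal (Real.log (‖x - y‖ / δ + 1))

/-- The logarithmic Kantorovich-Rubinstein distance of two (not necessarily nonnegative)
densities `f` and `g`: the optimal transportation cost between the positive part `(f - g)⁺` and
the negative part `(f - g)⁻` of their difference. -/
def logKR {d : ℕ} (δ : ℝ) (f g : Space d → ℝ) : ℝ≥0∞ :=
  transportCost (logCost δ)
    (volume.withDensity fun x => ENNReal.ofReal (f x - g x))
    (volume.withDensity fun x => ENNReal.ofReal (-(f x - g x)))

/-- `v` is a representative of `θ`, defined at all times `t ∈ [0,T]` with values in `L¹(ℝᵈ)`,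
that is continuous in time in the sense of distributions. -/
structure IsWeaklyContinuousRep {d : ℕ} (T : ℝ) (θ v : ℝ → Space d → ℝ) : Prop where
  ae_eq : ∀ᵐ t ∂(volume.restrict (Ioo 0 T)), v t =ᵐ[volume] θ t
  integrable : ∀ t ∈ Icc 0 T, Integrable (v t) volume
  continuousOn : ∀ φ : Space d → ℝ, ContDiff ℝ (⊤ : ℕ∞) φ → HasCompactSupport φ →
    ContinuousOn (fun t => ∫ x, v t x * φ x) (Icc 0 T)

end

end AdvDiff

open AdvDiff

/-! ### The logarithmic cost and its Lipschitz functions. -/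

namespace AdvDiff

open Filter Topology
-- The cost log(|x - y|/δ + 1) is a metric, so Kantorovich–Rubinstein duality (`exists_coupling`,
-- `exists_plan`) turns the distance into the supremum of ∫ (f - g) ζ over functions ζ that are
-- 1-Lipschitz for it; smooth compactly supported ζ suffice, and they satisfy |∇ζ| ≤ 1/δ. Tested
-- with such ζ, the difference θ₁ - θ₂ evolves through the flux (θ₁ - θ₂) u₁ - κ₁ ∇(θ₁ - θ₂) plus
-- the residual θ₂ (u₁ - u₂) - (κ₁ - κ₂) ∇θ₂. By Hölder, the residual contributes the term with the
-- factor 1/δ.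
--
-- For the main flux, fix a time and a plan π between the positive and negative parts of θ₁ - θ₂.
-- Over a short time h both ends of π are moved by an Euler–Maruyama step x ↦ x + h u₁(x) + r y with
-- the same noise y, uniform in the unit ball, where r² is proportional to h. Common noise leaves
-- distances unchanged, so diffusion costs nothing; the drift raises the cost by at most h |u₁(x) -
-- u₁(y)| / (|x - y| + δ). The Lusin–Lipschitz inequality `ae_enorm_sub_le_maxFn` bounds |u₁(x) -
-- u₁(y)| by |x - y| (g(x) + g(y)), with g a multiple of the maximal function of |∇u₁|. The increase
-- is thus at most h ∫ g |θ₁ - θ₂|, which the maximal theorem (here p > 1 enters) and Hölder bound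
-- by a multiple of h ‖∇u₁‖ in Lᵖ, independently of δ. This is `exists_step_estimate`.
--
-- A supremum over ζ can be differentiated in time only if the error of one step is o(h) uniformly
-- in ζ. Hence `exists_euler_step` uses nothing of ζ but |∇ζ| ≤ 1/δ: second derivatives are moved
-- onto θ, and the errors are L¹ translation moduli of ∇θ and θu. At Lebesgue points in time the
-- frozen flux may replace the true one, and the supremum, being an absolutely continuous function
-- minus a monotone one, is recovered from its derivative (`ofReal_le_add_lintegral_of_step`). The
-- bound holds for the time-continuous functionals at every t in [0,T], which gives both forms of
-- the supremum.
theorem log_div_add_one_nonneg {δ r : ℝ} (hδ : 0 < δ) (hr : 0 ≤ r) : 0 ≤ Real.log (r / δ + 1) :=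
  Real.log_nonneg (by have := div_nonneg hr hδ.le; linarith)

theorem log_div_add_one_mono {δ r s : ℝ} (hδ : 0 < δ) (hr : 0 ≤ r) (h : r ≤ s) :
    Real.log (r / δ + 1) ≤ Real.log (s / δ + 1) :=
  Real.log_le_log (by positivity) (by gcongr)

theorem log_div_add_one_le {δ r : ℝ} (hδ : 0 < δ) (hr : 0 ≤ r) : Real.log (r / δ + 1) ≤ r / δ := by
  have := Real.log_le_sub_one_of_pos (x := r / δ + 1) (by positivity)
  linarith

/-- Triangle inequality of the cost, from (1 + a)(1 + b) ≥ 1 + a + b. -/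
theorem log_div_add_one_add_le {δ r s : ℝ} (hδ : 0 < δ) (hr : 0 ≤ r) (hs : 0 ≤ s) :
    Real.log ((r + s) / δ + 1) ≤ Real.log (r / δ + 1) + Real.log (s / δ + 1) := by
  rw [← Real.log_mul (by positivity) (by positivity)]
  apply Real.log_le_log (by positivity)
  have : 0 ≤ r / δ * (s / δ) := by positivity
  rw [add_div]; nlinarith

/-- The exact factorisation (r + s)/δ + 1 = (r/δ + 1)(s/(r + δ) + 1) keeps r in the denominator. It
later cancels the factor |x - y| of the Lusin–Lipschitz inequality, so that the drift costs nothing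
in terms of δ. -/
theorem log_div_add_one_add_le_div {δ r s : ℝ} (hδ : 0 < δ) (hr : 0 ≤ r) (hs : 0 ≤ s) :
    Real.log ((r + s) / δ + 1) ≤ Real.log (r / δ + 1) + s / (r + δ) := by
  have h1 : (r + s) / δ + 1 = (r / δ + 1) * (s / (r + δ) + 1) := by field_simp; ring
  rw [h1, Real.log_mul (by positivity) (by positivity)]
  have := Real.log_le_sub_one_of_pos (x := s / (r + δ) + 1) (by positivity)
  linarith

/-- `ζ` is `1`-Lipschitz for the metric `log (|x - y| / δ + 1)`. -/
def LogLip {d : ℕ} (δ : ℝ) (ζ : Space d → ℝ) : Prop :=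
  ∀ x y, ζ x - ζ y ≤ Real.log (‖x - y‖ / δ + 1)

namespace LogLip

variable {d : ℕ} {δ : ℝ} {ζ : Space d → ℝ}

theorem abs_sub_le (h : LogLip δ ζ) (x y : Space d) :
    |ζ x - ζ y| ≤ Real.log (‖x - y‖ / δ + 1) := by
  rw [abs_le]
  have := h y x
  rw [norm_sub_rev] at this
  exact ⟨by linarith, h x y⟩

theorem abs_sub_le_div (hδ : 0 < δ) (h : LogLip δ ζ) (x y : Space d) :
    |ζ x - ζ y| ≤ ‖x - y‖ / δ :=
  (h.abs_sub_le x y).trans (log_div_add_one_le hδ (norm_nonneg _))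

theorem lipschitzWith (hδ : 0 < δ) (h : LogLip δ ζ) : LipschitzWith (Real.toNNReal δ⁻¹) ζ := by
  apply LipschitzWith.of_dist_le_mul
  intro x y
  rw [Real.dist_eq, dist_eq_norm, Real.coe_toNNReal _ (by positivity), inv_mul_eq_div]
  exact h.abs_sub_le_div hδ x y

theorem continuous (hδ : 0 < δ) (h : LogLip δ ζ) : Continuous ζ := (h.lipschitzWith hδ).continuous

/-- The source of every factor 1/δ: the cost has slope 1/δ at the diagonal. -/
theorem norm_fderiv_le (hδ : 0 < δ) (h : LogLip δ ζ) (x : Space d) : ‖fderiv ℝ ζ x‖ ≤ δ⁻¹ := by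
  have := norm_fderiv_le_of_lipschitz ℝ (x₀ := x) (h.lipschitzWith hδ)
  rwa [Real.coe_toNNReal _ (by positivity)] at this

end LogLip

theorem measurable_logCost {d : ℕ} (δ : ℝ) :
    Measurable (fun z : Space d × Space d => logCost δ z.1 z.2) := by
  unfold logCost
  fun_prop

end AdvDiff

/-! ### Kantorovich–Rubinstein duality for a continuous metric cost. -/

namespace AdvDiff

open Filter Topology
open scoped BoundedContinuousFunction CompactlySupported

section Duality

variable {X : Type*} [MetricSpace X] [MeasurableSpace X] [BorelSpace X]

/-- Dual feasibility forces a nonnegative value: this is the `c`-transform argument. -/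
theorem integral_add_integral_add_mul_nonneg [Nonempty X] {c : X → X → ℝ}
    (hc : Continuous fun z : X × X => c z.1 z.2) (hc0 : ∀ x, c x x = 0)
    (hcn : ∀ x y, 0 ≤ c x y) (hct : ∀ x y z, c x z ≤ c x y + c y z)
    {μ ν : Measure X} [IsFiniteMeasure μ] [IsFiniteMeasure ν] {S : ℝ}
    (hS : ∀ ζ : X →ᵇ ℝ, (∀ x y, ζ x - ζ y ≤ c x y) → ∫ x, ζ x ∂μ - ∫ x, ζ x ∂ν ≤ S)
    (a b : X →ᵇ ℝ) {l : ℝ} (hl : 0 ≤ l) (h : ∀ x y, 0 ≤ a x + b y + l * c x y) :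
    0 ≤ ∫ x, a x ∂μ + ∫ x, b x ∂ν + l * S := by
  have pos_case : ∀ l : ℝ, 0 < l → (∀ x y, 0 ≤ a x + b y + l * c x y) →
      0 ≤ ∫ x, a x ∂μ + ∫ x, b x ∂ν + l * S := by
    intro l hl h
    have bdd : ∀ x, BddBelow (range fun y => b y + l * c x y) := fun x => by
      refine ⟨-‖b‖, ?_⟩
      rintro _ ⟨y, rfl⟩
      have h1 := (abs_le.1 (b.norm_coe_le_norm y)).1
      have h2 := mul_nonneg hl.le (hcn x y)
      simp only; linarith
    -- The c-transform of b for the cost `l * c`: it lies between -a and b and is l-Lipschitz for c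
    -- by the triangle inequality, so z / l is admissible in `hS`.
    set z : X → ℝ := fun x => ⨅ y, (b y + l * c x y) with hz
    have z_le : ∀ x, z x ≤ b x := fun x => by
      have := ciInf_le (bdd x) x
      simpa [hc0] using this
    have le_z : ∀ x, -a x ≤ z x := fun x => le_ciInf fun y => by have := h x y; linarith
    have z_lip : ∀ x x', z x - z x' ≤ l * c x x' := fun x x' => by
      rw [sub_le_iff_le_add, ← sub_le_iff_le_add']
      refine le_ciInf fun y => ?_
      have h1 := ciInf_le (bdd x) y
      have h2 := mul_le_mul_of_nonneg_left (hct x x' y) hl.le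
      simp only [hz] at *
      linarith
    have z_cont : Continuous z := by
      rw [continuous_iff_continuousAt]
      intro x
      have h1 : Tendsto (fun x' => l * c x x') (𝓝 x) (𝓝 0) := by
        have : Continuous fun x' => l * c x x' :=
          continuous_const.mul (hc.comp (continuous_const.prodMk continuous_id))
        have := this.tendsto x
        simpa [hc0] using this
      have h2 : Tendsto (fun x' => l * c x' x) (𝓝 x) (𝓝 0) := by
        have : Continuous fun x' => l * c x' x :=
          continuous_const.mul (hc.comp (continuous_id.prodMk continuous_const))
        have := this.tendsto x
        simpa [hc0] using this
      have h3 : Tendsto (fun x' => z x' - z x) (𝓝 x) (𝓝 0) := by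
        refine tendsto_of_tendsto_of_tendsto_of_le_of_le (by simpa using h1.neg) h2 ?_ ?_
        · intro x'
          have := z_lip x x'
          simp only; linarith
        · intro x'; exact z_lip x' x
      have := h3.add_const (z x)
      simpa [ContinuousAt] using this
    have z_bdd : ∀ x, ‖z x‖ ≤ ‖a‖ + ‖b‖ := fun x => by
      have h1 := abs_le.1 (a.norm_coe_le_norm x)
      have h2 := abs_le.1 (b.norm_coe_le_norm x)
      have h3 := norm_nonneg a
      have h4 := norm_nonneg b
      rw [Real.norm_eq_abs, abs_le]
      constructor <;> linarith [z_le x, le_z x, h1.1, h1.2, h2.1, h2.2]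
    let ζ : X →ᵇ ℝ := BoundedContinuousFunction.ofNormedAddCommGroup z z_cont _ z_bdd
    have h1 := hS (l⁻¹ • ζ) (fun x y => by
      have := z_lip x y
      simp only [BoundedContinuousFunction.coe_smul, smul_eq_mul, ← mul_sub]
      rw [inv_mul_le_iff₀ hl]
      exact this)
    simp only [BoundedContinuousFunction.coe_smul, smul_eq_mul, integral_const_mul,
      ← mul_sub] at h1
    rw [inv_mul_le_iff₀ hl] at h1
    have h2 : -∫ x, a x ∂μ ≤ ∫ x, ζ x ∂μ := by
      rw [← integral_neg]
      exact integral_mono (a.integrable μ).neg (ζ.integrable μ) le_z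
    have h3 : ∫ x, ζ x ∂ν ≤ ∫ x, b x ∂ν :=
      integral_mono (ζ.integrable ν) (b.integrable ν) z_le
    linarith
  rcases hl.lt_or_eq with hl' | rfl
  · exact pos_case l hl' h
  -- For l = 0 the rescaling by 1/l is impossible; since c ≥ 0 the constraint persists for every
  -- larger l, and l tends to 0.
  · have h1 : Tendsto (fun l : ℝ => ∫ x, a x ∂μ + ∫ x, b x ∂ν + l * S) (𝓝[>] 0)
        (𝓝 (∫ x, a x ∂μ + ∫ x, b x ∂ν + 0 * S)) := by
      refine Tendsto.mono_left ?_ nhdsWithin_le_nhds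
      exact (Continuous.tendsto (by fun_prop) 0)
    refine ge_of_tendsto h1 ?_
    filter_upwards [self_mem_nhdsWithin] with l hl
    refine pos_case l hl fun x y => ?_
    have := h x y
    have := mul_nonneg (le_of_lt hl) (hcn x y)
    linarith

/-- The positive functional provided by the Hahn-Banach theorem. -/
theorem exists_functional [Nonempty X] {c : X → X → ℝ}
    (hc : Continuous fun z : X × X => c z.1 z.2) (hc0 : ∀ x, c x x = 0)
    (hcn : ∀ x y, 0 ≤ c x y) (hct : ∀ x y z, c x z ≤ c x y + c y z)
    {μ ν : Measure X} [IsFiniteMeasure μ] [IsFiniteMeasure ν] {S : ℝ}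
    (hS : ∀ ζ : X →ᵇ ℝ, (∀ x y, ζ x - ζ y ≤ c x y) → ∫ x, ζ x ∂μ - ∫ x, ζ x ∂ν ≤ S) :
    ∃ L : (X × X →ᵇ ℝ) →ₗ[ℝ] ℝ, ∀ (Φ : X × X →ᵇ ℝ) (a b : X →ᵇ ℝ) (l : ℝ), 0 ≤ l →
      (∀ x y, Φ (x, y) ≤ a x + b y + l * c x y) →
      L Φ ≤ ∫ x, a x ∂μ + ∫ x, b x ∂ν + l * S := by
  -- The infimum of `V Φ` is the price of superhedging Φ by a(x) + b(y) + l c(x,y). It is sublinear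
  -- in Φ, and finite by the preceding lemma.
  let V : (X × X →ᵇ ℝ) → Set ℝ := fun Φ => {r | ∃ (a b : X →ᵇ ℝ) (l : ℝ), 0 ≤ l ∧
      (∀ x y, Φ (x, y) ≤ a x + b y + l * c x y) ∧ r = ∫ x, a x ∂μ + ∫ x, b x ∂ν + l * S}
  have hne : ∀ Φ, (V Φ).Nonempty := fun Φ =>
    ⟨_, BoundedContinuousFunction.const X ‖Φ‖, 0, 0, le_rfl, fun x y => by
      simpa using (le_abs_self _).trans (Φ.norm_coe_le_norm (x, y)), rfl⟩
  have hbdd : ∀ Φ, BddBelow (V Φ) := by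
    refine fun Φ => ⟨-(‖Φ‖ * μ.real univ), ?_⟩
    rintro _ ⟨a, b, l, hl, h, rfl⟩
    have := integral_add_integral_add_mul_nonneg hc hc0 hcn hct hS
      (a + BoundedContinuousFunction.const X ‖Φ‖) b hl (fun x y => by
        have h1 := h x y
        have h2 := (abs_le.1 (Φ.norm_coe_le_norm (x, y))).1
        simp only [BoundedContinuousFunction.coe_add, Pi.add_apply,
          BoundedContinuousFunction.const_apply]
        linarith)
    simp only [BoundedContinuousFunction.coe_add, Pi.add_apply,
          BoundedContinuousFunction.const_apply] at this
    rw [integral_add (a.integrable μ) (integrable_const _)] at this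
    simp only [integral_const, smul_eq_mul] at this
    linarith
  obtain ⟨L, -, hL⟩ := exists_extension_of_le_sublinear (E := X × X →ᵇ ℝ)
    -- The extension starts from the zero subspace: only domination by the sublinear functional is
    -- wanted.
    ⟨⊥, 0⟩ (fun Φ => sInf (V Φ)) (by
      have key : ∀ k : ℝ, 0 < k → ∀ Φ, sInf (V (k • Φ)) ≤ k * sInf (V Φ) := by
        intro k hk Φ
        rw [← inv_mul_le_iff₀ hk]
        refine le_csInf (hne Φ) ?_
        rintro _ ⟨a, b, l, hl, h, rfl⟩
        rw [inv_mul_le_iff₀ hk]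
        refine csInf_le (hbdd _) ⟨k • a, k • b, k * l, by positivity, fun x y => ?_, ?_⟩
        · have := mul_le_mul_of_nonneg_left (h x y) hk.le
          simp only [BoundedContinuousFunction.coe_smul, smul_eq_mul]
          linarith
        · simp only [BoundedContinuousFunction.coe_smul, smul_eq_mul, integral_const_mul]
          ring
      intro k hk Φ
      refine le_antisymm (key k hk Φ) ?_
      have := key k⁻¹ (inv_pos.2 hk) (k • Φ)
      rw [smul_smul, inv_mul_cancel₀ hk.ne', one_smul] at this
      rwa [← le_inv_mul_iff₀ hk])
    (by
      intro Φ Ψ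
      rw [← sub_le_iff_le_add]
      refine le_csInf (hne Φ) ?_
      rintro _ ⟨a, b, l, hl, h, rfl⟩
      rw [sub_le_comm]
      refine le_csInf (hne Ψ) ?_
      rintro _ ⟨a', b', l', hl', h', rfl⟩
      rw [sub_le_iff_le_add]
      refine csInf_le (hbdd _) ⟨a + a', b + b', l + l', by positivity, fun x y => ?_, ?_⟩
      · simp only [BoundedContinuousFunction.coe_add, Pi.add_apply]
        have := h x y
        have := h' x y
        linarith
      · simp only [BoundedContinuousFunction.coe_add, Pi.add_apply]
        rw [integral_add (a.integrable μ) (a'.integrable μ),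
          integral_add (b.integrable ν) (b'.integrable ν)]
        ring)
    (by
      rintro ⟨x, hx⟩
      have : x = 0 := by simpa using hx
      subst this
      refine le_csInf (hne _) ?_
      rintro _ ⟨a, b, l, hl, h, rfl⟩
      exact integral_add_integral_add_mul_nonneg hc hc0 hcn hct hS a b hl
        (fun x y => by simpa using h x y))
  exact ⟨L, fun Φ a b l hl h => (hL Φ).trans (csInf_le (hbdd Φ) ⟨a, b, l, hl, h, rfl⟩)⟩

/-- A sequence of compactly supported cutoff functions increasing to `1`. -/
noncomputable def cutoff {Y : Type*} [PseudoMetricSpace Y] (y₀ : Y) (n : ℕ) (y : Y) : ℝ :=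
  max 0 (min 1 (n + 1 - dist y y₀))

section Cutoff

variable {Y : Type*} [PseudoMetricSpace Y] (y₀ : Y)

theorem continuous_cutoff (n : ℕ) : Continuous (cutoff y₀ n) := by
  unfold cutoff; fun_prop

theorem cutoff_nonneg (n : ℕ) (y : Y) : 0 ≤ cutoff y₀ n y := le_max_left _ _

theorem cutoff_le_one (n : ℕ) (y : Y) : cutoff y₀ n y ≤ 1 :=
  max_le zero_le_one (min_le_left _ _)

theorem tendsto_cutoff (y : Y) : Tendsto (fun n => cutoff y₀ n y) atTop (𝓝 1) := by
  refine tendsto_const_nhds.congr' ?_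
  filter_upwards [eventually_ge_atTop ⌈dist y y₀⌉₊] with n hn
  have : dist y y₀ ≤ n := Nat.ceil_le.1 hn
  unfold cutoff
  rw [min_eq_left (by linarith), max_eq_right zero_le_one]

theorem hasCompactSupport_cutoff [ProperSpace Y] (n : ℕ) : HasCompactSupport (cutoff y₀ n) := by
  refine HasCompactSupport.intro (isCompact_closedBall y₀ (n + 1)) fun y hy => ?_
  rw [Metric.mem_closedBall, not_le] at hy
  unfold cutoff
  rw [max_eq_left]
  exact (min_le_right _ _).trans (by linarith)

/-- With the maximum distance on the product, a point far from the centre has a far coordinate.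
Tails of a plan are therefore controlled by tails of its marginals, which is the tightness used for
duality. -/
theorem one_sub_cutoff_prod_le {X : Type*} [PseudoMetricSpace X] (x₀ y₀ : X) (n : ℕ) (z : X × X) :
    1 - cutoff (x₀, y₀) n z ≤ (1 - cutoff x₀ n z.1) + (1 - cutoff y₀ n z.2) := by
  have h1 := cutoff_le_one x₀ n z.1
  have h2 := cutoff_le_one y₀ n z.2
  have : dist z (x₀, y₀) = max (dist z.1 x₀) (dist z.2 y₀) := rfl
  rcases max_cases (dist z.1 x₀) (dist z.2 y₀) with h | h
  · have : cutoff (x₀, y₀) n z = cutoff x₀ n z.1 := by unfold cutoff; rw [this, h.1]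
    linarith
  · have : cutoff (x₀, y₀) n z = cutoff y₀ n z.2 := by unfold cutoff; rw [this, h.1]
    linarith

end Cutoff

/-- Restriction of a functional on bounded continuous functions to compactly supported ones. -/
noncomputable def restrictCompactlySupported {Y : Type*} [TopologicalSpace Y]
    (L : (Y →ᵇ ℝ) →ₗ[ℝ] ℝ) (hL : ∀ Φ : Y →ᵇ ℝ, 0 ≤ Φ → 0 ≤ L Φ) : C_c(Y, ℝ) →ₚ[ℝ] ℝ :=
  PositiveLinearMap.mk₀
    { toFun := fun f => L (f : Y →ᵇ ℝ)
      map_add' := fun f g => by rw [← map_add]; rfl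
      map_smul' := fun k f => by
        rw [RingHom.id_apply, ← map_smul]; rfl }
    (fun f hf => hL _ hf)

/-- Kantorovich-Rubinstein duality for a continuous (pseudo-)metric cost, existence of a plan. -/
theorem exists_coupling [ProperSpace X] [Nonempty X] {c : X → X → ℝ}
    (hc : Continuous fun z : X × X => c z.1 z.2) (hc0 : ∀ x, c x x = 0)
    (hcn : ∀ x y, 0 ≤ c x y) (hct : ∀ x y z, c x z ≤ c x y + c y z)
    {μ ν : Measure X} [IsFiniteMeasure μ] [IsFiniteMeasure ν] {S : ℝ}
    (hS : ∀ ζ : X →ᵇ ℝ, (∀ x y, ζ x - ζ y ≤ c x y) → ∫ x, ζ x ∂μ - ∫ x, ζ x ∂ν ≤ S) :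
    ∃ π : Measure (X × X), π.fst = μ ∧ π.snd = ν ∧
      ∫⁻ z, ENNReal.ofReal (c z.1 z.2) ∂π ≤ ENNReal.ofReal S := by
  obtain ⟨L, hL⟩ := exists_functional hc hc0 hcn hct hS
  have L_nonpos : ∀ Φ : X × X →ᵇ ℝ, (∀ z, Φ z ≤ 0) → L Φ ≤ 0 := fun Φ h => by
    simpa using hL Φ 0 0 0 le_rfl (fun x y => by simpa using h (x, y))
  have L_nonneg : ∀ Φ : X × X →ᵇ ℝ, 0 ≤ Φ → 0 ≤ L Φ := fun Φ h => by
    have := L_nonpos (-Φ) (fun z => by simpa using h z)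
    rw [map_neg] at this; linarith
  have L_mono : ∀ Φ Ψ : X × X →ᵇ ℝ, (∀ z, Φ z ≤ Ψ z) → L Φ ≤ L Ψ := fun Φ Ψ h => by
    have := L_nonpos (Φ - Ψ) (fun z => by simpa using h z)
    rw [map_sub] at this; linarith
  let p1 : (X →ᵇ ℝ) → (X × X →ᵇ ℝ) := fun a => a.compContinuous ⟨Prod.fst, continuous_fst⟩
  let p2 : (X →ᵇ ℝ) → (X × X →ᵇ ℝ) := fun a => a.compContinuous ⟨Prod.snd, continuous_snd⟩
  -- Both a and -a are hedges of themselves with l = 0, so the inequality for L becomes an equality: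
  -- the marginals are exact.
  have L_fst : ∀ a : X →ᵇ ℝ, L (p1 a) = ∫ x, a x ∂μ := fun a => by
    refine le_antisymm ?_ ?_
    · simpa using hL (p1 a) a 0 0 le_rfl (fun x y => by simp [p1])
    · have := hL (-(p1 a)) (-a) 0 0 le_rfl (fun x y => by simp [p1])
      rw [map_neg] at this
      simp only [BoundedContinuousFunction.coe_neg, Pi.neg_apply, integral_neg] at this
      simp at this; linarith
  have L_snd : ∀ a : X →ᵇ ℝ, L (p2 a) = ∫ x, a x ∂ν := fun a => by
    refine le_antisymm ?_ ?_
    · simpa using hL (p2 a) 0 a 0 le_rfl (fun x y => by simp [p2])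
    · have := hL (-(p2 a)) 0 (-a) 0 le_rfl (fun x y => by simp [p2])
      rw [map_neg] at this
      simp only [BoundedContinuousFunction.coe_neg, Pi.neg_apply, integral_neg] at this
      simp at this; linarith
  have L_cost : ∀ Φ : X × X →ᵇ ℝ, (∀ z, Φ z ≤ c z.1 z.2) → L Φ ≤ S := fun Φ h => by
    simpa using hL Φ 0 0 1 zero_le_one (fun x y => by simpa using h (x, y))
  let Λ := restrictCompactlySupported L L_nonneg
  let π : Measure (X × X) := RealRMK.rieszMeasure Λ
  have π_int : ∀ (f : X × X → ℝ) (hf : Continuous f) (hfs : HasCompactSupport f)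
      (Φ : X × X →ᵇ ℝ), (∀ z, Φ z = f z) → Integrable f π ∧ ∫ z, f z ∂π = L Φ := by
    intro f hf hfs Φ hΦ
    refine ⟨hf.integrable_of_hasCompactSupport hfs, ?_⟩
    have h1 := RealRMK.integral_rieszMeasure Λ ⟨⟨f, hf⟩, hfs⟩
    refine h1.trans ?_
    change L _ = L Φ
    congr 1
    ext z
    exact (hΦ z).symm
  obtain ⟨x₀⟩ := ‹Nonempty X›
  let χ : ℕ → X × X → ℝ := cutoff (x₀, x₀)
  let χb : ℕ → (X × X →ᵇ ℝ) := fun n =>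
    BoundedContinuousFunction.ofNormedAddCommGroup (χ n) (continuous_cutoff _ n) 1 (fun z => by
      rw [Real.norm_eq_abs, abs_of_nonneg (cutoff_nonneg _ _ _)]; exact cutoff_le_one _ _ _)
  let χ1 : ℕ → (X →ᵇ ℝ) := fun n =>
    BoundedContinuousFunction.ofNormedAddCommGroup (cutoff x₀ n) (continuous_cutoff _ n) 1
      (fun z => by
        rw [Real.norm_eq_abs, abs_of_nonneg (cutoff_nonneg _ _ _)]; exact cutoff_le_one _ _ _)
  have π_mul : ∀ (Φ : X × X →ᵇ ℝ) n,
      Integrable (fun z => Φ z * χ n z) π ∧ ∫ z, Φ z * χ n z ∂π = L (Φ * χb n) := fun Φ n =>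
    π_int _ (Φ.continuous.mul (continuous_cutoff _ n))
      ((hasCompactSupport_cutoff _ n).mul_left) _ (fun z => rfl)
  -- The Riesz measure represents L only on compactly supported functions; monotone cutoffs and
  -- Fatou extend upper bounds to the limits of bounded functions.
  have fatou : ∀ (f : X × X → ℝ) (Φ : ℕ → X × X →ᵇ ℝ) (B : ℝ), Measurable f →
      (∀ n z, 0 ≤ Φ n z) →
      (∀ z, Tendsto (fun n => Φ n z) atTop (𝓝 (f z))) → (∀ n, L (Φ n) ≤ B) →
      ∫⁻ z, ENNReal.ofReal (f z) ∂π ≤ ENNReal.ofReal B := by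
    intro f Φ B hf hΦ0 hΦ hB
    have h1 : ∀ z, ENNReal.ofReal (f z) =
        liminf (fun n => ENNReal.ofReal (Φ n z * χ n z)) atTop := fun z => by
      refine (Tendsto.liminf_eq ?_).symm
      refine ENNReal.tendsto_ofReal ?_
      simpa using (hΦ z).mul (tendsto_cutoff (x₀, x₀) z)
    simp_rw [h1]
    refine (lintegral_liminf_le (fun n => ?_)).trans ?_
    · exact ENNReal.measurable_ofReal.comp
        (((Φ n).continuous.mul (continuous_cutoff _ n)).measurable)
    · refine liminf_le_of_le (by isBoundedDefault) ?_
      intro b hb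
      obtain ⟨n, hn⟩ := hb.exists
      refine hn.trans ?_
      rw [← ofReal_integral_eq_lintegral_ofReal (π_mul (Φ n) n).1
        (.of_forall fun z => mul_nonneg (hΦ0 n z) (cutoff_nonneg _ _ _)), (π_mul (Φ n) n).2]
      refine ENNReal.ofReal_le_ofReal ((L_mono _ _ fun z => ?_).trans (hB n))
      exact mul_le_of_le_one_right (hΦ0 n z) (cutoff_le_one _ _ _)
  have π_fin : IsFiniteMeasure π := by
    refine ⟨lt_of_le_of_lt ?_ (ENNReal.ofReal_lt_top (r := L 1))⟩
    have := fatou (fun _ => 1) (fun _ => 1) (L 1) measurable_const (fun _ _ => zero_le_one)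
      (fun z => tendsto_const_nhds) (fun _ => le_rfl)
    simpa using this
  -- No mass escapes to infinity: the part of Φ lost to the cutoff is dominated by functions of one
  -- variable, on which L is integration against μ or ν.
  have L_eq : ∀ Φ : X × X →ᵇ ℝ, ∫ z, Φ z ∂π = L Φ := by
    intro Φ
    have h1 : Tendsto (fun n => ∫ z, Φ z * χ n z ∂π) atTop (𝓝 (∫ z, Φ z ∂π)) := by
      refine tendsto_integral_of_dominated_convergence (fun _ => ‖Φ‖)
        (fun n => (π_mul Φ n).1.aestronglyMeasurable) (integrable_const _) ?_ ?_
      · refine fun n => .of_forall fun z => ?_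
        rw [norm_mul, Real.norm_of_nonneg (cutoff_nonneg _ n z : 0 ≤ χ n z)]
        exact (mul_le_of_le_one_right (norm_nonneg _) (cutoff_le_one _ _ _)).trans
          (Φ.norm_coe_le_norm z)
      · refine .of_forall fun z => ?_
        simpa using (tendsto_const_nhds (x := Φ z)).mul (tendsto_cutoff (x₀, x₀) z)
    have tail : ∀ ρ : Measure X, IsFiniteMeasure ρ →
        Tendsto (fun n => ∫ x, (1 - χ1 n) x ∂ρ) atTop (𝓝 0) := by
      intro ρ _
      have : Tendsto (fun n => ∫ x, (1 - χ1 n) x ∂ρ) atTop (𝓝 (∫ x, (0 : ℝ) ∂ρ)) := by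
        refine tendsto_integral_of_dominated_convergence (fun _ => 1)
          (fun n => (1 - χ1 n).continuous.aestronglyMeasurable) (integrable_const _) ?_ ?_
        · refine fun n => .of_forall fun z => ?_
          have h0 := cutoff_nonneg x₀ n z
          have h1 := cutoff_le_one x₀ n z
          change |1 - cutoff x₀ n z| ≤ 1
          rw [abs_le]; constructor <;> linarith
        · refine .of_forall fun z => ?_
          have := (tendsto_const_nhds (x := (1 : ℝ))).sub (tendsto_cutoff x₀ z)
          rw [sub_self] at this
          exact this
      simpa using this
    have h2 : Tendsto (fun n => ∫ z, Φ z * χ n z ∂π) atTop (𝓝 (L Φ)) := by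
      rw [tendsto_iff_dist_tendsto_zero]
      have h3 : Tendsto (fun n => ‖Φ‖ * (∫ x, (1 - χ1 n) x ∂μ + ∫ x, (1 - χ1 n) x ∂ν)) atTop
          (𝓝 0) := by
        simpa using ((tail μ inferInstance).add (tail ν inferInstance)).const_mul ‖Φ‖
      refine squeeze_zero (fun _ => dist_nonneg) (fun n => ?_) h3
      have hb : ∀ z, |Φ z| * (1 - χ n z) ≤
          ‖Φ‖ * ((1 - cutoff x₀ n z.1) + (1 - cutoff x₀ n z.2)) := fun z => by
        have h0 : χ n z ≤ 1 := cutoff_le_one _ n z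
        have := one_sub_cutoff_prod_le x₀ x₀ n z
        exact mul_le_mul (Φ.norm_coe_le_norm z) this (by linarith) (norm_nonneg _)
      have h4 : ∀ s : ℝ, |s| = 1 → L (s • (Φ * χb n - Φ)) ≤
          ‖Φ‖ * (∫ x, (1 - χ1 n) x ∂μ + ∫ x, (1 - χ1 n) x ∂ν) := fun s hs => by
        rw [← L_fst, ← L_snd, ← map_add]
        refine le_of_le_of_eq ?_ (map_smul L ‖Φ‖ (p1 (1 - χ1 n) + p2 (1 - χ1 n)))
        refine L_mono _ _ fun z => ?_
        refine le_trans ?_ (hb z)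
        change s * (Φ z * χ n z - Φ z) ≤ _
        have h0 : χ n z ≤ 1 := cutoff_le_one _ n z
        refine (le_abs_self _).trans ?_
        rw [abs_mul, hs, one_mul, show Φ z * χ n z - Φ z = -(Φ z * (1 - χ n z)) by ring, abs_neg,
          abs_mul, abs_of_nonneg (by linarith : 0 ≤ 1 - χ n z)]
      rw [Real.dist_eq, (π_mul Φ n).2, abs_le]
      have h5 := h4 1 (by simp)
      have h6 := h4 (-1) (by simp)
      simp only [map_smul, map_sub, smul_eq_mul] at h5 h6
      constructor <;> linarith
    exact tendsto_nhds_unique h1 h2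
  refine ⟨π, ?_, ?_, ?_⟩
  · refine ext_of_forall_integral_eq_of_IsFiniteMeasure fun a => ?_
    rw [Measure.fst, integral_map measurable_fst.aemeasurable a.continuous.aestronglyMeasurable,
      ← L_fst, ← L_eq]
    rfl
  · refine ext_of_forall_integral_eq_of_IsFiniteMeasure fun a => ?_
    rw [Measure.snd, integral_map measurable_snd.aemeasurable a.continuous.aestronglyMeasurable,
      ← L_snd, ← L_eq]
    rfl
  -- The cost may be unbounded, so it is approached by its truncations min(c, n), each of which L
  -- bounds by S.
  · have h0 : ∀ (n : ℕ) (z : X × X), 0 ≤ min (c z.1 z.2) (n : ℝ) := fun n z =>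
      le_min (hcn _ _) n.cast_nonneg
    refine fatou _ (fun n => BoundedContinuousFunction.ofNormedAddCommGroup
      (fun z => min (c z.1 z.2) n) (hc.min continuous_const) n (fun z => by
        rw [Real.norm_of_nonneg (h0 n z)]; exact min_le_right _ _)) S hc.measurable h0
      (fun z => ?_) (fun n => L_cost _ fun z => min_le_left _ _)
    refine tendsto_const_nhds.congr' ?_
    filter_upwards [eventually_ge_atTop ⌈c z.1 z.2⌉₊] with n hn
    exact (min_eq_left (Nat.ceil_le.1 hn)).symm

end Duality

end AdvDiff

/-! ### Smooth compactly supported test functions suffice; transport plans of signed densities. -/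

namespace AdvDiff

open Filter Topology
open scoped BoundedContinuousFunction Convolution

variable {d : ℕ}

/-- A mollification is an average of translates, and the cost is translation invariant; the
displacement of each translate is at most `φ.rOut`. -/
theorem LogLip.sub_norm_convolution {δ : ℝ} {g : Space d → ℝ} (hδ : 0 < δ) (hg : LogLip δ g)
    (hgs : HasCompactSupport g) (φ : ContDiffBump (0 : Space d)) :
    ContDiff ℝ (⊤ : ℕ∞) (φ.normed volume ⋆[ContinuousLinearMap.lsmul ℝ ℝ, volume] g) ∧
    HasCompactSupport (φ.normed volume ⋆[ContinuousLinearMap.lsmul ℝ ℝ, volume] g) ∧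
    LogLip δ (φ.normed volume ⋆[ContinuousLinearMap.lsmul ℝ ℝ, volume] g) ∧
    ∀ x, |(φ.normed volume ⋆[ContinuousLinearMap.lsmul ℝ ℝ, volume] g) x - g x| ≤
      φ.rOut / δ := by
  have hgc := hg.continuous hδ
  refine ⟨φ.hasCompactSupport_normed.contDiff_convolution_left _ φ.contDiff_normed
    hgc.locallyIntegrable, φ.hasCompactSupport_normed.convolution _ hgs, ?_, ?_⟩
  · intro x y
    have hi : ∀ x, Integrable (fun t => φ.normed volume t • g (x - t)) := fun x =>
      Continuous.integrable_of_hasCompactSupport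
        (φ.continuous_normed.smul (hgc.comp (continuous_const.sub continuous_id)))
        φ.hasCompactSupport_normed.smul_right
    have hφ := φ.integral_normed (μ := volume)
    simp only [MeasureTheory.convolution, ContinuousLinearMap.lsmul_apply]
    rw [← integral_sub (hi x) (hi y)]
    refine le_of_le_of_eq (b := ∫ t, φ.normed volume t * Real.log (‖x - y‖ / δ + 1)) ?_
      (by rw [integral_mul_const, hφ, one_mul])
    refine integral_mono ((hi x).sub (hi y)) (φ.integrable_normed.mul_const _) fun t => ?_
    have h1 := hg (x - t) (y - t)
    rw [sub_sub_sub_cancel_right] at h1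
    have := mul_le_mul_of_nonneg_left h1 (φ.nonneg_normed (μ := volume) t)
    simpa [mul_sub] using this
  · intro x
    have := φ.dist_normed_convolution_le (μ := volume) (g := g) (x₀ := x) (ε := φ.rOut / δ)
      hgc.aestronglyMeasurable (fun y hy => by
        rw [Real.dist_eq]
        refine (hg.abs_sub_le_div hδ y x).trans ?_
        rw [Metric.mem_ball, dist_eq_norm] at hy
        gcongr)
    rwa [Real.dist_eq] at this

/-- Mollification at radius r changes the integral by at most (r/δ) ∫ |f|; then r tends to 0. -/
theorem integral_mul_le_of_hasCompactSupport {δ : ℝ} (hδ : 0 < δ) {f : Space d → ℝ}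
    (hf : Integrable f) {B : ℝ}
    (hB : ∀ ζ : Space d → ℝ, ContDiff ℝ (⊤ : ℕ∞) ζ → HasCompactSupport ζ → LogLip δ ζ →
      ∫ x, f x * ζ x ≤ B) {g : Space d → ℝ} (hg : LogLip δ g) (hgs : HasCompactSupport g) :
    ∫ x, f x * g x ≤ B := by
  have hgc := hg.continuous hδ
  have hgi : Integrable (fun x => f x * g x) := by
    obtain ⟨C, hC⟩ := hgc.bounded_above_of_compact_support hgs
    exact hf.mul_bdd (c := C) hgc.aestronglyMeasurable (.of_forall hC)
  have key : ∀ r : ℝ, 0 < r → ∫ x, f x * g x ≤ B + r / δ * ∫ x, |f x| := by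
    intro r hr
    let φ : ContDiffBump (0 : Space d) := ⟨r / 2, r, by linarith, by linarith⟩
    obtain ⟨h1, h2, h3, h4⟩ := hg.sub_norm_convolution hδ hgs φ
    set ζ := φ.normed volume ⋆[ContinuousLinearMap.lsmul ℝ ℝ, volume] g
    have hζi : Integrable (fun x => f x * ζ x) := by
      obtain ⟨C, hC⟩ := h1.continuous.bounded_above_of_compact_support h2
      exact hf.mul_bdd (c := C) h1.continuous.aestronglyMeasurable (.of_forall hC)
    have h5 := hB ζ h1 h2 h3
    have h6 : (∫ x, f x * g x) - ∫ x, f x * ζ x ≤ r / δ * ∫ x, |f x| := by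
      rw [← integral_sub hgi hζi, ← integral_const_mul]
      refine integral_mono (hgi.sub hζi) (hf.abs.const_mul _) fun x => ?_
      have := h4 x
      simp only
      rw [← mul_sub]
      refine (le_abs_self _).trans ?_
      rw [abs_mul, mul_comm, abs_sub_comm]
      gcongr
    linarith
  have h1 : Tendsto (fun r : ℝ => B + r / δ * ∫ x, |f x|) (𝓝[>] 0)
      (𝓝 (B + 0 / δ * ∫ x, |f x|)) :=
    (Continuous.tendsto (by fun_prop) _).mono_left nhdsWithin_le_nhds
  rw [zero_div, zero_mul, add_zero] at h1
  exact ge_of_tendsto h1 (by filter_upwards [self_mem_nhdsWithin] with r hr using key r hr)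

/-- A slowly varying cutoff. -/
noncomputable def logCutoff (δ η : ℝ) (x : Space d) : ℝ :=
  max 0 (min 1 (2 - η * Real.log (‖x‖ / δ + 1)))

/-- The cost to the origin is 1-Lipschitz for the cost, and truncation does not increase Lipschitz
constants. A cutoff varying in this logarithmic variable thus has an arbitrarily small constant η.
-/
theorem abs_logCutoff_sub_le {δ η : ℝ} (hδ : 0 < δ) (hη : 0 ≤ η) (x y : Space d) :
    |logCutoff δ η x - logCutoff δ η y| ≤ η * Real.log (‖x - y‖ / δ + 1) := by
  have h1 : ∀ x y : Space d,
      Real.log (‖x‖ / δ + 1) - Real.log (‖y‖ / δ + 1) ≤ Real.log (‖x - y‖ / δ + 1) := by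
    intro x y
    have h2 : ‖x‖ ≤ ‖x - y‖ + ‖y‖ := by simpa using norm_add_le (x - y) y
    have := log_div_add_one_mono hδ (norm_nonneg x) h2
    have := log_div_add_one_add_le hδ (norm_nonneg (x - y)) (norm_nonneg y)
    linarith
  have h2 : |Real.log (‖x‖ / δ + 1) - Real.log (‖y‖ / δ + 1)| ≤ Real.log (‖x - y‖ / δ + 1) := by
    rw [abs_le]
    have := h1 y x
    rw [norm_sub_rev] at this
    exact ⟨by linarith, h1 x y⟩
  unfold logCutoff
  refine (abs_max_sub_max_le_max _ _ _ _).trans ?_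
  rw [sub_self, abs_zero, max_eq_right (abs_nonneg _)]
  refine (abs_min_sub_min_le_max _ _ _ _).trans ?_
  rw [sub_self, abs_zero, max_eq_right (abs_nonneg _)]
  rw [show ∀ a b : ℝ, 2 - η * a - (2 - η * b) = -(η * (a - b)) by intros; ring, abs_neg, abs_mul,
    abs_of_nonneg hη]
  gcongr

theorem hasCompactSupport_logCutoff {δ η : ℝ} (hδ : 0 < δ) (hη : 0 < η) :
    HasCompactSupport (logCutoff δ η : Space d → ℝ) := by
  refine HasCompactSupport.intro
    (isCompact_closedBall (0 : Space d) (δ * Real.exp (2 / η))) fun x hx => ?_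
  rw [Metric.mem_closedBall, dist_zero_right, not_le] at hx
  unfold logCutoff
  rw [max_eq_left]
  refine (min_le_right _ _).trans ?_
  have : 2 / η ≤ Real.log (‖x‖ / δ + 1) := by
    rw [Real.le_log_iff_exp_le (by positivity)]
    have : Real.exp (2 / η) ≤ ‖x‖ / δ := by rw [le_div_iff₀ hδ]; linarith
    linarith
  rw [div_le_iff₀ hη] at this
  linarith

/-- Multiplying g by a cutoff of Lipschitz constant η gives, by the product rule, the constant 1 +
Cη. Dividing by it yields an admissible function, and η tends to 0 along 1/(n + 1). -/
theorem integral_mul_le_of_bounded {δ : ℝ} (hδ : 0 < δ) {f : Space d → ℝ}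
    (hf : Integrable f) {B : ℝ}
    (hB : ∀ ζ : Space d → ℝ, ContDiff ℝ (⊤ : ℕ∞) ζ → HasCompactSupport ζ → LogLip δ ζ →
      ∫ x, f x * ζ x ≤ B) {g : Space d → ℝ} (hg : LogLip δ g) {C : ℝ} (hC : ∀ x, |g x| ≤ C) :
    ∫ x, f x * g x ≤ B := by
  have hgc := hg.continuous hδ
  have hC0 : 0 ≤ C := (abs_nonneg _).trans (hC 0)
  have key : ∀ n : ℕ, ∫ x, f x * (g x * logCutoff δ (n + 1 : ℝ)⁻¹ x) ≤
      (1 + C * (n + 1 : ℝ)⁻¹) * B := by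
    intro n
    set η : ℝ := (n + 1 : ℝ)⁻¹
    have hη : 0 < η := by positivity
    set k := 1 + C * η with hk
    have hk0 : 0 < k := by positivity
    have := integral_mul_le_of_hasCompactSupport hδ hf hB
      (g := fun x => k⁻¹ * (g x * logCutoff δ η x)) (fun x y => by
        rw [← mul_sub, inv_mul_le_iff₀ hk0]
        have h1 := abs_logCutoff_sub_le hδ hη.le x y
        have h2 := hg.abs_sub_le x y
        have h3 : |logCutoff δ η x| ≤ 1 := by
          unfold logCutoff
          rw [abs_of_nonneg (le_max_left _ _)]
          exact max_le zero_le_one (min_le_left _ _)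
        have h4 := hC y
        have h5 := log_div_add_one_nonneg hδ (norm_nonneg (x - y))
        calc g x * logCutoff δ η x - g y * logCutoff δ η y
            = (g x - g y) * logCutoff δ η x + g y * (logCutoff δ η x - logCutoff δ η y) := by ring
          _ ≤ |g x - g y| * |logCutoff δ η x| + |g y| * |logCutoff δ η x - logCutoff δ η y| := by
              rw [← abs_mul, ← abs_mul]
              exact add_le_add (le_abs_self _) (le_abs_self _)
          _ ≤ Real.log (‖x - y‖ / δ + 1) * 1 + C * (η * Real.log (‖x - y‖ / δ + 1)) := by
              gcongr
          _ = k * Real.log (‖x - y‖ / δ + 1) := by rw [hk]; ring)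
      (((hasCompactSupport_logCutoff hδ hη).mul_left).mul_left)
    have h2 : ∀ x, f x * (k⁻¹ * (g x * logCutoff δ η x)) =
      k⁻¹ * (f x * (g x * logCutoff δ η x)) := fun x => by ring
    simp_rw [h2] at this
    rwa [integral_const_mul, inv_mul_le_iff₀ hk0] at this
  have hinv : Tendsto (fun n : ℕ => (n + 1 : ℝ)⁻¹) atTop (𝓝 0) := by
    simpa using tendsto_one_div_add_atTop_nhds_zero_nat (𝕜 := ℝ)
  have lim1 : Tendsto (fun n : ℕ => ∫ x, f x * (g x * logCutoff δ (n + 1 : ℝ)⁻¹ x)) atTop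
      (𝓝 (∫ x, f x * g x)) := by
    refine tendsto_integral_of_dominated_convergence (fun x => |f x| * C) (fun n => ?_)
      (hf.abs.mul_const _) (fun n => .of_forall fun x => ?_) (.of_forall fun x => ?_)
    · refine hf.aestronglyMeasurable.mul (hgc.aestronglyMeasurable.mul ?_)
      unfold logCutoff
      exact Measurable.aestronglyMeasurable (by fun_prop)
    · have h3 : |logCutoff δ (n + 1 : ℝ)⁻¹ x| ≤ 1 := by
        unfold logCutoff
        rw [abs_of_nonneg (le_max_left _ _)]
        exact max_le zero_le_one (min_le_left _ _)
      rw [Real.norm_eq_abs, abs_mul, abs_mul]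
      gcongr
      exact (mul_le_mul (hC x) h3 (abs_nonneg _) hC0).trans (by simp)
    · have : Tendsto (fun n : ℕ => logCutoff δ (n + 1 : ℝ)⁻¹ x) atTop (𝓝 1) := by
        unfold logCutoff
        have h := (continuous_const (y := (0 : ℝ))).max ((continuous_const (y := (1 : ℝ))).min
          ((continuous_const (y := (2 : ℝ))).sub
            (continuous_id.mul (continuous_const (y := Real.log (‖x‖ / δ + 1))))))
        have := (h.tendsto 0).comp hinv
        simpa [Function.comp_def] using this
      simpa using (tendsto_const_nhds (x := f x)).mul ((tendsto_const_nhds (x := g x)).mul this)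
  have lim2 : Tendsto (fun n : ℕ => (1 + C * (n + 1 : ℝ)⁻¹) * B) atTop (𝓝 B) := by
    simpa using ((hinv.const_mul C).const_add 1).mul_const B
  exact le_of_tendsto_of_tendsto' lim1 lim2 key

theorem isFiniteMeasure_withDensity_ofReal' {f : Space d → ℝ} (hf : Integrable f) :
    IsFiniteMeasure (volume.withDensity fun x => ENNReal.ofReal (f x)) :=
  isFiniteMeasure_withDensity_ofReal hf.2

theorem integral_withDensity_ofReal {f H : Space d → ℝ} (hf : Integrable f) :
    ∫ x, H x ∂(volume.withDensity fun x => ENNReal.ofReal (f x)) = ∫ x, max (f x) 0 * H x := by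
  rw [integral_withDensity_eq_integral_toReal_smul₀ hf.aemeasurable.ennreal_ofReal
    (.of_forall fun _ => ENNReal.ofReal_lt_top)]
  simp only [ENNReal.toReal_ofReal', smul_eq_mul]

theorem integral_mul_eq_sub {f H : Space d → ℝ} (hf : Integrable f)
    (hH : AEStronglyMeasurable H) {C : ℝ} (hC : ∀ x, |H x| ≤ C) :
    ∫ x, f x * H x = ∫ x, H x ∂(volume.withDensity fun x => ENNReal.ofReal (f x)) -
      ∫ x, H x ∂(volume.withDensity fun x => ENNReal.ofReal (-f x)) := by
  rw [integral_withDensity_ofReal hf, integral_withDensity_ofReal (f := fun x => -f x) hf.neg,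
    ← integral_sub]
  · congr 1; ext x
    rw [← sub_mul]
    congr 1
    rcases le_total (f x) 0 with h | h
    · rw [max_eq_right h, max_eq_left (by simpa using h)]; simp
    · rw [max_eq_left h, max_eq_right (by simpa using h)]; simp
  · exact hf.pos_part.mul_bdd (c := C) hH (.of_forall hC)
  · exact hf.neg.pos_part.mul_bdd (c := C) hH (.of_forall hC)

/-- Equality of masses is not assumed: arbitrary constants of either sign are bounded and Lipschitz
for the cost, so the bound B extended to bounded functions already forces ∫ f = 0. -/
theorem exists_plan {δ : ℝ} (hδ : 0 < δ) {f : Space d → ℝ} (hf : Integrable f) {B : ℝ}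
    (hB : ∀ ζ : Space d → ℝ, ContDiff ℝ (⊤ : ℕ∞) ζ → HasCompactSupport ζ → LogLip δ ζ →
      ∫ x, f x * ζ x ≤ B) :
    ∃ π : Measure (Space d × Space d),
      π.fst = (volume.withDensity fun x => ENNReal.ofReal (f x)) ∧
      π.snd = (volume.withDensity fun x => ENNReal.ofReal (-f x)) ∧
      ∫⁻ z, logCost δ z.1 z.2 ∂π ≤ ENNReal.ofReal B := by
  have := isFiniteMeasure_withDensity_ofReal' hf
  have := isFiniteMeasure_withDensity_ofReal' hf.neg
  refine exists_coupling (c := fun x y : Space d => Real.log (‖x - y‖ / δ + 1))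
    (ν := volume.withDensity fun x => ENNReal.ofReal (-f x)) ?_ ?_ ?_ ?_ ?_
  · refine Continuous.log (by fun_prop) fun z => ?_
    positivity
  · simp
  · exact fun x y => log_div_add_one_nonneg hδ (norm_nonneg _)
  · intro x y z
    have h2 : ‖x - z‖ ≤ ‖x - y‖ + ‖y - z‖ := by simpa using norm_add_le (x - y) (y - z)
    exact (log_div_add_one_mono hδ (norm_nonneg _) h2).trans
      (log_div_add_one_add_le hδ (norm_nonneg _) (norm_nonneg _))
  · intro ζ hζ
    rw [← integral_mul_eq_sub hf ζ.continuous.aestronglyMeasurable ζ.norm_coe_le_norm]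
    exact integral_mul_le_of_bounded hδ hf hB hζ ζ.norm_coe_le_norm

theorem logKR_le_of_forall {δ : ℝ} (hδ : 0 < δ) {f g : Space d → ℝ}
    (hf : Integrable fun x => f x - g x) {B : ℝ}
    (hB : ∀ ζ : Space d → ℝ, ContDiff ℝ (⊤ : ℕ∞) ζ → HasCompactSupport ζ → LogLip δ ζ →
      ∫ x, (f x - g x) * ζ x ≤ B) :
    logKR δ f g ≤ ENNReal.ofReal B := by
  obtain ⟨π, h1, h2, h3⟩ := exists_plan hδ hf hB
  exact (iInf₂_le π ⟨h1, h2⟩).trans h3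

section Plan

variable {f H : Space d → ℝ} {π : Measure (Space d × Space d)}

theorem isFiniteMeasure_plan (hf : Integrable f)
    (h1 : π.fst = volume.withDensity fun x => ENNReal.ofReal (f x)) : IsFiniteMeasure π := by
  have := isFiniteMeasure_withDensity_ofReal' hf
  refine ⟨?_⟩
  rw [← Measure.fst_univ, h1]
  exact measure_lt_top _ _

theorem quasiMeasurePreserving_fst_plan
    (h1 : π.fst = volume.withDensity fun x => ENNReal.ofReal (f x)) :
    Measure.QuasiMeasurePreserving Prod.fst π volume :=
  ⟨measurable_fst, by
    rw [show Measure.map Prod.fst π = π.fst from rfl, h1]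
    exact withDensity_absolutelyContinuous _ _⟩

theorem quasiMeasurePreserving_snd_plan
    (h2 : π.snd = volume.withDensity fun x => ENNReal.ofReal (f x)) :
    Measure.QuasiMeasurePreserving Prod.snd π volume :=
  ⟨measurable_snd, by
    rw [show Measure.map Prod.snd π = π.snd from rfl, h2]
    exact withDensity_absolutelyContinuous _ _⟩

theorem integral_mul_eq_integral_plan (hf : Integrable f)
    (hH : AEStronglyMeasurable H) {C : ℝ} (hC : ∀ x, |H x| ≤ C)
    (h1 : π.fst = volume.withDensity fun x => ENNReal.ofReal (f x))
    (h2 : π.snd = volume.withDensity fun x => ENNReal.ofReal (-f x)) :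
    Integrable (fun z : Space d × Space d => H z.1 - H z.2) π ∧
      ∫ x, f x * H x = ∫ z, (H z.1 - H z.2) ∂π := by
  have := isFiniteMeasure_plan hf h1
  have m1 := hH.comp_quasiMeasurePreserving (quasiMeasurePreserving_fst_plan h1)
  have m2 := hH.comp_quasiMeasurePreserving (quasiMeasurePreserving_snd_plan h2)
  have i1 : Integrable (fun z : Space d × Space d => H z.1) π :=
    Integrable.of_bound m1 C (.of_forall fun z => hC _)
  have i2 : Integrable (fun z : Space d × Space d => H z.2) π :=
    Integrable.of_bound m2 C (.of_forall fun z => hC _)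
  refine ⟨i1.sub i2, ?_⟩
  rw [integral_mul_eq_sub hf hH hC, integral_sub i1 i2, ← h1, ← h2, Measure.fst, Measure.snd,
    integral_map measurable_fst.aemeasurable, integral_map measurable_snd.aemeasurable]
  · exact hH.mono_ac (quasiMeasurePreserving_snd_plan h2).absolutelyContinuous
  · exact hH.mono_ac (quasiMeasurePreserving_fst_plan h1).absolutelyContinuous

/-- Estimate of a linear functional by a transport plan. -/
theorem ofReal_integral_mul_le_lintegral_plan (hf : Integrable f)
    (hH : AEStronglyMeasurable H) {C : ℝ} (hC : ∀ x, |H x| ≤ C)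
    (h1 : π.fst = volume.withDensity fun x => ENNReal.ofReal (f x))
    (h2 : π.snd = volume.withDensity fun x => ENNReal.ofReal (-f x))
    {k : Space d × Space d → ℝ≥0∞} (hk : ∀ᵐ z ∂π, ENNReal.ofReal (H z.1 - H z.2) ≤ k z) :
    ENNReal.ofReal (∫ x, f x * H x) ≤ ∫⁻ z, k z ∂π := by
  obtain ⟨i, e⟩ := integral_mul_eq_integral_plan hf hH hC h1 h2
  rw [e]
  refine le_trans ?_ (lintegral_mono_ae hk)
  rw [← ENNReal.ofReal_toReal (i.lintegral_lt_top).ne]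
  refine ENNReal.ofReal_le_ofReal ?_
  rw [integral_eq_lintegral_pos_part_sub_lintegral_neg_part i]
  exact sub_le_self _ ENNReal.toReal_nonneg

end Plan

theorem ofReal_integral_mul_le_logKR {δ : ℝ} (hδ : 0 < δ) {f g : Space d → ℝ}
    (hf : Integrable fun x => f x - g x) {ζ : Space d → ℝ} (hζ : LogLip δ ζ)
    {C : ℝ} (hC : ∀ x, |ζ x| ≤ C) :
    ENNReal.ofReal (∫ x, (f x - g x) * ζ x) ≤ logKR δ f g := by
  refine le_iInf₂ fun π hπ => ?_
  exact ofReal_integral_mul_le_lintegral_plan hf (hζ.continuous hδ).aestronglyMeasurable hC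
    hπ.1 hπ.2 (.of_forall fun z => ENNReal.ofReal_le_ofReal (hζ _ _))

end AdvDiff

/-! ### Translations in L¹, the isotropic noise, and symmetric second differences. -/

namespace AdvDiff

open Filter Topology
open scoped RealInnerProductSpace

variable {d : ℕ}

section Translation

variable {F : Type*} [NormedAddCommGroup F]

theorem tendsto_lintegral_enorm_translate_sub {f : Space d → F} (hf : Integrable f) :
    Tendsto (fun a : Space d => ∫⁻ x, ‖f (x + a) - f x‖ₑ) (𝓝 0) (𝓝 0) := by
  let τ : Space d → C(Space d, Space d) := fun a => ⟨fun x => x + a, by fun_prop⟩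
  have hτ : Continuous τ :=
    ContinuousMap.continuous_of_continuous_uncurry _ (by
      change Continuous fun z : Space d × Space d => z.2 + z.1
      fun_prop)
  have hm : ∀ a, MeasurePreserving (τ a) volume volume := fun a =>
    measurePreserving_add_right volume a
  have hf1 : MemLp f 1 volume := memLp_one_iff_integrable.2 hf
  have h1 := (tendsto_const_nhds (x := hf1.toLp f) (f := 𝓝 (0 : Space d))).compMeasurePreservingLp
    (hτ.tendsto 0) hm (hm 0) ENNReal.one_ne_top
  rw [tendsto_iff_edist_tendsto_0] at h1
  refine h1.congr fun a => ?_
  rw [Lp.toLp_compMeasurePreserving, Lp.toLp_compMeasurePreserving, Lp.edist_toLp_toLp,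
    eLpNorm_one_eq_lintegral_enorm]
  simp [τ]

/-- The L¹ translation modulus is what replaces derivatives of the test function in all error terms
below. -/
theorem exists_forall_integral_norm_translate_sub_le {f : Space d → F} (hf : Integrable f)
    {η : ℝ} (hη : 0 < η) :
    ∃ ρ > 0, ∀ a : Space d, ‖a‖ ≤ ρ → ∫ x, ‖f (x + a) - f x‖ ≤ η := by
  have h1 := (tendsto_lintegral_enorm_translate_sub hf).eventually
    (Iio_mem_nhds (ENNReal.ofReal_pos.2 hη))
  obtain ⟨ρ, hρ, h⟩ := Metric.eventually_nhds_iff.1 h1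
  refine ⟨ρ / 2, by positivity, fun a ha => ?_⟩
  have h2 : ∫⁻ x, ‖f (x + a) - f x‖ₑ < ENNReal.ofReal η := h (by
    rw [dist_zero_right]; linarith)
  have hfa : Integrable fun x => f (x + a) - f x := (hf.comp_add_right a).sub hf
  rw [integral_norm_eq_lintegral_enorm hfa.aestronglyMeasurable]
  exact ENNReal.toReal_le_of_le_ofReal hη.le h2.le

end Translation

/-- The uniform distribution on the unit ball. -/
noncomputable def ballNoise (d : ℕ) : Measure (Space d) :=
  (volume (Metric.ball (0 : Space d) 1))⁻¹ • volume.restrict (Metric.ball 0 1)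

instance isProbabilityMeasure_ballNoise : IsProbabilityMeasure (ballNoise d) := by
  refine ⟨?_⟩
  rw [ballNoise, Measure.smul_apply, Measure.restrict_apply_univ, smul_eq_mul]
  exact ENNReal.inv_mul_cancel (Metric.measure_ball_pos _ _ one_pos).ne' measure_ball_lt_top.ne

theorem ae_norm_lt_one_ballNoise : ∀ᵐ y ∂(ballNoise d), ‖y‖ < 1 := by
  refine Measure.ae_smul_measure ?_ _
  filter_upwards [ae_restrict_mem Metric.isOpen_ball.measurableSet] with y hy
  simpa using hy

/-- Used for y ↦ -y, which removes the first-order term of the noise, and for reflections, which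
make its covariance scalar. -/
theorem measurePreserving_ballNoise (e : Space d ≃ₗᵢ[ℝ] Space d) :
    MeasurePreserving e (ballNoise d) (ballNoise d) := by
  have h := e.measurePreserving.restrict_preimage (s := Metric.ball (0 : Space d) 1)
    Metric.isOpen_ball.measurableSet
  have h2 : e ⁻¹' Metric.ball (0 : Space d) 1 = Metric.ball 0 1 := by
    ext y; simp
  rw [h2] at h
  exact h.smul_measure _

theorem integrable_ballNoise_of_continuous {F : Type*} [NormedAddCommGroup F] {g : Space d → F}
    (hg : Continuous g) : Integrable g (ballNoise d) := by
  refine Integrable.smul_measure ?_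
    (ENNReal.inv_ne_top.2 (Metric.measure_ball_pos _ _ one_pos).ne')
  have : IntegrableOn g (Metric.closedBall 0 1) :=
    hg.continuousOn.integrableOn_compact (isCompact_closedBall _ _)
  exact this.mono_set Metric.ball_subset_closedBall

theorem integral_ballNoise_neg {F : Type*} [NormedAddCommGroup F] [NormedSpace ℝ F]
    (g : Space d → F) : ∫ y, g (-y) ∂(ballNoise d) = ∫ y, g y ∂(ballNoise d) :=
  (measurePreserving_ballNoise (LinearIsometryEquiv.neg ℝ)).integral_comp
    (LinearIsometryEquiv.neg ℝ).toHomeomorph.measurableEmbedding g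

/-- The second moment of the uniform distribution on the unit ball is isotropic. -/
theorem exists_integral_inner_mul_inner_ballNoise (hd : 1 ≤ d) :
    ∃ m : ℝ, 0 < m ∧ ∀ v w : Space d, ∫ y, ⟪v, y⟫ * ⟪w, y⟫ ∂(ballNoise d) = m * ⟪v, w⟫ := by
  let Q : Space d → ℝ := fun v => ∫ y, ⟪v, y⟫ * ⟪v, y⟫ ∂(ballNoise d)
  -- Vectors of equal norm are exchanged by the reflection in the hyperplane orthogonal to v - w, so
  -- the quadratic form depends on the norm alone.
  have hQ : ∀ v w : Space d, ‖v‖ = ‖w‖ → Q v = Q w := fun v w hvw => by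
    let R : Space d ≃ₗᵢ[ℝ] Space d := (ℝ ∙ (v - w))ᗮ.reflection
    have hR : R v = w := Submodule.reflection_sub hvw
    have := (measurePreserving_ballNoise R).integral_comp R.toHomeomorph.measurableEmbedding
      (fun y => ⟪w, y⟫ * ⟪w, y⟫)
    simp only [Q]
    rw [← this]
    simp_rw [← hR, LinearIsometryEquiv.inner_map_map]
  let e : Space d := EuclideanSpace.single ⟨0, hd⟩ 1
  have he : ‖e‖ = 1 := by simp [e]
  have hQ2 : ∀ v, Q v = Q e * ‖v‖ ^ 2 := fun v => by
    have h1 : ‖v‖ = ‖(‖v‖ • e)‖ := by simp [norm_smul, he]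
    rw [hQ _ _ h1]
    simp only [Q, ← integral_mul_const, real_inner_smul_left]
    congr 1; ext y; ring
  have hi : ∀ v w : Space d, Integrable (fun y => ⟪v, y⟫ * ⟪w, y⟫) (ballNoise d) := fun v w =>
    integrable_ballNoise_of_continuous (by fun_prop)
  refine ⟨Q e, ?_, fun v w => ?_⟩
  · have h0 : 0 ≤ Q e := integral_nonneg fun y => mul_self_nonneg _
    refine lt_of_le_of_ne h0 fun h => ?_
    have h1 : (fun y => ⟪e, y⟫ * ⟪e, y⟫) =ᵐ[ballNoise d] 0 :=
      (integral_eq_zero_iff_of_nonneg (fun y => mul_self_nonneg _) (hi e e)).1 h.symm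
    have hpos := (Metric.measure_ball_pos volume (0 : Space d) one_pos).ne'
    have h2 : (fun y => ⟪e, y⟫ * ⟪e, y⟫) =ᵐ[volume.restrict (Metric.ball 0 1)] 0 := by
      rw [ballNoise] at h1
      exact (Measure.ae_ennreal_smul_measure_iff
        (ENNReal.inv_ne_zero.2 measure_ball_lt_top.ne)).1 h1
    have h3 : EqOn (fun y => ⟪e, y⟫ * ⟪e, y⟫) 0 (Metric.ball (0 : Space d) 1) :=
      Measure.eqOn_open_of_ae_eq h2 Metric.isOpen_ball (by fun_prop) (by fun_prop)
    have h4 := h3 (x := (1 / 2 : ℝ) • e) (by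
      rw [Metric.mem_ball, dist_zero_right, norm_smul, he]; norm_num)
    simp [real_inner_smul_right, he] at h4
  -- Polarisation of the quadratic form.
  · have h1 : ∫ y, ⟪v + w, y⟫ * ⟪v + w, y⟫ ∂(ballNoise d) =
        Q v + 2 * (∫ y, ⟪v, y⟫ * ⟪w, y⟫ ∂(ballNoise d)) + Q w := by
      simp only [Q]
      rw [← integral_const_mul, ← integral_add (hi v v) ((hi v w).const_mul 2),
        ← integral_add (by exact (hi v v).add ((hi v w).const_mul 2)) (hi w w)]
      congr 1; ext y
      rw [inner_add_left]; ring
    have h2 := hQ2 (v + w)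
    rw [norm_add_sq_real] at h2
    have h3 := hQ2 v
    have h4 := hQ2 w
    change Q (v + w) = _ at h1
    linarith

/-- The hypothesis makes ψ'(s) - cs an ε-Lipschitz function on [-1,1]. The derivative of ψ(s) +
ψ(-s) - cs² is its increment between -s and s, hence at most 2ε for s in [0,1]. -/
theorem abs_second_difference_sub_le {ψ ψ' ψ'' : ℝ → ℝ} {c ε : ℝ}
    (h1 : ∀ s, HasDerivAt ψ (ψ' s) s) (h2 : ∀ s, HasDerivAt ψ' (ψ'' s) s)
    (h3 : ∀ s, |s| ≤ 1 → |ψ'' s - c| ≤ ε) :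
    |ψ 1 + ψ (-1) - 2 * ψ 0 - c| ≤ 2 * ε := by
  have hb : ∀ s ∈ Icc (-1 : ℝ) 1, ∀ t ∈ Icc (-1 : ℝ) 1,
      ‖(ψ' s - c * s) - (ψ' t - c * t)‖ ≤ ε * ‖s - t‖ := by
    intro s hs t ht
    refine (convex_Icc (-1 : ℝ) 1).norm_image_sub_le_of_norm_hasDerivWithin_le
      (f := fun s => ψ' s - c * s) (f' := fun s => ψ'' s - c) (fun x _ => ?_) (fun x hx => h3 x (abs_le.2 hx)) ht hs
    have := (h2 x).sub ((hasDerivAt_id x).const_mul c)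
    rw [mul_one] at this
    exact this.hasDerivWithinAt
  have hε : 0 ≤ ε := (abs_nonneg _).trans (h3 0 (by simp))
  have := (convex_Icc (0 : ℝ) 1).norm_image_sub_le_of_norm_hasDerivWithin_le
    (f := fun s => ψ s + ψ (-s) - c * s ^ 2)
    (f' := fun s => (ψ' s - c * s) - (ψ' (-s) - c * (-s))) (C := 2 * ε) (x := 0) (y := 1)
    (fun x _ => by
      have h4 := (h1 (-x)).comp x (hasDerivAt_neg x)
      have h5 := ((h1 x).add h4).sub ((hasDerivAt_pow 2 x).const_mul c)
      refine HasDerivAt.hasDerivWithinAt (h5.congr_deriv ?_)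
      push_cast; ring)
    (fun x hx => by
      refine (hb x ⟨by linarith [hx.1], hx.2⟩ (-x) ⟨by linarith [hx.2], by linarith [hx.1]⟩).trans ?_
      have : ‖x - -x‖ ≤ 2 := by
        rw [Real.norm_eq_abs, abs_le]; constructor <;> linarith [hx.1, hx.2]
      nlinarith) (by simp) (by simp)
  simp only [Real.norm_eq_abs] at this
  convert this using 1
  · congr 1; simp; ring
  · simp

theorem aestronglyMeasurable_clm_apply {α F F' : Type*} [MeasurableSpace α]
    [NormedAddCommGroup F] [NormedSpace ℝ F] [NormedAddCommGroup F'] [NormedSpace ℝ F']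
    {μ : Measure α}
    {A : α → F →L[ℝ] F'} {v : α → F} (hA : AEStronglyMeasurable A μ)
    (hv : AEStronglyMeasurable v μ) : AEStronglyMeasurable (fun x => A x (v x)) μ :=
  isBoundedBilinearMap_apply.continuous.comp_aestronglyMeasurable (hA.prodMk hv)

theorem hasDerivAt_integral_mul_translate {G ζ : Space d → ℝ} (hG : Integrable G)
    (hζ : ContDiff ℝ (⊤ : ℕ∞) ζ) (hζs : HasCompactSupport ζ) {K : ℝ}
    (hK : ∀ x, ‖fderiv ℝ ζ x‖ ≤ K) (y : Space d) (s : ℝ) :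
    HasDerivAt (fun s : ℝ => ∫ x, G x * ζ (x + s • y))
      (∫ x, G x * fderiv ℝ ζ (x + s • y) y) s := by
  have hd := hζ.continuous_fderiv (by simp)
  obtain ⟨C, hC⟩ := hζ.continuous.bounded_above_of_compact_support hζs
  refine (hasDerivAt_integral_of_dominated_loc_of_deriv_le (bound := fun x => ‖G x‖ * (K * ‖y‖))
    (F' := fun s x => G x * fderiv ℝ ζ (x + s • y) y)
    univ_mem (.of_forall fun s => ?_) ?_ ?_ ?_ (hG.norm.mul_const _) ?_).2
  · exact hG.aestronglyMeasurable.mul (hζ.continuous.comp (by fun_prop)).aestronglyMeasurable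
  · exact hG.mul_bdd (c := C) (hζ.continuous.comp (by fun_prop)).aestronglyMeasurable
      (.of_forall fun x => hC _)
  · exact hG.aestronglyMeasurable.mul
      ((hd.comp (by fun_prop)).clm_apply continuous_const).aestronglyMeasurable
  · refine .of_forall fun x s _ => ?_
    rw [norm_mul]
    gcongr
    exact (ContinuousLinearMap.le_opNorm _ _).trans (mul_le_mul_of_nonneg_right (hK _) (norm_nonneg _))
  · refine .of_forall fun x s _ => ?_
    have h1 := (hζ.differentiable (by simp) (x + s • y)).hasFDerivAt
    have h2 : HasDerivAt (fun s : ℝ => x + s • y) y s := by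
      simpa using ((hasDerivAt_id s).smul_const y).const_add x
    exact (h1.comp_hasDerivAt s h2).const_mul _

/-- Second-order expansion of symmetric differences, tested with Lipschitz functions. -/
theorem abs_integral_second_difference_le {θ : Space d → ℝ} {Dθ : Space d → Space d →L[ℝ] ℝ}
    (hθ : Integrable θ) (hDθ : Integrable Dθ) (hw : HasWeakFDeriv θ Dθ)
    {ζ : Space d → ℝ} (hζ : ContDiff ℝ (⊤ : ℕ∞) ζ) (hζs : HasCompactSupport ζ) {K : ℝ}
    (hK : ∀ x, ‖fderiv ℝ ζ x‖ ≤ K) {y : Space d} {η : ℝ}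
    (hη : ∀ a : Space d, ‖a‖ ≤ ‖y‖ → ∫ x, ‖Dθ (x + a) - Dθ x‖ ≤ η) :
    |((∫ x, θ x * ζ (x + y)) + (∫ x, θ x * ζ (x + -y)) - 2 * (∫ x, θ x * ζ x)) +
      ∫ x, Dθ x y * fderiv ℝ ζ x y| ≤ 2 * (K * ‖y‖ ^ 2 * η) := by
  have hK0 : 0 ≤ K := (norm_nonneg _).trans (hK 0)
  have hd := hζ.continuous_fderiv (by simp)
  have hDy : Integrable (fun x => Dθ x y) := hDθ.apply_continuousLinearMap y
  have h1 := hasDerivAt_integral_mul_translate hθ hζ hζs hK y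
  have h2 := hasDerivAt_integral_mul_translate hDy hζ hζs hK y
  -- One derivative is moved onto θ, so that the second derivative in s of the translated integral
  -- involves only the first derivative of ζ.
  have h3 : ∀ s : ℝ, ∫ x, θ x * fderiv ℝ ζ (x + s • y) y = -∫ x, Dθ x y * ζ (x + s • y) := by
    intro s
    have := hw.integral_eq (fun x => ζ (x + s • y)) (hζ.comp (contDiff_id.add contDiff_const))
      (hζs.comp_homeomorph (Homeomorph.addRight (s • y))) y
    simp only [fderiv_comp_add_right, smul_eq_mul] at this
    simpa only [mul_comm] using this
  simp_rw [h3] at h1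
  have h4 := abs_second_difference_sub_le h1 (fun s => (h2 s).neg)
    (c := -∫ x, Dθ x y * fderiv ℝ ζ x y) (ε := K * ‖y‖ ^ 2 * η) (fun s hs => by
      have hi : ∀ D : Space d → Space d →L[ℝ] ℝ, Integrable D →
          Integrable (fun x => D x y * fderiv ℝ ζ x y) := fun D hD =>
        (hD.apply_continuousLinearMap y).mul_bdd (c := K * ‖y‖)
          (hd.clm_apply continuous_const).aestronglyMeasurable
          (.of_forall fun x => (ContinuousLinearMap.le_opNorm _ _).trans (mul_le_mul_of_nonneg_right (hK _) (norm_nonneg _)))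
      have hDs : Integrable fun x => Dθ (x + -(s • y)) := hDθ.comp_add_right (-(s • y))
      -- The translation is moved from ζ to Dθ, where it is measured in L¹ uniformly in ζ.
      have h5 : ∫ x, Dθ x y * fderiv ℝ ζ (x + s • y) y =
          ∫ x, Dθ (x + -(s • y)) y * fderiv ℝ ζ x y := by
        rw [← integral_add_right_eq_self (fun x => Dθ (x + -(s • y)) y * fderiv ℝ ζ x y) (s • y)]
        simp
      rw [h5, neg_sub_neg, ← integral_sub (hi _ hDθ) (hi _ hDs)]
      have hb : ‖-(s • y)‖ ≤ ‖y‖ := by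
        rw [norm_neg, norm_smul, Real.norm_eq_abs]
        exact mul_le_of_le_one_left (norm_nonneg _) hs
      have h6 := hη _ hb
      refine (abs_integral_le_integral_abs).trans ?_
      calc ∫ x, |Dθ x y * fderiv ℝ ζ x y - Dθ (x + -(s • y)) y * fderiv ℝ ζ x y|
          ≤ ∫ x, ‖Dθ (x + -(s • y)) - Dθ x‖ * (K * ‖y‖ ^ 2) := by
            refine integral_mono ((hi _ hDθ).sub (hi _ hDs)).abs
              ((hDs.sub hDθ).norm.mul_const _) fun x => ?_
            simp only
            rw [← sub_mul, abs_mul]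
            have h7 : |Dθ x y - Dθ (x + -(s • y)) y| ≤ ‖Dθ (x + -(s • y)) - Dθ x‖ * ‖y‖ := by
              rw [abs_sub_comm]
              exact (Dθ (x + -(s • y)) - Dθ x).le_opNorm y
            have h8 : |fderiv ℝ ζ x y| ≤ K * ‖y‖ :=
              (ContinuousLinearMap.le_opNorm _ _).trans (mul_le_mul_of_nonneg_right (hK _) (norm_nonneg _))
            calc _ ≤ (‖Dθ (x + -(s • y)) - Dθ x‖ * ‖y‖) * (K * ‖y‖) := by gcongr
              _ = _ := by ring
        _ ≤ K * ‖y‖ ^ 2 * η := by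
            rw [integral_mul_const, mul_comm]
            gcongr)
  simpa using h4

end AdvDiff

/-! ### One Euler–Maruyama step and its effect on the transport cost. -/

namespace AdvDiff

open Filter Topology
open scoped RealInnerProductSpace

variable {d : ℕ}

/-- Average over balls of radius `r`. -/
noncomputable def ballAvg {F : Type*} [NormedAddCommGroup F] [NormedSpace ℝ F]
    (r : ℝ) (g : Space d → F) (x : Space d) : F :=
  ∫ y, g (x + r • y) ∂(ballNoise d)

theorem continuous_ballAvg_of_bounded {F : Type*} [NormedAddCommGroup F] [NormedSpace ℝ F]
    {g : Space d → F} (hg : Continuous g) {C : ℝ} (hC : ∀ x, ‖g x‖ ≤ C) (r : ℝ) :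
    Continuous (ballAvg r g) :=
  continuous_of_dominated (bound := fun _ => C)
    (fun x => (hg.comp (by fun_prop)).aestronglyMeasurable)
    (fun x => .of_forall fun y => hC _) (integrable_const _)
    (.of_forall fun y => hg.comp (by fun_prop))

theorem norm_ballAvg_le {F : Type*} [NormedAddCommGroup F] [NormedSpace ℝ F]
    {g : Space d → F} {C : ℝ} (hC : ∀ x, ‖g x‖ ≤ C) (r : ℝ) (x : Space d) :
    ‖ballAvg r g x‖ ≤ C := by
  have := norm_integral_le_of_norm_le_const (μ := ballNoise d) (f := fun y => g (x + r • y))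
    (.of_forall fun y => hC _)
  simpa [ballAvg] using this

/-- Diffusion is free because of this: both ends of a plan receive the same noise, and averaging
translates preserves the Lipschitz property. -/
theorem LogLip.ballAvg {δ : ℝ} {ζ : Space d → ℝ} (hδ : 0 < δ) (h : LogLip δ ζ) (r : ℝ) :
    LogLip δ (AdvDiff.ballAvg r ζ) := by
  intro x y
  have hc := h.continuous hδ
  have hi : ∀ x, Integrable (fun t => ζ (x + r • t)) (ballNoise d) := fun x =>
    integrable_ballNoise_of_continuous (hc.comp (by fun_prop))
  unfold AdvDiff.ballAvg
  rw [← integral_sub (hi x) (hi y)]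
  refine (integral_mono ((hi x).sub (hi y))
    (integrable_const (Real.log (‖x - y‖ / δ + 1))) fun t => ?_).trans ?_
  · have := h (x + r • t) (y + r • t)
    rwa [add_sub_add_right_eq_sub] at this
  · simp

theorem integrable_prod_noise {F : Type*} [NormedAddCommGroup F] {k : Space d × Space d → F}
    {w : Space d → ℝ} (hw : Integrable w)
    (hk : AEStronglyMeasurable k ((ballNoise d).prod volume))
    (hb : ∀ y x, ‖y‖ < 1 → ‖k (y, x)‖ ≤ w x) :
    Integrable k ((ballNoise d).prod volume) := by
  have h1 : Integrable (fun z : Space d × Space d => w z.2) ((ballNoise d).prod volume) :=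
    hw.comp_snd (ballNoise d)
  refine h1.mono' hk ?_
  have := Measure.quasiMeasurePreserving_fst (μ := ballNoise d) (ν := (volume : Measure (Space d)))
  filter_upwards [this.ae ae_norm_lt_one_ballNoise] with z hz using hb z.1 z.2 hz

section Diffusion

variable {θ : Space d → ℝ} {Dθ : Space d → Space d →L[ℝ] ℝ}

/-- The gradient vector field associated with a derivative. -/
noncomputable def gradOf (D : Space d →L[ℝ] ℝ) : Space d :=
  (InnerProductSpace.toDual ℝ (Space d)).symm D

theorem inner_gradOf (D : Space d →L[ℝ] ℝ) (y : Space d) : ⟪gradOf D, y⟫ = D y :=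
  InnerProductSpace.toDual_symm_apply

theorem norm_gradOf (D : Space d →L[ℝ] ℝ) : ‖gradOf D‖ = ‖D‖ :=
  (InnerProductSpace.toDual ℝ (Space d)).symm.norm_map D

theorem continuous_gradOf : Continuous (gradOf : (Space d →L[ℝ] ℝ) → Space d) :=
  (InnerProductSpace.toDual ℝ (Space d)).symm.continuous

/-- Averaging at radius r acts on θ as (r² m/2) times the Laplacian. The error depends on ζ only
through its gradient bound K, the rest being the translation modulus of Dθ. -/
theorem abs_integral_ballAvg_sub_le
    (hθ : Integrable θ) (hDθ : Integrable Dθ) (hw : HasWeakFDeriv θ Dθ) {m : ℝ}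
    (hm : ∀ v w : Space d, ∫ y, ⟪v, y⟫ * ⟪w, y⟫ ∂(ballNoise d) = m * ⟪v, w⟫)
    {ζ : Space d → ℝ} (hζ : ContDiff ℝ (⊤ : ℕ∞) ζ) (hζs : HasCompactSupport ζ) {K : ℝ}
    (hK : ∀ x, ‖fderiv ℝ ζ x‖ ≤ K) {r η : ℝ} (hr : 0 ≤ r)
    (hη : ∀ a : Space d, ‖a‖ ≤ r → ∫ x, ‖Dθ (x + a) - Dθ x‖ ≤ η) :
    |(∫ x, θ x * ballAvg r ζ x) - (∫ x, θ x * ζ x) +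
      r ^ 2 * m / 2 * ∫ x, fderiv ℝ ζ x (gradOf (Dθ x))| ≤ K * r ^ 2 * η := by
  have hK0 : 0 ≤ K := (norm_nonneg _).trans (hK 0)
  have hd := hζ.continuous_fderiv (by simp)
  obtain ⟨C, hC⟩ := hζ.continuous.bounded_above_of_compact_support hζs
  have i1 : Integrable (fun z : Space d × Space d => θ z.2 * ζ (z.2 + r • z.1))
      ((ballNoise d).prod volume) := by
    refine integrable_prod_noise (w := fun x => ‖θ x‖ * C) (hθ.norm.mul_const _) ?_ ?_
    · exact hθ.aestronglyMeasurable.comp_snd.mul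
        (hζ.continuous.comp (by fun_prop)).aestronglyMeasurable
    · intro y x _
      rw [norm_mul]
      gcongr
      exact hC _
  have i2 : Integrable (fun z : Space d × Space d => Dθ z.2 (r • z.1) *
      fderiv ℝ ζ z.2 (r • z.1)) ((ballNoise d).prod volume) := by
    refine integrable_prod_noise (w := fun x => ‖Dθ x‖ * (K * r ^ 2)) (hDθ.norm.mul_const _) ?_ ?_
    · exact (aestronglyMeasurable_clm_apply hDθ.aestronglyMeasurable.comp_snd
        (by fun_prop : Continuous fun z : Space d × Space d => r • z.1).aestronglyMeasurable).mul
        ((hd.comp continuous_snd).clm_apply (by fun_prop)).aestronglyMeasurable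
    · intro y x hy
      have hy' : ‖r • y‖ ≤ r := by
        rw [norm_smul, Real.norm_of_nonneg hr]
        exact mul_le_of_le_one_right hr hy.le
      rw [norm_mul]
      calc _ ≤ (‖Dθ x‖ * r) * (K * r) := by
            gcongr
            · exact (ContinuousLinearMap.le_opNorm _ _).trans (by gcongr)
            · exact (ContinuousLinearMap.le_opNorm _ _).trans (by gcongr; exact hK _)
        _ = _ := by ring
  set a : Space d → ℝ := fun y => ∫ x, θ x * ζ (x + r • y) with ha
  set b : Space d → ℝ := fun y => ∫ x, Dθ x (r • y) * fderiv ℝ ζ x (r • y) with hb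
  have ia : Integrable a (ballNoise d) := i1.integral_prod_left
  have ib : Integrable b (ballNoise d) := i2.integral_prod_left
  have ian : Integrable (fun y => a (-y)) (ballNoise d) :=
    (measurePreserving_ballNoise (LinearIsometryEquiv.neg ℝ)).integrable_comp_of_integrable ia
  have e1 : ∫ y, a y ∂(ballNoise d) = ∫ x, θ x * ballAvg r ζ x := by
    rw [ha, integral_integral_swap i1]
    simp_rw [integral_const_mul]
    rfl
  have e2 : ∫ y, b y ∂(ballNoise d) = r ^ 2 * m * ∫ x, fderiv ℝ ζ x (gradOf (Dθ x)) := by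
    rw [hb, integral_integral_swap i2, ← integral_const_mul]
    congr 1; ext x
    have h1 : ∀ y : Space d, Dθ x (r • y) * fderiv ℝ ζ x (r • y) =
        r ^ 2 * (⟪gradOf (Dθ x), y⟫ * ⟪gradOf (fderiv ℝ ζ x), y⟫) := fun y => by
      rw [inner_gradOf, inner_gradOf]
      simp only [map_smul, smul_eq_mul]; ring
    simp_rw [h1]
    rw [integral_const_mul, hm, real_inner_comm, inner_gradOf]
    ring
  -- By symmetry of the noise, y and -y are averaged together, which makes the second-difference
  -- estimate applicable to each pair.
  have key : |∫ y, (a y + a (-y) - 2 * (∫ x, θ x * ζ x) + b y) ∂(ballNoise d)| ≤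
      2 * (K * r ^ 2 * η) := by
    have := norm_integral_le_of_norm_le_const (μ := ballNoise d)
      (f := fun y => a y + a (-y) - 2 * (∫ x, θ x * ζ x) + b y) (C := 2 * (K * r ^ 2 * η)) (by
        filter_upwards [ae_norm_lt_one_ballNoise] with y hy
        have hy' : ‖r • y‖ ≤ r := by
          rw [norm_smul, Real.norm_of_nonneg hr]
          exact mul_le_of_le_one_right hr hy.le
        have := abs_integral_second_difference_le hθ hDθ hw hζ hζs hK (y := r • y)
          (fun a ha => hη a (ha.trans hy'))
        simp only [ha, hb, smul_neg]
        refine this.trans ?_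
        have hη0 : 0 ≤ η := (integral_nonneg fun _ => norm_nonneg _).trans (hη 0 (by simpa))
        gcongr)
    simpa using this
  have e3 : ∫ y, (a y + a (-y) - 2 * (∫ x, θ x * ζ x) + b y) ∂(ballNoise d) =
      2 * ((∫ x, θ x * ballAvg r ζ x) - (∫ x, θ x * ζ x) +
        r ^ 2 * m / 2 * ∫ x, fderiv ℝ ζ x (gradOf (Dθ x))) := by
    rw [integral_add (by exact (ia.add ian).sub (integrable_const _)) ib,
      integral_sub (by exact ia.add ian) (integrable_const _), integral_add ia ian,
      integral_ballNoise_neg a, e1, e2]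
    simp
    ring
  rw [e3, abs_mul, abs_of_pos (by norm_num : (0 : ℝ) < 2)] at key
  linarith

end Diffusion

section Advection

theorem integral_ballNoise_eq {F : Type*} [NormedAddCommGroup F] [NormedSpace ℝ F]
    (g : Space d → F) :
    ∫ y, g y ∂(ballNoise d) = (volume.real (Metric.ball (0 : Space d) 1))⁻¹ •
      ∫ y, (Metric.ball (0 : Space d) 1).indicator (fun _ => (1 : ℝ)) y • g y := by
  rw [ballNoise, integral_smul_measure, ENNReal.toReal_inv, Measure.real,
    ← integral_indicator Metric.isOpen_ball.measurableSet]
  congr 2; ext y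
  by_cases h : y ∈ Metric.ball (0 : Space d) 1 <;> simp [h]

/-- A shift by ρr moves the ball of radius r by a small fraction of itself, and the relative
symmetric difference is an L¹ translation modulus of the indicator of the unit ball. So averages of
any bounded continuous function have a modulus of continuity at scale r depending only on its bound
K. -/
theorem exists_norm_ballAvg_sub_le {F : Type*} [NormedAddCommGroup F] [NormedSpace ℝ F]
    {η : ℝ} (hη : 0 < η) :
    ∃ ρ > 0, ∀ (g : Space d → F) (K : ℝ), Continuous g → (∀ x, ‖g x‖ ≤ K) →
      ∀ r > 0, ∀ x b : Space d, ‖b‖ ≤ ρ * r → ‖ballAvg r g (x + b) - ballAvg r g x‖ ≤ K * η := by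
  set V := volume.real (Metric.ball (0 : Space d) 1) with hV
  have hV0 : 0 < V := ENNReal.toReal_pos (Metric.measure_ball_pos _ _ one_pos).ne'
    measure_ball_lt_top.ne
  set χ : Space d → ℝ := (Metric.ball (0 : Space d) 1).indicator (fun _ => (1 : ℝ)) with hχ
  have hχi : Integrable χ :=
    (integrable_indicator_iff Metric.isOpen_ball.measurableSet).2
      (integrableOn_const measure_ball_lt_top.ne)
  obtain ⟨ρ, hρ, h⟩ := exists_forall_integral_norm_translate_sub_le hχi (mul_pos hη hV0)
  refine ⟨ρ, hρ, fun g K hg hK r hr x b hb => ?_⟩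
  have hK0 : 0 ≤ K := (norm_nonneg _).trans (hK 0)
  have hgc : Continuous fun y : Space d => g (x + r • y) := hg.comp (by fun_prop)
  have e1 : ballAvg r g (x + b) = V⁻¹ • ∫ y, χ (y + -(r⁻¹ • b)) • g (x + r • y) := by
    rw [ballAvg, integral_ballNoise_eq,
      ← integral_add_right_eq_self (fun y => χ (y + -(r⁻¹ • b)) • g (x + r • y)) (r⁻¹ • b)]
    congr 2; ext y
    rw [add_neg_cancel_right, smul_add, smul_smul, mul_inv_cancel₀ hr.ne', one_smul,
      add_assoc, add_comm b]
  have e2 : ballAvg r g x = V⁻¹ • ∫ y, χ y • g (x + r • y) := by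
    rw [ballAvg, integral_ballNoise_eq]
  have hi : ∀ a : Space d, Integrable fun y => χ (y + a) • g (x + r • y) := fun a =>
    (hχi.comp_add_right a).smul_bdd K hgc.aestronglyMeasurable (.of_forall fun y => hK _)
  have hi0 : Integrable fun y => χ y • g (x + r • y) := by simpa using hi 0
  rw [e1, e2, ← smul_sub, ← integral_sub (hi _) hi0, norm_smul, norm_inv,
    Real.norm_of_nonneg hV0.le, inv_mul_le_iff₀ hV0]
  have hb' : ‖-(r⁻¹ • b)‖ ≤ ρ := by
    rw [norm_neg, norm_smul, norm_inv, Real.norm_of_nonneg hr.le, inv_mul_le_iff₀ hr]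
    linarith
  calc ‖∫ y, (χ (y + -(r⁻¹ • b)) • g (x + r • y) - χ y • g (x + r • y))‖
      ≤ ∫ y, ‖χ (y + -(r⁻¹ • b)) - χ y‖ * K := by
        refine norm_integral_le_of_norm_le (((hχi.comp_add_right _).sub hχi).norm.mul_const _)
          (.of_forall fun y => ?_)
        rw [← sub_smul, norm_smul]
        gcongr
        exact hK _
    _ ≤ (η * V) * K := by
        rw [integral_mul_const]
        gcongr
        exact h _ hb'
    _ = V * (K * η) := by ring

theorem hasFDerivAt_ballAvg {ζ : Space d → ℝ} (hζ : ContDiff ℝ (⊤ : ℕ∞) ζ) {K : ℝ}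
    (hK : ∀ x, ‖fderiv ℝ ζ x‖ ≤ K) (r : ℝ) (x : Space d) :
    HasFDerivAt (ballAvg r ζ) (ballAvg r (fderiv ℝ ζ) x) x := by
  have hd := hζ.continuous_fderiv (by simp)
  refine hasFDerivAt_integral_of_dominated_of_fderiv_le (bound := fun _ => K)
    (F' := fun x y => fderiv ℝ ζ (x + r • y)) univ_mem (.of_forall fun x => ?_) ?_ ?_
    (.of_forall fun y x _ => hK _) (integrable_const _) (.of_forall fun y x _ => ?_)
  · exact (hζ.continuous.comp (by fun_prop)).aestronglyMeasurable
  · exact integrable_ballNoise_of_continuous (hζ.continuous.comp (by fun_prop))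
  · exact (hd.comp (by fun_prop)).aestronglyMeasurable
  · have := (hζ.differentiable (by simp) (x + r • y)).hasFDerivAt
    exact (hasFDerivAt_comp_add_right _).2 this

theorem abs_ballAvg_add_sub_le {ζ : Space d → ℝ} (hζ : ContDiff ℝ (⊤ : ℕ∞) ζ) {K C r : ℝ}
    (hK : ∀ x, ‖fderiv ℝ ζ x‖ ≤ K) (x a : Space d)
    (hC : ∀ b, ‖b‖ ≤ ‖a‖ → ‖ballAvg r (fderiv ℝ ζ) (x + b) - ballAvg r (fderiv ℝ ζ) x‖ ≤ C) :
    |ballAvg r ζ (x + a) - ballAvg r ζ x - ballAvg r (fderiv ℝ ζ) x a| ≤ C * ‖a‖ := by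
  have := (convex_closedBall x ‖a‖).norm_image_sub_le_of_norm_hasFDerivWithin_le'
    (f := ballAvg r ζ) (f' := ballAvg r (fderiv ℝ ζ)) (φ := ballAvg r (fderiv ℝ ζ) x) (C := C)
    (fun z _ => (hasFDerivAt_ballAvg hζ hK r z).hasFDerivWithinAt)
    (fun z hz => by
      have := hC (z - x) (by simpa [dist_eq_norm] using hz)
      simpa using this)
    (Metric.mem_closedBall_self (norm_nonneg a)) (y := x + a) (by simp [dist_eq_norm])
  simpa using this

variable {θ : Space d → ℝ} {u : Space d → Space d}

/-- The averaging is moved by translation from the gradient of ζ to the flux, so no modulus of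
continuity of that gradient is needed. -/
theorem abs_integral_ballAvg_fderiv_sub_le (hW : Integrable fun x => θ x • u x)
    {ζ : Space d → ℝ} (hζ : ContDiff ℝ (⊤ : ℕ∞) ζ) {K : ℝ}
    (hK : ∀ x, ‖fderiv ℝ ζ x‖ ≤ K) {r η : ℝ} (hr : 0 ≤ r)
    (hη : ∀ a : Space d, ‖a‖ ≤ r → ∫ x, ‖θ (x + a) • u (x + a) - θ x • u x‖ ≤ η) :
    |(∫ x, ballAvg r (fderiv ℝ ζ) x (θ x • u x)) - ∫ x, fderiv ℝ ζ x (θ x • u x)| ≤ K * η := by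
  have hK0 : 0 ≤ K := (norm_nonneg _).trans (hK 0)
  have hd := hζ.continuous_fderiv (by simp)
  set W : Space d → Space d := fun x => θ x • u x
  have i1 : Integrable (fun z : Space d × Space d => fderiv ℝ ζ (z.2 + r • z.1) (W z.2))
      ((ballNoise d).prod volume) := by
    refine integrable_prod_noise (w := fun x => K * ‖W x‖) (hW.norm.const_mul _) ?_ ?_
    · exact aestronglyMeasurable_clm_apply (hd.comp (by fun_prop)).aestronglyMeasurable
        hW.aestronglyMeasurable.comp_snd
    · intro y x _
      exact (ContinuousLinearMap.le_opNorm _ _).trans (by gcongr; exact hK _)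
  have hi : ∀ W : Space d → Space d, Integrable W → Integrable fun x => fderiv ℝ ζ x (W x) :=
    fun W hW => (hW.norm.const_mul K).mono'
      (aestronglyMeasurable_clm_apply hd.aestronglyMeasurable hW.aestronglyMeasurable)
      (.of_forall fun x => (ContinuousLinearMap.le_opNorm _ _).trans (by gcongr; exact hK _))
  have e1 : ∫ x, ballAvg r (fderiv ℝ ζ) x (W x) =
      ∫ y, ∫ x, fderiv ℝ ζ (x + r • y) (W x) ∂volume ∂(ballNoise d) := by
    rw [integral_integral_swap i1]
    congr 1; ext x
    exact ContinuousLinearMap.integral_apply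
      (integrable_ballNoise_of_continuous (hd.comp (by fun_prop))) _
  have e2 : ∫ x, fderiv ℝ ζ x (W x) = ∫ _, (∫ x, fderiv ℝ ζ x (W x)) ∂(ballNoise d) := by simp
  rw [e1, e2, ← integral_sub i1.integral_prod_left (integrable_const _)]
  have := norm_integral_le_of_norm_le_const (μ := ballNoise d)
    (f := fun y => (∫ x, fderiv ℝ ζ (x + r • y) (W x)) - ∫ x, fderiv ℝ ζ x (W x)) (C := K * η) (by
      filter_upwards [ae_norm_lt_one_ballNoise] with y hy
      have hy' : ‖-(r • y)‖ ≤ r := by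
        rw [norm_neg, norm_smul, Real.norm_of_nonneg hr]
        exact mul_le_of_le_one_right hr hy.le
      have hWt : Integrable fun x => W (x + -(r • y)) := hW.comp_add_right _
      have e3 : ∫ x, fderiv ℝ ζ (x + r • y) (W x) = ∫ x, fderiv ℝ ζ x (W (x + -(r • y))) := by
        rw [← integral_add_right_eq_self (fun x => fderiv ℝ ζ x (W (x + -(r • y)))) (r • y)]
        simp
      rw [e3, ← integral_sub (hi _ hWt) (hi _ hW)]
      calc _ ≤ ∫ x, K * ‖W (x + -(r • y)) - W x‖ := by
            refine norm_integral_le_of_norm_le ((hWt.sub hW).norm.const_mul _)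
              (.of_forall fun x => ?_)
            rw [← map_sub]
            exact (ContinuousLinearMap.le_opNorm _ _).trans (by gcongr; exact hK _)
        _ ≤ K * η := by
            rw [integral_const_mul]
            gcongr
            exact hη _ hy')
  simpa using this

/-- Linearisation of the averaged test function along the drift. Where |u| ≤ N the displacement is
small compared with the noise radius, so the averaged gradient is almost constant; where |u| > N the
crude bound 2K suffices since the flux there is small in L¹. -/
theorem abs_integral_ballAvg_flow_sub_le (hu : AEStronglyMeasurable u) (hθ : Integrable θ)
    (hW : Integrable fun x => θ x • u x)
    {ζ : Space d → ℝ} (hζ : ContDiff ℝ (⊤ : ℕ∞) ζ) (hζs : HasCompactSupport ζ) {K : ℝ}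
    (hK : ∀ x, ‖fderiv ℝ ζ x‖ ≤ K) {r η ρ h N : ℝ} (hh : 0 ≤ h) (hη0 : 0 ≤ η)
    (hρ : ∀ x b : Space d, ‖b‖ ≤ ρ * r →
      ‖ballAvg r (fderiv ℝ ζ) (x + b) - ballAvg r (fderiv ℝ ζ) x‖ ≤ K * η)
    (hN : ∫ x in {x | N < ‖u x‖}, ‖θ x • u x‖ ≤ η) (hNh : N * h ≤ ρ * r) :
    |(∫ x, θ x * ballAvg r ζ (x + h • u x)) - (∫ x, θ x * ballAvg r ζ x) -
      h * ∫ x, ballAvg r (fderiv ℝ ζ) x (θ x • u x)| ≤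
      K * h * η * ((∫ x, ‖θ x • u x‖) + 2) := by
  have hK0 : 0 ≤ K := (norm_nonneg _).trans (hK 0)
  have hd := hζ.continuous_fderiv (by simp)
  obtain ⟨C, hC⟩ := hζ.continuous.bounded_above_of_compact_support hζs
  have hac := continuous_ballAvg_of_bounded hζ.continuous hC r
  have hab := norm_ballAvg_le hC r
  have hdc := continuous_ballAvg_of_bounded hd hK r
  have hdb := norm_ballAvg_le hK r
  have i1 : Integrable fun x => θ x * ballAvg r ζ (x + h • u x) :=
    hθ.mul_bdd (c := C) (hac.comp_aestronglyMeasurable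
      (aestronglyMeasurable_id.add (hu.const_smul h))) (.of_forall fun x => hab _)
  have i2 : Integrable fun x => θ x * ballAvg r ζ x :=
    hθ.mul_bdd (c := C) hac.aestronglyMeasurable (.of_forall fun x => hab _)
  have i3 : Integrable fun x => ballAvg r (fderiv ℝ ζ) x (θ x • u x) :=
    (hW.norm.const_mul K).mono'
      (aestronglyMeasurable_clm_apply hdc.aestronglyMeasurable hW.aestronglyMeasurable)
      (.of_forall fun x => (ContinuousLinearMap.le_opNorm _ _).trans (by gcongr; exact hdb _))
  rw [← integral_sub i1 i2, ← integral_const_mul, ← integral_sub (by exact i1.sub i2) (i3.const_mul h)]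
  have hs : NullMeasurableSet {x | N < ‖u x‖} :=
    nullMeasurableSet_lt aemeasurable_const hu.norm.aemeasurable
  have iW2 : Integrable ({x | N < ‖u x‖}.indicator fun x => ‖θ x • u x‖) :=
    hW.norm.indicator₀ hs
  calc |∫ x, (θ x * ballAvg r ζ (x + h • u x) - θ x * ballAvg r ζ x -
        h * ballAvg r (fderiv ℝ ζ) x (θ x • u x))|
      ≤ ∫ x, (K * h * η * ‖θ x • u x‖ +
          2 * K * h * {x | N < ‖u x‖}.indicator (fun x => ‖θ x • u x‖) x) := by
        refine norm_integral_le_of_norm_le (G := ℝ) ((hW.norm.const_mul _).add (iW2.const_mul _))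
          (.of_forall fun x => ?_)
        have e : θ x * ballAvg r ζ (x + h • u x) - θ x * ballAvg r ζ x -
            h * ballAvg r (fderiv ℝ ζ) x (θ x • u x) = θ x * (ballAvg r ζ (x + h • u x) -
              ballAvg r ζ x - ballAvg r (fderiv ℝ ζ) x (h • u x)) := by
          simp only [map_smul, smul_eq_mul]; ring
        rw [e, norm_mul]
        have hn : ‖θ x • u x‖ = ‖θ x‖ * ‖u x‖ := norm_smul _ _
        have hhu : ‖h • u x‖ = h * ‖u x‖ := by rw [norm_smul, Real.norm_of_nonneg hh]
        by_cases hx : N < ‖u x‖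
        · have h1 := abs_ballAvg_add_sub_le (r := r) hζ hK x (h • u x) (C := 2 * K) (fun b _ => by
            refine (norm_sub_le _ _).trans ?_
            linarith [hdb (x + b), hdb x])
          have h2 : {x | N < ‖u x‖}.indicator (fun x => ‖θ x • u x‖) x = ‖θ x‖ * ‖u x‖ := by
            rw [indicator_of_mem (by exact hx), hn]
          rw [h2, hn]
          rw [hhu] at h1
          have h3 := mul_le_mul_of_nonneg_left h1 (norm_nonneg (θ x))
          have h4 : 0 ≤ K * h * η * (‖θ x‖ * ‖u x‖) := by positivity
          rw [Real.norm_eq_abs (ballAvg r ζ (x + h • u x) - _ - _)]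
          linarith
        · have h1 := abs_ballAvg_add_sub_le (r := r) hζ hK x (h • u x) (C := K * η) (fun b hb => by
            refine hρ x b (hb.trans ?_)
            rw [hhu]
            have : h * ‖u x‖ ≤ h * N := by gcongr; exact not_lt.1 hx
            linarith)
          have h2 : {x | N < ‖u x‖}.indicator (fun x => ‖θ x • u x‖) x = 0 :=
            indicator_of_notMem (by exact hx) _
          rw [h2, hn]
          rw [hhu] at h1
          have h3 := mul_le_mul_of_nonneg_left h1 (norm_nonneg (θ x))
          rw [Real.norm_eq_abs (ballAvg r ζ (x + h • u x) - _ - _)]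
          linarith
    _ ≤ K * h * η * ((∫ x, ‖θ x • u x‖) + 2) := by
        rw [integral_add (hW.norm.const_mul _) (iW2.const_mul _), integral_const_mul,
          integral_const_mul, integral_indicator₀ hs]
        have : 2 * K * h * ∫ x in {x | N < ‖u x‖}, ‖θ x • u x‖ ≤ 2 * K * h * η := by gcongr
        linarith

theorem exists_setIntegral_norm_gt_le (hu : AEStronglyMeasurable u)
    (hW : Integrable fun x => θ x • u x) {η : ℝ} (hη : 0 < η) :
    ∃ N : ℝ, 0 < N ∧ ∫ x in {x | N < ‖u x‖}, ‖θ x • u x‖ ≤ η := by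
  have hs : ∀ N : ℝ, NullMeasurableSet {x | N < ‖u x‖} := fun N =>
    nullMeasurableSet_lt aemeasurable_const hu.norm.aemeasurable
  have h1 : Tendsto (fun n : ℕ => ∫ x in {x | (n : ℝ) < ‖u x‖}, ‖θ x • u x‖) atTop
      (𝓝 (∫ _ : Space d, (0 : ℝ))) := by
    simp_rw [← integral_indicator₀ (hs _)]
    refine tendsto_integral_of_dominated_convergence (fun x => ‖θ x • u x‖)
      (fun n => (hW.norm.indicator₀ (hs _)).aestronglyMeasurable) hW.norm
      (fun n => .of_forall fun x => ?_) (.of_forall fun x => ?_)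
    · rw [Real.norm_of_nonneg (indicator_nonneg (fun _ _ => norm_nonneg _) _)]
      exact indicator_le_self' (fun _ _ => norm_nonneg _) _
    · refine tendsto_const_nhds.congr' ?_
      filter_upwards [eventually_ge_atTop ⌈‖u x‖⌉₊] with n hn
      rw [indicator_of_notMem]
      simpa using Nat.ceil_le.1 hn
  rw [integral_zero] at h1
  obtain ⟨n, hn, hn0⟩ := ((h1.eventually (Iio_mem_nhds hη)).and (eventually_gt_atTop 0)).exists
  exact ⟨n, by exact_mod_cast hn0, hn.le⟩

end Advection

/-- One explicit Euler-Maruyama step approximates the flux form of the equation, uniformly over all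
Lipschitz test functions. -/
theorem exists_euler_step (hd : 1 ≤ d) {θ : Space d → ℝ} {Dθ : Space d → Space d →L[ℝ] ℝ}
    {u : Space d → Space d}
    (hθ : Integrable θ) (hDθ : Integrable Dθ) (hw : HasWeakFDeriv θ Dθ)
    (hu : AEStronglyMeasurable u) (hW : Integrable fun x => θ x • u x)
    {κ δ η : ℝ} (hκ : 0 < κ) (hδ : 0 < δ) (hη : 0 < η) :
    ∃ h₀ > 0, ∀ h : ℝ, 0 < h → h ≤ h₀ → ∃ r : ℝ, ∀ ζ : Space d → ℝ, ContDiff ℝ (⊤ : ℕ∞) ζ →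
      HasCompactSupport ζ → LogLip δ ζ →
      (∫ x, θ x * ζ x) + h * (∫ x, fderiv ℝ ζ x (θ x • u x - κ • gradOf (Dθ x))) ≤
        (∫ x, θ x * ballAvg r ζ (x + h • u x)) + η * h := by
  obtain ⟨m, hm0, hm⟩ := exists_integral_inner_mul_inner_ballNoise hd
  set w := ∫ x, ‖θ x • u x‖ with hwdef
  have hw0 : 0 ≤ w := integral_nonneg fun _ => norm_nonneg _
  -- The noise radius satisfies r² = ch, so that r² m/2 = κh is the amount of diffusion in time h.
  set c := 2 * κ / m with hc
  have hc0 : 0 < c := by positivity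
  -- With K = 1/δ, the diffusion, drift and averaging errors are hε/δ times c, w + 2 and 1; this ε
  -- makes their sum ηh.
  set ε := η * δ / (c + w + 3) with hε
  have hε0 : 0 < ε := by positivity
  obtain ⟨ρ₁, hρ₁, h₁⟩ := exists_forall_integral_norm_translate_sub_le hDθ hε0
  obtain ⟨ρ₂, hρ₂, h₂⟩ := exists_forall_integral_norm_translate_sub_le hW hε0
  obtain ⟨ρ, hρ, h₃⟩ := exists_norm_ballAvg_sub_le (d := d) (F := Space d →L[ℝ] ℝ) hε0
  obtain ⟨N, hN, h₄⟩ := exists_setIntegral_norm_gt_le hu hW hε0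
  -- The first two bounds give r ≤ ρ₁ and r ≤ ρ₂. The third gives Nh ≤ ρr: the drift is of order h
  -- and the noise of order √h, so noise dominates for small h.
  refine ⟨min (min (ρ₁ ^ 2 / c) (ρ₂ ^ 2 / c)) (ρ ^ 2 * c / N ^ 2), by positivity,
    fun h hh0 hh => ?_⟩
  have hh1 : h ≤ ρ₁ ^ 2 / c := hh.trans ((min_le_left _ _).trans (min_le_left _ _))
  have hh2 : h ≤ ρ₂ ^ 2 / c := hh.trans ((min_le_left _ _).trans (min_le_right _ _))
  have hh3 : h ≤ ρ ^ 2 * c / N ^ 2 := hh.trans (min_le_right _ _)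
  rw [le_div_iff₀ (by positivity)] at hh1 hh2 hh3
  set r := Real.sqrt (c * h) with hr
  have hr0 : 0 < r := Real.sqrt_pos.2 (by positivity)
  have hr2 : r ^ 2 = c * h := Real.sq_sqrt (by positivity)
  have hr1 : r ≤ ρ₁ := by
    refine abs_le_of_sq_le_sq' ?_ hρ₁.le |>.2
    rw [hr2]; linarith
  have hr2' : r ≤ ρ₂ := by
    refine abs_le_of_sq_le_sq' ?_ hρ₂.le |>.2
    rw [hr2]; linarith
  have hNh : N * h ≤ ρ * r := by
    refine abs_le_of_sq_le_sq' ?_ (by positivity) |>.2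
    rw [mul_pow, mul_pow, hr2]
    nlinarith
  refine ⟨r, fun ζ hζ hζs hl => ?_⟩
  have hK := hl.norm_fderiv_le hδ
  have hdc := hζ.continuous_fderiv (by simp)
  have A := abs_integral_ballAvg_sub_le hθ hDθ hw hm hζ hζs hK hr0.le
    (fun a ha => h₁ a (ha.trans hr1))
  have B := abs_integral_ballAvg_fderiv_sub_le hW hζ hK hr0.le (fun a ha => h₂ a (ha.trans hr2'))
  have D := abs_integral_ballAvg_flow_sub_le hu hθ hW hζ hζs hK hh0.le hε0.le
    (h₃ _ _ hdc hK r hr0) h₄ hNh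
  rw [hr2, show c * h * m / 2 = κ * h by rw [hc]; field_simp] at A
  have hG : Integrable fun x => gradOf (Dθ x) := by
    refine (integrable_norm_iff
      (continuous_gradOf.comp_aestronglyMeasurable hDθ.aestronglyMeasurable)).1 ?_
    simp_rw [norm_gradOf]
    exact hDθ.norm
  have hi : ∀ W : Space d → Space d, Integrable W → Integrable fun x => fderiv ℝ ζ x (W x) :=
    fun W hW => (hW.norm.const_mul δ⁻¹).mono'
      (aestronglyMeasurable_clm_apply hdc.aestronglyMeasurable hW.aestronglyMeasurable)
      (.of_forall fun x => (ContinuousLinearMap.le_opNorm _ _).trans (by gcongr; exact hK _))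
  have e : ∫ x, fderiv ℝ ζ x (θ x • u x - κ • gradOf (Dθ x)) =
      (∫ x, fderiv ℝ ζ x (θ x • u x)) - κ * ∫ x, fderiv ℝ ζ x (gradOf (Dθ x)) := by
    rw [← integral_const_mul, ← integral_sub (hi _ hW) ((hi _ hG).const_mul κ)]
    congr 1; ext x
    rw [map_sub, map_smul _ κ, smul_eq_mul]
  rw [e]
  have A' := (abs_le.1 A).1
  have B' := (abs_le.1 B).1
  have D' := (abs_le.1 D).1
  have B'' := mul_le_mul_of_nonneg_left B' hh0.le
  have hfin : δ⁻¹ * (c * h) * ε + δ⁻¹ * h * ε * (w + 2) + h * (δ⁻¹ * ε) = η * h := by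
    rw [hε]; field_simp; ring
  linarith

/-- Infinitesimal estimate of the Kantorovich-Rubinstein distance along the flow of
`u • θ - κ • ∇θ`. -/
theorem exists_step_estimate (hd : 1 ≤ d) {θ : Space d → ℝ} {Dθ : Space d → Space d →L[ℝ] ℝ}
    {u : Space d → Space d}
    (hθ : Integrable θ) (hDθ : Integrable Dθ) (hw : HasWeakFDeriv θ Dθ)
    (hu : AEStronglyMeasurable u) (hW : Integrable fun x => θ x • u x)
    {κ δ η : ℝ} (hκ : 0 < κ) (hδ : 0 < δ) (hη : 0 < η) {E A : ℝ} (hE0 : 0 ≤ E) (hA0 : 0 ≤ A)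
    (hE : ∀ ζ : Space d → ℝ, ContDiff ℝ (⊤ : ℕ∞) ζ → HasCompactSupport ζ → LogLip δ ζ →
      ∫ x, θ x * ζ x ≤ E)
    {g : Space d → ℝ≥0∞} (hg : AEMeasurable g) {S : Set (Space d)} (hS : ∀ᵐ x, x ∈ S)
    (hug : ∀ x ∈ S, ∀ y ∈ S, ‖u x - u y‖ₑ ≤ ‖x - y‖ₑ * (g x + g y))
    (hA : ∫⁻ x, g x * ‖θ x‖ₑ ≤ ENNReal.ofReal A) :
    ∃ h₀ > 0, ∀ h : ℝ, 0 < h → h ≤ h₀ → ∀ ζ : Space d → ℝ, ContDiff ℝ (⊤ : ℕ∞) ζ →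
      HasCompactSupport ζ → LogLip δ ζ →
      (∫ x, θ x * ζ x) + h * (∫ x, fderiv ℝ ζ x (θ x • u x - κ • gradOf (Dθ x))) ≤
        E + h * A + η * h := by
  obtain ⟨h₀, hh₀, H⟩ := exists_euler_step hd hθ hDθ hw hu hW hκ hδ hη
  -- The plan is chosen before h and ζ, hence serves all steps and all test functions at once.
  obtain ⟨π, h1, h2, h3⟩ := exists_plan hδ hθ hE
  refine ⟨h₀, hh₀, fun h hh hhh ζ hζ hζs hl => ?_⟩
  obtain ⟨r, hr⟩ := H h hh hhh
  refine (hr ζ hζ hζs hl).trans ?_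
  gcongr
  obtain ⟨C, hC⟩ := hζ.continuous.bounded_above_of_compact_support hζs
  have hac := continuous_ballAvg_of_bounded hζ.continuous hC r
  have hab := norm_ballAvg_le hC r
  have q1 := quasiMeasurePreserving_fst_plan h1
  have q2 := quasiMeasurePreserving_snd_plan h2
  have key := ofReal_integral_mul_le_lintegral_plan (H := fun x => ballAvg r ζ (x + h • u x))
    hθ (hac.comp_aestronglyMeasurable (aestronglyMeasurable_id.add (hu.const_smul h)))
    (fun x => hab _) h1 h2
    (k := fun z => logCost δ z.1 z.2 + ENNReal.ofReal h * (g z.1 + g z.2)) (by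
      filter_upwards [q1.ae hS, q2.ae hS] with z hz1 hz2
      have s1 := hl.ballAvg hδ r (z.1 + h • u z.1) (z.2 + h • u z.2)
      have s2 : ‖z.1 + h • u z.1 - (z.2 + h • u z.2)‖ ≤ ‖z.1 - z.2‖ + h * ‖u z.1 - u z.2‖ := by
        rw [add_sub_add_comm, ← smul_sub]
        refine (norm_add_le _ _).trans ?_
        rw [norm_smul, Real.norm_of_nonneg hh.le]
      have s3 := log_div_add_one_mono hδ (norm_nonneg _) s2
      have s4 := log_div_add_one_add_le_div hδ (norm_nonneg (z.1 - z.2))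
        (by positivity : 0 ≤ h * ‖u z.1 - u z.2‖)
      refine (ENNReal.ofReal_le_ofReal (s1.trans (s3.trans s4))).trans ?_
      refine ENNReal.ofReal_add_le.trans ?_
      unfold logCost
      gcongr
      -- The denominator |x - y| + δ dominates the factor |x - y| in `hug`, leaving h (g(x) + g(y)).
      rw [ENNReal.ofReal_div_of_pos (by positivity), ENNReal.ofReal_mul hh.le, mul_div_assoc]
      gcongr
      refine ENNReal.div_le_of_le_mul ?_
      rw [ofReal_norm]
      refine (hug _ hz1 _ hz2).trans ?_
      rw [mul_comm]
      gcongr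
      rw [← ofReal_norm]
      exact ENNReal.ofReal_le_ofReal (by linarith))
  -- The marginals of the plan are the positive and negative parts of θ, which add up to |θ|.
  have e1 : ∫⁻ z, (g z.1 + g z.2) ∂π = ∫⁻ x, g x * ‖θ x‖ₑ := by
    have m1 : AEMeasurable (fun z : Space d × Space d => g z.1) π :=
      hg.comp_quasiMeasurePreserving q1
    rw [lintegral_add_left' m1]
    have a1 : ∫⁻ z, g z.1 ∂π = ∫⁻ x, g x * ENNReal.ofReal (θ x) := by
      rw [← lintegral_map' (hg.mono_ac q1.absolutelyContinuous) measurable_fst.aemeasurable]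
      change ∫⁻ x, g x ∂π.fst = _
      rw [h1, lintegral_withDensity_eq_lintegral_mul₀ hθ.aemeasurable.ennreal_ofReal hg]
      simp [mul_comm]
    have a2 : ∫⁻ z, g z.2 ∂π = ∫⁻ x, g x * ENNReal.ofReal (-θ x) := by
      rw [← lintegral_map' (hg.mono_ac q2.absolutelyContinuous) measurable_snd.aemeasurable]
      change ∫⁻ x, g x ∂π.snd = _
      rw [h2, lintegral_withDensity_eq_lintegral_mul₀ (by exact hθ.aemeasurable.neg.ennreal_ofReal)
        hg]
      simp [mul_comm]
    rw [a1, a2, ← lintegral_add_left' (by exact hg.mul hθ.aemeasurable.ennreal_ofReal)]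
    congr 1; ext x
    rw [← mul_add]
    congr 1
    rcases le_total 0 (θ x) with h | h
    · rw [ENNReal.ofReal_of_nonpos (by linarith : -θ x ≤ 0), add_zero,
        ← ofReal_norm, Real.norm_of_nonneg h]
    · rw [ENNReal.ofReal_of_nonpos h, zero_add, ← ofReal_norm, Real.norm_of_nonpos h]
  rw [lintegral_add_left (measurable_logCost δ), lintegral_const_mul' _ _ ENNReal.ofReal_ne_top,
    e1] at key
  have hfin : ENNReal.ofReal (∫ x, θ x * ballAvg r ζ (x + h • u x)) ≤
      ENNReal.ofReal (E + h * A) := by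
    refine key.trans ?_
    rw [ENNReal.ofReal_add hE0 (by positivity), ENNReal.ofReal_mul hh.le]
    gcongr
  exact (ENNReal.ofReal_le_ofReal_iff (by positivity)).1 hfin

end AdvDiff

/-! ### The Hardy–Littlewood maximal theorem. -/

namespace AdvDiff

open Filter Topology
open Metric

variable {d : ℕ}

theorem volume_ball_eq (x : Space d) (r : ℝ) : volume (ball x r) = volume (ball (0 : Space d) r) :=
  Measure.addHaar_ball_center _ _ _

theorem volume_ball_mul {k : ℝ} (hk : 0 < k) (x : Space d) (r : ℝ) :
    volume (ball x (k * r)) = ENNReal.ofReal (k ^ d) * volume (ball (0 : Space d) r) := by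
  rw [Measure.addHaar_ball_mul_of_pos _ _ hk, finrank_euclideanSpace_fin]

/-- The (centered) Hardy-Littlewood maximal function. -/
noncomputable def maxFn (f : Space d → ℝ≥0∞) (x : Space d) : ℝ≥0∞ :=
  ⨆ (r : ℝ) (_ : 0 < r), (∫⁻ y in ball x r, f y) / volume (ball (0 : Space d) r)

theorem volume_ball_ne_zero {r : ℝ} (hr : 0 < r) : volume (ball (0 : Space d) r) ≠ 0 :=
  (measure_ball_pos _ _ hr).ne'

theorem lintegral_ball_le_maxFn (f : Space d → ℝ≥0∞) (x : Space d) {r : ℝ} (hr : 0 < r) :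
    ∫⁻ y in ball x r, f y ≤ maxFn f x * volume (ball (0 : Space d) r) := by
  rw [← ENNReal.div_le_iff (volume_ball_ne_zero hr) measure_ball_lt_top.ne]
  exact le_iSup₂ (f := fun (r : ℝ) (_ : 0 < r) =>
    (∫⁻ y in ball x r, f y) / volume (ball (0 : Space d) r)) r hr

theorem lt_maxFn_iff {f : Space d → ℝ≥0∞} {x : Space d} {t : ℝ≥0∞} :
    t < maxFn f x ↔ ∃ r : ℝ, 0 < r ∧ t * volume (ball (0 : Space d) r) < ∫⁻ y in ball x r, f y := by
  unfold maxFn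
  simp only [lt_iSup_iff]
  constructor
  · rintro ⟨r, hr, h⟩
    refine ⟨r, hr, ?_⟩
    rwa [ENNReal.lt_div_iff_mul_lt (.inl (volume_ball_ne_zero hr))
      (.inl measure_ball_lt_top.ne)] at h
  · rintro ⟨r, hr, h⟩
    refine ⟨r, hr, ?_⟩
    rwa [ENNReal.lt_div_iff_mul_lt (.inl (volume_ball_ne_zero hr))
      (.inl measure_ball_lt_top.ne)]

theorem maxFn_congr {f g : Space d → ℝ≥0∞} (h : f =ᵐ[volume] g) : maxFn f = maxFn g := by
  ext x
  unfold maxFn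
  congr! 4 with r hr
  exact lintegral_congr_ae (ae_restrict_of_ae h)

/-- By monotone convergence a slightly smaller ball still has integral above t, and it is contained
in the full balls around nearby centres. -/
theorem isOpen_lt_lintegral_ball (f : Space d → ℝ≥0∞) (r : ℝ) (t : ℝ≥0∞) :
    IsOpen {x | t < ∫⁻ y in ball x r, f y} := by
  rw [Metric.isOpen_iff]
  intro x hx
  have hU : ball x r = ⋃ n : ℕ, ball x (r - 1 / (n + 1 : ℝ)) := by
    ext y
    simp only [mem_ball, mem_iUnion]
    constructor
    · intro h
      obtain ⟨n, hn⟩ := exists_nat_one_div_lt (sub_pos.2 h)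
      exact ⟨n, by linarith⟩
    · rintro ⟨n, hn⟩
      have : 0 < 1 / (n + 1 : ℝ) := by positivity
      linarith
  have hmono : Monotone fun n : ℕ => ball x (r - 1 / (n + 1 : ℝ)) := by
    intro m n hmn
    apply ball_subset_ball
    have : 1 / (n + 1 : ℝ) ≤ 1 / (m + 1 : ℝ) := by gcongr
    linarith
  have hx' : t < ∫⁻ y in ball x r, f y := hx
  rw [hU, setLIntegral_iUnion_of_directed _ hmono.directed_le, lt_iSup_iff] at hx'
  obtain ⟨n, hn⟩ := hx'
  refine ⟨1 / (n + 1 : ℝ), by positivity, fun y hy => ?_⟩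
  refine hn.trans_le (lintegral_mono_set (ball_subset_ball' ?_))
  rw [mem_ball, dist_comm] at hy
  linarith

theorem measurable_maxFn (f : Space d → ℝ≥0∞) : Measurable (maxFn f) := by
  refine measurable_of_Ioi fun t => IsOpen.measurableSet ?_
  have : maxFn f ⁻¹' Ioi t = ⋃ (r : ℝ) (_ : 0 < r),
      {x | t * volume (ball (0 : Space d) r) < ∫⁻ y in ball x r, f y} := by
    ext x
    simp only [mem_preimage, mem_Ioi, lt_maxFn_iff, mem_iUnion, mem_ofPred_eq, exists_prop]
  rw [this]
  exact isOpen_iUnion fun r => isOpen_iUnion fun _ => isOpen_lt_lintegral_ball f r _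

/-- Weak type `(1,1)` estimate for the maximal function. -/
theorem mul_volume_lt_maxFn_le (f : Space d → ℝ≥0∞) (t : ℝ≥0∞) :
    t * volume {x | t < maxFn f x} ≤ ENNReal.ofReal (4 ^ d) * ∫⁻ x, f x := by
  -- The Vitali covering lemma requires bounded radii; the bound n is removed at the end by
  -- monotonicity.
  let T : ℕ → Set (Space d × ℝ) := fun n =>
    {z | 0 < z.2 ∧ z.2 ≤ n ∧ t * volume (ball (0 : Space d) z.2) < ∫⁻ y in ball z.1 z.2, f y}
  have hU : {x | t < maxFn f x} = ⋃ n, Prod.fst '' T n := by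
    ext x
    simp only [mem_ofPred_eq, lt_maxFn_iff, mem_iUnion, mem_image, Prod.exists, exists_and_right,
      exists_eq_right, T]
    constructor
    · rintro ⟨r, hr, h⟩
      obtain ⟨n, hn⟩ := exists_nat_ge r
      exact ⟨n, r, hr, hn, h⟩
    · rintro ⟨n, r, hr, -, h⟩
      exact ⟨r, hr, h⟩
  have hmono : Monotone fun n => Prod.fst '' T n := by
    intro m n hmn
    apply image_mono
    rintro z ⟨h1, h2, h3⟩
    exact ⟨h1, h2.trans (by exact_mod_cast hmn), h3⟩
  rw [hU, hmono.measure_iUnion, ENNReal.mul_iSup]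
  refine iSup_le fun n => ?_
  -- Any enlargement factor above 3 is allowed; 4 yields the constant 4^d.
  obtain ⟨u, huT, hdisj, hcov⟩ := Vitali.exists_disjoint_subfamily_covering_enlargement_ball
    (T n) Prod.fst Prod.snd n (fun z hz => hz.2.1) 4 (by norm_num)
  have hc : u.Countable := hdisj.countable_of_isOpen (fun z _ => isOpen_ball)
    (fun z hz => ⟨z.1, mem_ball_self (huT hz).1⟩)
  have hsub : Prod.fst '' T n ⊆ ⋃ z ∈ u, ball z.1 (4 * z.2) := by
    rintro _ ⟨z, hz, rfl⟩
    obtain ⟨w, hw, h⟩ := hcov z hz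
    exact mem_iUnion₂.2 ⟨w, hw, h (mem_ball_self hz.1)⟩
  calc t * volume (Prod.fst '' T n)
      ≤ t * ∑' z : u, volume (ball z.1.1 (4 * z.1.2)) := by
        gcongr
        exact (measure_mono hsub).trans (measure_biUnion_le _ hc _)
    _ = ENNReal.ofReal (4 ^ d) * ∑' z : u, t * volume (ball (0 : Space d) z.1.2) := by
        simp_rw [volume_ball_mul (d := d) (by norm_num : (0 : ℝ) < 4), ENNReal.tsum_mul_left]
        ring
    _ ≤ ENNReal.ofReal (4 ^ d) * ∑' z : u, ∫⁻ y in ball z.1.1 z.1.2, f y := by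
        gcongr with z
        exact (huT z.2).2.2.le
    _ = ENNReal.ofReal (4 ^ d) * ∫⁻ y in ⋃ z ∈ u, ball z.1 z.2, f y := by
        rw [lintegral_biUnion hc (fun z _ => isOpen_ball.measurableSet) hdisj]
    _ ≤ _ := by gcongr; exact Measure.restrict_le_self

/-- Splitting f at height s for Marcinkiewicz interpolation: the part below s contributes at most s
to any average. -/
theorem maxFn_le_add (f : Space d → ℝ≥0∞) (s : ℝ≥0∞) (x : Space d) :
    maxFn f x ≤ maxFn ({y | s < f y}.indicator f) x + s := by
  refine iSup₂_le fun r hr => ?_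
  rw [ENNReal.div_le_iff (volume_ball_ne_zero hr) measure_ball_lt_top.ne, add_mul]
  refine le_trans ?_ (add_le_add_left (lintegral_ball_le_maxFn _ x hr) _)
  have h1 : ∫⁻ _ in ball x r, s = s * volume (ball (0 : Space d) r) := by
    rw [setLIntegral_const, volume_ball_eq]
  rw [← h1, ← lintegral_add_right _ measurable_const]
  refine lintegral_mono fun y => ?_
  by_cases h : s < f y
  · rw [indicator_of_mem (by exact h)]; exact le_self_add
  · rw [indicator_of_notMem (by exact h), zero_add]; exact not_lt.1 h

theorem maxFn_le_of_ae_le {f : Space d → ℝ≥0∞} {s : ℝ≥0∞} (hf : ∀ᵐ y, f y ≤ s) (x : Space d) :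
    maxFn f x ≤ s := by
  refine iSup₂_le fun r hr => ?_
  rw [ENNReal.div_le_iff (volume_ball_ne_zero hr) measure_ball_lt_top.ne, ← volume_ball_eq x,
    ← setLIntegral_const]
  exact lintegral_mono_ae (ae_restrict_of_ae hf)

/-- The integral over the levels t < 2a in the layer-cake formula; convergence at t = 0 is where p >
1 is needed. -/
theorem lintegral_indicator_rpow_le {p : ℝ} (hp : 1 < p) (a : ℝ≥0∞) :
    ∫⁻ t in Ioi (0 : ℝ), {t : ℝ | ENNReal.ofReal (t / 2) < a}.indicator
      (fun t => ENNReal.ofReal (t ^ (p - 2))) t ≤ ENNReal.ofReal (1 / (p - 1)) * (2 * a) ^ (p - 1) := by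
  have hp1 : 0 < p - 1 := by linarith
  rcases eq_or_ne a ⊤ with rfl | ha
  · rw [ENNReal.mul_top (by norm_num), ENNReal.top_rpow_of_pos hp1, ENNReal.mul_top]
    · exact le_top
    · rw [Ne, ENNReal.ofReal_eq_zero, not_le]; positivity
  lift a to ℝ≥0 using ha
  have hset : {t : ℝ | ENNReal.ofReal (t / 2) < a} ∩ Ioi 0 = Ioo 0 (2 * (a : ℝ)) := by
    ext t
    simp only [mem_inter_iff, mem_ofPred_eq, mem_Ioi, mem_Ioo]
    rw [and_comm]
    refine and_congr_right fun ht => ?_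
    rw [ENNReal.ofReal_lt_coe_iff (by positivity), div_lt_iff₀ two_pos, mul_comm]
  have hm : MeasurableSet {t : ℝ | ENNReal.ofReal (t / 2) < a} :=
    measurableSet_lt (by fun_prop) measurable_const
  rw [setLIntegral_indicator hm, hset, setLIntegral_congr Ioo_ae_eq_Ioc]
  have h0 : (0 : ℝ) ≤ 2 * a := by positivity
  have hi : IntervalIntegrable (fun t : ℝ => t ^ (p - 2)) volume 0 (2 * a) :=
    intervalIntegral.intervalIntegrable_rpow' (by linarith)
  rw [← ofReal_integral_eq_lintegral_ofReal ((intervalIntegrable_iff_integrableOn_Ioc_of_le h0).1 hi),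
    ← intervalIntegral.integral_of_le h0, integral_rpow (.inl (by linarith)),
    show p - 2 + 1 = p - 1 by ring, Real.zero_rpow hp1.ne', sub_zero, div_eq_inv_mul, ← one_div,
    ENNReal.ofReal_mul (by positivity), ← ENNReal.ofReal_rpow_of_nonneg h0 hp1.le]
  · apply le_of_eq
    congr 2
    rw [ENNReal.ofReal_mul two_pos.le]; simp
  · filter_upwards [ae_restrict_mem measurableSet_Ioc] with t ht
    exact Real.rpow_nonneg ht.1.le _

/-- Separates the factor t/2 that the weak type estimate at level t/2 absorbs. -/
theorem two_mul_inv_mul_rpow {t p : ℝ} (ht : 0 < t) :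
    ENNReal.ofReal (t ^ (p - 1)) = ENNReal.ofReal (t / 2) * (2 * ENNReal.ofReal (t ^ (p - 2))) := by
  rw [show (2 : ℝ≥0∞) = ENNReal.ofReal 2 by simp, ← ENNReal.ofReal_mul two_pos.le,
    ← ENNReal.ofReal_mul (by positivity)]
  congr 1
  rw [show p - 1 = p - 2 + 1 by ring, Real.rpow_add_one ht.ne']
  ring

/-- Strong type `(p,p)` estimate for the maximal function. -/
theorem lintegral_maxFn_rpow_le {p : ℝ} (hp : 1 < p) {f : Space d → ℝ≥0∞} (hf : Measurable f) :
    ∫⁻ x, maxFn f x ^ p ≤ ENNReal.ofReal (p * (2 * 4 ^ d) * (1 / (p - 1)) * 2 ^ (p - 1)) *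
      ∫⁻ x, f x ^ p := by
  have hp0 : 0 < p := by linarith
  have hp1 : 0 < p - 1 := by linarith
  -- Truncation at n makes the function real-valued, as the layer-cake formula demands, without
  -- assuming the maximal function finite.
  have key : ∀ n : ℕ, ∫⁻ x, (min (maxFn f x) n) ^ p ≤
      ENNReal.ofReal (p * (2 * 4 ^ d) * (1 / (p - 1)) * 2 ^ (p - 1)) * ∫⁻ x, f x ^ p := by
    intro n
    have hfin : ∀ x, min (maxFn f x) n ≠ ⊤ := fun x =>
      ((min_le_right _ _).trans_lt (ENNReal.natCast_lt_top n)).ne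
    have hgm : Measurable fun x => (min (maxFn f x) n).toReal :=
      ((measurable_maxFn f).min measurable_const).ennreal_toReal
    have e1 : ∫⁻ x, (min (maxFn f x) n) ^ p =
        ∫⁻ x, ENNReal.ofReal ((min (maxFn f x) n).toReal ^ p) := by
      congr 1; ext x
      rw [← ENNReal.ofReal_rpow_of_nonneg ENNReal.toReal_nonneg hp0.le,
        ENNReal.ofReal_toReal (hfin x)]
    rw [e1, lintegral_rpow_eq_lintegral_meas_lt_mul volume (.of_forall fun _ => ENNReal.toReal_nonneg)
      hgm.aemeasurable hp0]
    have step : ∀ t ∈ Ioi (0 : ℝ),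
        volume {x | t < (min (maxFn f x) n).toReal} * ENNReal.ofReal (t ^ (p - 1)) ≤
        ∫⁻ x, ENNReal.ofReal (2 * 4 ^ d) * (f x * {t : ℝ | ENNReal.ofReal (t / 2) < f x}.indicator
          (fun t => ENNReal.ofReal (t ^ (p - 2))) t) := by
      intro t ht
      have ht : 0 < t := ht
      have hsub : {x | t < (min (maxFn f x) n).toReal} ⊆
          {x | ENNReal.ofReal (t / 2) <
            maxFn ({y | ENNReal.ofReal (t / 2) < f y}.indicator f) x} := by
        intro x hx
        have h1 : ENNReal.ofReal t < maxFn f x :=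
          ((ENNReal.ofReal_lt_iff_lt_toReal ht.le (hfin x)).2 hx).trans_le (min_le_left _ _)
        have h2 := h1.trans_le (maxFn_le_add f (ENNReal.ofReal (t / 2)) x)
        rw [← add_halves t, ENNReal.ofReal_add (by positivity) (by positivity)] at h2
        simp only [add_halves] at h2
        exact lt_of_add_lt_add_right h2
      have h3 := mul_volume_lt_maxFn_le ({y | ENNReal.ofReal (t / 2) < f y}.indicator f)
        (ENNReal.ofReal (t / 2))
      calc volume {x | t < (min (maxFn f x) n).toReal} * ENNReal.ofReal (t ^ (p - 1))
          ≤ volume {x | ENNReal.ofReal (t / 2) <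
              maxFn ({y | ENNReal.ofReal (t / 2) < f y}.indicator f) x} *
              (ENNReal.ofReal (t / 2) * (2 * ENNReal.ofReal (t ^ (p - 2)))) := by
            rw [two_mul_inv_mul_rpow ht]
            gcongr
        _ = (ENNReal.ofReal (t / 2) * volume {x | ENNReal.ofReal (t / 2) <
              maxFn ({y | ENNReal.ofReal (t / 2) < f y}.indicator f) x}) *
              (2 * ENNReal.ofReal (t ^ (p - 2))) := by ring
        _ ≤ (ENNReal.ofReal (4 ^ d) * ∫⁻ x, {y | ENNReal.ofReal (t / 2) < f y}.indicator f x) *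
              (2 * ENNReal.ofReal (t ^ (p - 2))) := by gcongr
        _ = ∫⁻ x, (ENNReal.ofReal (4 ^ d) * (2 * ENNReal.ofReal (t ^ (p - 2)))) *
              {y | ENNReal.ofReal (t / 2) < f y}.indicator f x := by
            rw [lintegral_const_mul' _ _ (by finiteness)]
            ring
        _ = _ := by
            congr 1; ext x
            rw [ENNReal.ofReal_mul two_pos.le]
            by_cases h : ENNReal.ofReal (t / 2) < f x
            · rw [indicator_of_mem (by exact h), indicator_of_mem (by exact h)]
              simp; ring
            · rw [indicator_of_notMem (by exact h), indicator_of_notMem (by exact h)]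
              simp
    have hmeas : Measurable (Function.uncurry fun (t : ℝ) (x : Space d) =>
        ENNReal.ofReal (2 * 4 ^ d) * (f x * {t : ℝ | ENNReal.ofReal (t / 2) < f x}.indicator
          (fun t => ENNReal.ofReal (t ^ (p - 2))) t)) := by
      refine measurable_const.mul ((hf.comp measurable_snd).mul ?_)
      have : (fun z : ℝ × Space d => {t : ℝ | ENNReal.ofReal (t / 2) < f z.2}.indicator
          (fun t => ENNReal.ofReal (t ^ (p - 2))) z.1) =
          {z : ℝ × Space d | ENNReal.ofReal (z.1 / 2) < f z.2}.indicator
          (fun z => ENNReal.ofReal (z.1 ^ (p - 2))) := by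
        ext z; simp only [indicator, mem_ofPred_eq]
      rw [this]
      exact Measurable.indicator (by fun_prop)
        (measurableSet_lt (by fun_prop) (hf.comp measurable_snd))
    calc ENNReal.ofReal p * ∫⁻ t in Ioi (0 : ℝ),
          volume {x | t < (min (maxFn f x) n).toReal} * ENNReal.ofReal (t ^ (p - 1))
        ≤ ENNReal.ofReal p * ∫⁻ t in Ioi (0 : ℝ), ∫⁻ x, ENNReal.ofReal (2 * 4 ^ d) *
          (f x * {t : ℝ | ENNReal.ofReal (t / 2) < f x}.indicator
          (fun t => ENNReal.ofReal (t ^ (p - 2))) t) := by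
          gcongr ENNReal.ofReal p * ?_
          exact setLIntegral_mono' measurableSet_Ioi step
      _ = ENNReal.ofReal p * ∫⁻ x, ∫⁻ t in Ioi (0 : ℝ), ENNReal.ofReal (2 * 4 ^ d) *
          (f x * {t : ℝ | ENNReal.ofReal (t / 2) < f x}.indicator
          (fun t => ENNReal.ofReal (t ^ (p - 2))) t) := by
          rw [lintegral_lintegral_swap hmeas.aemeasurable]
      _ ≤ ENNReal.ofReal p * ∫⁻ x, ENNReal.ofReal (2 * 4 ^ d) *
          (ENNReal.ofReal (1 / (p - 1)) * ENNReal.ofReal (2 ^ (p - 1)) * f x ^ p) := by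
          gcongr with x
          have hmx : Measurable fun t : ℝ => {t : ℝ | ENNReal.ofReal (t / 2) < f x}.indicator
              (fun t => ENNReal.ofReal (t ^ (p - 2))) t :=
            Measurable.indicator (by fun_prop) (measurableSet_lt (by fun_prop) measurable_const)
          rw [lintegral_const_mul _ (by exact measurable_const.mul hmx), lintegral_const_mul _ hmx]
          refine mul_le_mul_right ?_ _
          refine (mul_le_mul_right (lintegral_indicator_rpow_le hp (f x)) (f x)).trans
            (le_of_eq ?_)
          rw [ENNReal.mul_rpow_of_nonneg _ _ hp1.le, ← ENNReal.ofReal_rpow_of_pos two_pos,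
            ENNReal.ofReal_ofNat]
          have : f x ^ p = f x * f x ^ (p - 1) := by
            nth_rw 2 [← ENNReal.rpow_one (f x)]
            rw [← ENNReal.rpow_add_of_nonneg _ _ zero_le_one hp1.le]
            congr 1; ring
          rw [this]; ring
      _ = _ := by
          rw [lintegral_const_mul' _ _ ENNReal.ofReal_ne_top,
            lintegral_const_mul' _ _ (by finiteness), ← mul_assoc, ← mul_assoc,
            ← ENNReal.ofReal_mul (by positivity), ← ENNReal.ofReal_mul (by positivity),
            ← ENNReal.ofReal_mul (by positivity)]
          congr 2; ring
  have hlim : ∀ x, maxFn f x ^ p = ⨆ n : ℕ, (min (maxFn f x) n) ^ p := by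
    intro x
    have h1 : maxFn f x = ⨆ n : ℕ, min (maxFn f x) n := by
      rw [← inf_iSup_eq, ENNReal.iSup_natCast, inf_top_eq]
    conv_lhs => rw [h1]
    exact (ENNReal.orderIsoRpow p hp0).map_iSup _
  simp_rw [hlim]
  rw [lintegral_iSup (fun n => ((measurable_maxFn f).min measurable_const).pow_const p)]
  · exact iSup_le key
  · intro m n hmn x
    simp only
    gcongr

end AdvDiff

/-! ### The Lusin–Lipschitz inequality for Sobolev functions. -/

namespace AdvDiff

open Filter Topology
open Metric
open scoped Convolution

variable {d : ℕ} {F : Type} [NormedAddCommGroup F] [NormedSpace ℝ F]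

theorem lintegral_ball_comp_segment (f : Space d → ℝ≥0∞) (hf : Measurable f) (x : Space d)
    {r s : ℝ} (hs : 0 < s) :
    ∫⁻ z in ball x r, f (x + s • (z - x)) =
      (ENNReal.ofReal (s ^ d))⁻¹ * ∫⁻ z in ball x (s * r), f z := by
  have h1 : ∫⁻ z in ball x r, f (x + s • (z - x)) =
      ∫⁻ z, (ball x (s * r)).indicator f (x + s • z) := by
    rw [← lintegral_indicator isOpen_ball.measurableSet,
      ← lintegral_add_right_eq_self (fun z => (ball x r).indicator
        (fun z => f (x + s • (z - x))) z) x]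
    congr 1; ext z
    have : z + x ∈ ball x r ↔ x + s • z ∈ ball x (s * r) := by
      rw [mem_ball_iff_norm, mem_ball_iff_norm, add_sub_cancel_right, add_sub_cancel_left,
        norm_smul, Real.norm_of_nonneg hs.le, mul_lt_mul_iff_right₀ hs]
    by_cases h : z + x ∈ ball x r
    · rw [indicator_of_mem h, indicator_of_mem (this.1 h), add_sub_cancel_right]
    · rw [indicator_of_notMem h, indicator_of_notMem (fun h' => h (this.2 h'))]
  have hm : Measurable ((ball x (s * r)).indicator f) := hf.indicator isOpen_ball.measurableSet
  have h2 : ∫⁻ z, (ball x (s * r)).indicator f (x + s • z) =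
      ∫⁻ z, (ball x (s * r)).indicator f (x + z) ∂(Measure.map (s • ·) volume) := by
    rw [lintegral_map (by exact hm.comp (measurable_const_add x)) (measurable_const_smul s)]
  rw [h1, h2, Measure.map_addHaar_smul _ hs.ne', lintegral_smul_measure,
    lintegral_add_left_eq_self, lintegral_indicator isOpen_ball.measurableSet,
    finrank_euclideanSpace_fin, abs_of_pos (by positivity), ENNReal.ofReal_inv_of_pos (by positivity),
    smul_eq_mul]

theorem enorm_sub_le_lintegral_segment {w : Space d → F} (hw : ContDiff ℝ 1 w) [CompleteSpace F]
    (x z : Space d) :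
    ‖w z - w x‖ₑ ≤ ∫⁻ s in Ioc (0 : ℝ) 1, ‖fderiv ℝ w (x + s • (z - x))‖ₑ * ‖z - x‖ₑ := by
  have hd := hw.continuous_fderiv one_ne_zero
  have h1 : ∀ s ∈ uIcc (0 : ℝ) 1, HasDerivAt (fun s : ℝ => w (x + s • (z - x)))
      (fderiv ℝ w (x + s • (z - x)) (z - x)) s := fun s _ => by
    have h1 := (hw.differentiable one_ne_zero (x + s • (z - x))).hasFDerivAt
    have h2 : HasDerivAt (fun s : ℝ => x + s • (z - x)) (z - x) s := by
      simpa using ((hasDerivAt_id s).smul_const (z - x)).const_add x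
    exact h1.comp_hasDerivAt s h2
  have h2 := intervalIntegral.integral_eq_sub_of_hasDerivAt h1
    (Continuous.intervalIntegrable ((hd.comp (by fun_prop)).clm_apply continuous_const) _ _)
  simp only [one_smul, add_sub_cancel, zero_smul, add_zero] at h2
  rw [← h2, intervalIntegral.integral_of_le zero_le_one]
  refine (enorm_integral_le_lintegral_enorm _).trans ?_
  exact lintegral_mono fun s => ContinuousLinearMap.le_opENorm _ _

/-- Integrate the derivative along segments from x. The Jacobian of the contraction by s cancels the
volume ratio of the balls of radius r and sr, so the bound is uniform in s. -/
theorem lintegral_ball_enorm_sub_le {w : Space d → F} (hw : ContDiff ℝ 1 w) [CompleteSpace F]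
    (x : Space d) {r : ℝ} {A : ℝ≥0∞}
    (hA : ∀ s, 0 < s → ∫⁻ z in ball x s, ‖fderiv ℝ w z‖ₑ ≤ A * volume (ball (0 : Space d) s)) :
    ∫⁻ z in ball x r, ‖w z - w x‖ₑ ≤
      ENNReal.ofReal r * (A * volume (ball (0 : Space d) r)) := by
  rcases le_or_gt r 0 with hr | hr
  · rw [ball_eq_empty.2 hr]; simp
  have hd := hw.continuous_fderiv one_ne_zero
  calc ∫⁻ z in ball x r, ‖w z - w x‖ₑ
      ≤ ∫⁻ z in ball x r, ∫⁻ s in Ioc (0 : ℝ) 1,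
          ‖fderiv ℝ w (x + s • (z - x))‖ₑ * ENNReal.ofReal r := by
        refine setLIntegral_mono' isOpen_ball.measurableSet fun z hz => ?_
        refine (enorm_sub_le_lintegral_segment hw x z).trans ?_
        gcongr
        rw [← ofReal_norm]
        exact ENNReal.ofReal_le_ofReal (by rw [mem_ball_iff_norm] at hz; exact hz.le)
    _ = ∫⁻ s in Ioc (0 : ℝ) 1, ∫⁻ z in ball x r,
          ‖fderiv ℝ w (x + s • (z - x))‖ₑ * ENNReal.ofReal r := by
        refine lintegral_lintegral_swap (Measurable.aemeasurable ?_)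
        exact ((hd.comp (by fun_prop)).enorm.measurable).mul measurable_const
    _ ≤ ∫⁻ s in Ioc (0 : ℝ) 1, ENNReal.ofReal r * (A * volume (ball (0 : Space d) r)) := by
        refine setLIntegral_mono' measurableSet_Ioc fun s hs => ?_
        rw [lintegral_mul_const' _ _ ENNReal.ofReal_ne_top,
          lintegral_ball_comp_segment (fun z => ‖fderiv ℝ w z‖ₑ) hd.enorm.measurable x hs.1, mul_comm]
        refine mul_le_mul_right ?_ _
        rw [ENNReal.inv_mul_le_iff (by have := hs.1; simp; positivity) ENNReal.ofReal_ne_top]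
        refine (hA (s * r) (mul_pos hs.1 hr)).trans (le_of_eq ?_)
        rw [volume_ball_mul hs.1]
        ring
    _ = _ := by simp

/-- A Lusin-Lipschitz inequality for smooth functions. -/
theorem enorm_sub_le_of_lintegral_ball_le {w : Space d → F} (hw : ContDiff ℝ 1 w) [CompleteSpace F]
    {A : Space d → ℝ≥0∞}
    (hA : ∀ x, ∀ s, 0 < s →
      ∫⁻ z in ball x s, ‖fderiv ℝ w z‖ₑ ≤ A x * volume (ball (0 : Space d) s)) (x y : Space d) :
    ‖w x - w y‖ₑ ≤ ENNReal.ofReal (2 ^ d) * (‖x - y‖ₑ * (A x + A y)) := by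
  rcases eq_or_ne x y with rfl | hxy
  · simp
  set r := ‖x - y‖ with hr
  have hr0 : 0 < r := norm_sub_pos_iff.2 hxy
  -- The ball of radius |x - y|/2 about the midpoint lies in both balls of radius |x - y| about x
  -- and y; comparing w(x) and w(y) with values there costs the volume ratio 2^d.
  set m := midpoint ℝ x y
  have hmx : dist m x = r / 2 := by
    rw [dist_midpoint_left, dist_eq_norm, ← hr]; simp; ring
  have hmy : dist m y = r / 2 := by
    rw [dist_midpoint_right, dist_eq_norm, ← hr]; simp; ring
  have hbx : ball m (r / 2) ⊆ ball x r := ball_subset_ball' (by rw [hmx]; linarith)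
  have hby : ball m (r / 2) ⊆ ball y r := ball_subset_ball' (by rw [hmy]; linarith)
  have hvol : volume (ball (0 : Space d) r) =
      ENNReal.ofReal (2 ^ d) * volume (ball (0 : Space d) (r / 2)) := by
    rw [← volume_ball_mul two_pos 0, mul_div_cancel₀ _ two_ne_zero]
  have hc := hw.continuous
  have key : volume (ball (0 : Space d) (r / 2)) * ‖w x - w y‖ₑ ≤
      volume (ball (0 : Space d) (r / 2)) *
        (ENNReal.ofReal (2 ^ d) * (‖x - y‖ₑ * (A x + A y))) := by
    calc volume (ball (0 : Space d) (r / 2)) * ‖w x - w y‖ₑ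
        = ∫⁻ _ in ball m (r / 2), ‖w x - w y‖ₑ := by
          rw [setLIntegral_const, volume_ball_eq m, mul_comm]
      _ ≤ ∫⁻ z in ball m (r / 2), (‖w z - w x‖ₑ + ‖w z - w y‖ₑ) := by
          refine lintegral_mono fun z => ?_
          rw [← sub_sub_sub_cancel_left _ _ (w z), enorm_sub_rev]
          rw [enorm_sub_rev]
          exact (enorm_sub_le).trans (by rw [add_comm])
      _ = (∫⁻ z in ball m (r / 2), ‖w z - w x‖ₑ) + ∫⁻ z in ball m (r / 2), ‖w z - w y‖ₑ :=
          lintegral_add_left (hc.sub continuous_const).enorm.measurable _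
      _ ≤ (∫⁻ z in ball x r, ‖w z - w x‖ₑ) + ∫⁻ z in ball y r, ‖w z - w y‖ₑ :=
          add_le_add (lintegral_mono_set hbx) (lintegral_mono_set hby)
      _ ≤ ENNReal.ofReal r * (A x * volume (ball (0 : Space d) r)) +
          ENNReal.ofReal r * (A y * volume (ball (0 : Space d) r)) :=
          add_le_add (lintegral_ball_enorm_sub_le hw x (hA x))
            (lintegral_ball_enorm_sub_le hw y (hA y))
      _ = _ := by rw [hvol, hr, ofReal_norm]; ring
  exact (ENNReal.mul_le_mul_iff_right (volume_ball_ne_zero (by positivity))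
    measure_ball_lt_top.ne).1 key

/-- Averages over balls of a mollification are controlled by the maximal function. -/
theorem lintegral_ball_mollify_le {f : Space d → ℝ≥0∞} (hf : Measurable f)
    {φ : Space d → ℝ≥0∞} (hφ : Measurable φ) {R : ℝ} (hR : 0 < R) (hφ1 : ∫⁻ x, φ x ≤ 1)
    (hφ0 : ∀ x, R ≤ ‖x‖ → φ x = 0)
    (hφb : ∀ x, φ x * volume (ball (0 : Space d) R) ≤ ENNReal.ofReal (2 ^ d))
    (x : Space d) {s : ℝ} (hs : 0 < s) :
    ∫⁻ z in ball x s, ∫⁻ y, φ (z - y) * f y ≤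
      ENNReal.ofReal (4 ^ d) * maxFn f x * volume (ball (0 : Space d) s) := by
  have h24 : ENNReal.ofReal (4 ^ d) = ENNReal.ofReal (2 ^ d) * ENNReal.ofReal (2 ^ d) := by
    rw [← ENNReal.ofReal_mul (by positivity), ← mul_pow]; norm_num
  have hball : ∀ s, 0 < s → ∫⁻ y in ball x (2 * s), f y ≤
      ENNReal.ofReal (2 ^ d) * maxFn f x * volume (ball (0 : Space d) s) := fun s hs => by
    refine (lintegral_ball_le_maxFn f x (mul_pos two_pos hs)).trans (le_of_eq ?_)
    rw [volume_ball_mul two_pos]; ring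
  have hloc : ∀ ρ, s ≤ ρ → R ≤ ρ → ∀ z ∈ ball x s, ∫⁻ y, φ (z - y) * f y =
      ∫⁻ y in ball x (2 * ρ), φ (z - y) * f y := by
    intro ρ h1 h2 z hz
    rw [← lintegral_indicator isOpen_ball.measurableSet]
    congr 1; ext y
    by_cases hy : y ∈ ball x (2 * ρ)
    · rw [indicator_of_mem hy]
    · rw [indicator_of_notMem hy, hφ0, zero_mul]
      by_contra! h
      apply hy
      rw [mem_ball] at *
      have : dist y z < R := by rwa [dist_comm, dist_eq_norm]
      linarith [dist_triangle y z x]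
  have hone : ∀ y, ∫⁻ z, φ (z - y) ≤ 1 := fun y => by
    rwa [lintegral_sub_right_eq_self φ y]
  -- If the kernel is narrower than the ball, Fubini and its unit mass reduce to the ball of radius
  -- 2s. If it is wider, it is bounded by 2^d divided by the volume of its ball, and the ball of
  -- radius 2R contributes another 2^d.
  rcases le_total R s with hRs | hRs
  · calc ∫⁻ z in ball x s, ∫⁻ y, φ (z - y) * f y
        = ∫⁻ z in ball x s, ∫⁻ y in ball x (2 * s), φ (z - y) * f y :=
          setLIntegral_congr_fun isOpen_ball.measurableSet (hloc s le_rfl hRs)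
      _ = ∫⁻ y in ball x (2 * s), ∫⁻ z in ball x s, φ (z - y) * f y := by
          refine lintegral_lintegral_swap (Measurable.aemeasurable ?_)
          exact (hφ.comp (measurable_fst.sub measurable_snd)).mul (hf.comp measurable_snd)
      _ ≤ ∫⁻ y in ball x (2 * s), f y := by
          refine lintegral_mono fun y => ?_
          rw [lintegral_mul_const _ (by exact hφ.comp (measurable_id.sub_const y))]
          exact mul_le_of_le_one_left' ((setLIntegral_le_lintegral _ _).trans (hone y))
      _ ≤ ENNReal.ofReal (2 ^ d) * maxFn f x * volume (ball (0 : Space d) s) := hball s hs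
      _ ≤ _ := by
          gcongr
          norm_num
  · calc ∫⁻ z in ball x s, ∫⁻ y, φ (z - y) * f y
        = ∫⁻ z in ball x s, ∫⁻ y in ball x (2 * R), φ (z - y) * f y :=
          setLIntegral_congr_fun isOpen_ball.measurableSet (hloc R hRs le_rfl)
      _ ≤ ∫⁻ z in ball x s, ENNReal.ofReal (4 ^ d) * maxFn f x := by
          refine lintegral_mono fun z => ?_
          calc ∫⁻ y in ball x (2 * R), φ (z - y) * f y
              ≤ ∫⁻ y in ball x (2 * R),
                  ENNReal.ofReal (2 ^ d) / volume (ball (0 : Space d) R) * f y := by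
                gcongr with y
                rw [ENNReal.le_div_iff_mul_le (.inl (volume_ball_ne_zero hR))
                  (.inl measure_ball_lt_top.ne)]
                exact hφb _
            _ ≤ ENNReal.ofReal (2 ^ d) / volume (ball (0 : Space d) R) *
                  (ENNReal.ofReal (2 ^ d) * maxFn f x * volume (ball (0 : Space d) R)) := by
                rw [lintegral_const_mul _ hf]
                gcongr
                exact hball R hR
            _ = (ENNReal.ofReal (2 ^ d) / volume (ball (0 : Space d) R) *
                  volume (ball (0 : Space d) R)) * (ENNReal.ofReal (2 ^ d) * maxFn f x) := by ring
            _ = _ := by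
                rw [ENNReal.div_mul_cancel (volume_ball_ne_zero hR) measure_ball_lt_top.ne, h24]
                ring
      _ = _ := by rw [setLIntegral_const, volume_ball_eq]

/-- Mollification commutes with weak differentiation: the reflected kernel y ↦ ρ(x - y) is itself an
admissible test function, and the two signs cancel. -/
theorem fderiv_normed_convolution_apply [CompleteSpace F] {u : Space d → F}
    {Du : Space d → Space d →L[ℝ] F} (hu : HasWeakFDeriv u Du) (φ : ContDiffBump (0 : Space d))
    (x v : Space d) :
    fderiv ℝ (φ.normed volume ⋆[ContinuousLinearMap.lsmul ℝ ℝ, volume] u) x v =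
      ∫ y, φ.normed volume (x - y) • Du y v := by
  set ρ := φ.normed volume with hρ
  have hρs : HasCompactSupport ρ := φ.hasCompactSupport_normed
  have hρd : ContDiff ℝ (⊤ : ℕ∞) ρ := φ.contDiff_normed
  have h1 := hρs.hasFDerivAt_convolution_left (ContinuousLinearMap.lsmul ℝ ℝ : ℝ →L[ℝ] F →L[ℝ] F)
    (hρd.of_le (by simp)) hu.locallyIntegrable x
  have hρs' : HasCompactSupport (fderiv ℝ ρ) := hρs.fderiv ℝ
  have hex : ConvolutionExistsAt (fderiv ℝ ρ) u x
      ((ContinuousLinearMap.lsmul ℝ ℝ : ℝ →L[ℝ] F →L[ℝ] F).precompL (Space d)) volume :=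
    hρs'.convolutionExists_left _ (hρd.continuous_fderiv (by simp)) hu.locallyIntegrable x
  rw [h1.fderiv, convolution_def, ContinuousLinearMap.integral_apply hex]
  simp only [ContinuousLinearMap.precompL_apply, ContinuousLinearMap.lsmul_apply]
  rw [← integral_sub_left_eq_self (fun t => fderiv ℝ ρ t v • u (x - t)) volume x]
  have h2 := hu.integral_eq (fun y => ρ (x - y)) (hρd.comp (contDiff_const.sub contDiff_id))
    (hρs.comp_homeomorph (Homeomorph.subLeft x)) v
  have h3 : ∀ y, fderiv ℝ (fun y => ρ (x - y)) y v = -fderiv ℝ ρ (x - y) v := fun y => by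
    have := (hρd.differentiable (by simp) (x - y)).hasFDerivAt.comp y
      ((hasFDerivAt_id y).const_sub x)
    have h4 : fderiv ℝ (fun y => ρ (x - y)) y = _ := this.fderiv
    rw [h4]; simp
  simp_rw [h3, neg_smul, integral_neg, neg_inj] at h2
  rw [← h2]
  simp

/-- **Lusin-Lipschitz inequality** for Sobolev functions. -/
theorem ae_enorm_sub_le_maxFn [CompleteSpace F]
    {u : Space d → F}
    {Du : Space d → Space d →L[ℝ] F} (hu : HasWeakFDeriv u Du) :
    ∃ S : Set (Space d), (∀ᵐ x, x ∈ S) ∧ ∀ x ∈ S, ∀ y ∈ S, ‖u x - u y‖ₑ ≤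
      ‖x - y‖ₑ * (ENNReal.ofReal (8 ^ d) * maxFn (fun x => ‖Du x‖ₑ) x +
        ENNReal.ofReal (8 ^ d) * maxFn (fun x => ‖Du x‖ₑ) y) := by
  -- Taking the inner radius to be half the outer one bounds the kernels by 2^d over the ball volume
  -- and ensures convergence almost everywhere.
  let φ : ℕ → ContDiffBump (0 : Space d) := fun n =>
    ⟨1 / (2 * (n + 1)), 1 / (n + 1), by positivity, by
      apply one_div_lt_one_div_of_lt (by positivity)
      have : (0 : ℝ) < n + 1 := by positivity
      linarith⟩
  have hφK : ∀ n, (φ n).rOut ≤ 2 * (φ n).rIn := fun n => by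
    change (1 : ℝ) / (n + 1) ≤ 2 * (1 / (2 * (n + 1)))
    apply le_of_eq; field_simp
  have hφ0 : Tendsto (fun n => (φ n).rOut) atTop (𝓝 0) :=
    tendsto_one_div_add_atTop_nhds_zero_nat
  have hae := ContDiffBump.ae_convolution_tendsto_right_of_locallyIntegrable hφ0
    (.of_forall hφK) hu.locallyIntegrable
  -- The good set S consists of the points at which the mollifications converge to u.
  refine ⟨_, hae, fun x hx y hy => ?_⟩
  have hDm : AEMeasurable (fun x => ‖Du x‖ₑ) := hu.locallyIntegrable_deriv.aestronglyMeasurable.enorm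
  have key : ∀ n, ‖((φ n).normed volume ⋆[ContinuousLinearMap.lsmul ℝ ℝ, volume] u) x -
      ((φ n).normed volume ⋆[ContinuousLinearMap.lsmul ℝ ℝ, volume] u) y‖ₑ ≤
      ‖x - y‖ₑ * (ENNReal.ofReal (8 ^ d) * maxFn (fun x => ‖Du x‖ₑ) x +
        ENNReal.ofReal (8 ^ d) * maxFn (fun x => ‖Du x‖ₑ) y) := by
    intro n
    set ρ := (φ n).normed volume with hρ
    have hw : ContDiff ℝ 1 (ρ ⋆[ContinuousLinearMap.lsmul ℝ ℝ, volume] u) :=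
      (φ n).hasCompactSupport_normed.contDiff_convolution_left _ (φ n).contDiff_normed
        hu.locallyIntegrable
    have hb : ∀ z, ‖fderiv ℝ (ρ ⋆[ContinuousLinearMap.lsmul ℝ ℝ, volume] u) z‖ₑ ≤
        ∫⁻ y, ‖ρ (z - y)‖ₑ * hDm.mk _ y := by
      intro z
      refine ContinuousLinearMap.opENorm_le_bound _ fun v => ?_
      rw [hρ, fderiv_normed_convolution_apply hu]
      refine (enorm_integral_le_lintegral_enorm _).trans ?_
      rw [← lintegral_mul_const'' _ ?_]
      · refine lintegral_mono_ae ?_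
        filter_upwards [hDm.ae_eq_mk] with y hy
        rw [enorm_smul, ← hy, mul_assoc]
        gcongr
        exact ContinuousLinearMap.le_opENorm _ _
      · refine AEMeasurable.mul ?_ hDm.measurable_mk.aemeasurable
        exact ((φ n).continuous_normed.comp (by fun_prop)).enorm.measurable.aemeasurable
    have hA : ∀ x, ∀ s, 0 < s →
        ∫⁻ z in ball x s, ‖fderiv ℝ (ρ ⋆[ContinuousLinearMap.lsmul ℝ ℝ, volume] u) z‖ₑ ≤
        (ENNReal.ofReal (4 ^ d) * maxFn (fun x => ‖Du x‖ₑ) x) * volume (ball (0 : Space d) s) := by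
      intro x s hs
      refine (lintegral_mono fun z => hb z).trans ?_
      rw [maxFn_congr hDm.ae_eq_mk]
      refine lintegral_ball_mollify_le hDm.measurable_mk (φ := fun z => ‖ρ z‖ₑ)
        (φ n).continuous_normed.enorm.measurable (φ n).rOut_pos ?_ ?_ ?_ x hs
      · have := (φ n).integral_normed (μ := volume)
        have h2 : ∫⁻ z, ‖ρ z‖ₑ = ∫⁻ z, ENNReal.ofReal (ρ z) := by
          congr 1; ext z
          rw [← ofReal_norm, Real.norm_of_nonneg ((φ n).nonneg_normed z)]
        rw [h2, ← ofReal_integral_eq_lintegral_ofReal (φ n).integrable_normed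
          (.of_forall (φ n).nonneg_normed), this]
        simp
      · intro z hz
        have : z ∉ Function.support ρ := by
          rw [hρ, ContDiffBump.support_normed_eq]
          simpa using hz
        rw [Function.notMem_support.1 this]; simp
      · intro z
        have h1 := (φ n).normed_le_div_measure_closedBall_rOut volume 2 (hφK n) z
        have hv : volume.real (ball (0 : Space d) (φ n).rOut) ≤
            volume.real (closedBall (0 : Space d) (φ n).rOut) :=
          measureReal_mono ball_subset_closedBall measure_closedBall_lt_top.ne
        have hv0 : 0 < volume.real (ball (0 : Space d) (φ n).rOut) :=
          ENNReal.toReal_pos (volume_ball_ne_zero (φ n).rOut_pos) measure_ball_lt_top.ne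
        rw [le_div_iff₀ (hv0.trans_le hv), finrank_euclideanSpace_fin] at h1
        rw [← ofReal_norm, Real.norm_of_nonneg ((φ n).nonneg_normed z),
          ← ENNReal.ofReal_toReal (measure_ball_lt_top (μ := volume) (x := (0 : Space d))
            (r := (φ n).rOut)).ne, ← ENNReal.ofReal_mul ((φ n).nonneg_normed z)]
        exact ENNReal.ofReal_le_ofReal
          ((mul_le_mul_of_nonneg_left hv ((φ n).nonneg_normed z)).trans h1)
    -- The constant 8^d is 2^d from the midpoint argument times 4^d from the mollification.
    refine (enorm_sub_le_of_lintegral_ball_le hw hA x y).trans (le_of_eq ?_)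
    have : ENNReal.ofReal (8 ^ d) = ENNReal.ofReal (2 ^ d) * ENNReal.ofReal (4 ^ d) := by
      rw [← ENNReal.ofReal_mul (by positivity), ← mul_pow]; norm_num
    rw [this]; ring
  have hx' : Tendsto (fun n => ((φ n).normed volume ⋆[ContinuousLinearMap.lsmul ℝ ℝ, volume] u) x)
    atTop (𝓝 (u x)) := hx
  have hy' : Tendsto (fun n => ((φ n).normed volume ⋆[ContinuousLinearMap.lsmul ℝ ℝ, volume] u) y)
    atTop (𝓝 (u y)) := hy
  exact le_of_tendsto ((hx'.sub hy').enorm) (.of_forall key)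

end AdvDiff

/-! ### Estimates in space at a fixed time. -/

namespace AdvDiff

open Filter Topology
variable {d : ℕ}

theorem lintegral_rpow_enorm_le_of_eLpNorm_le {θ : Space d → ℝ} {M : ℝ≥0} {Q : ℝ} (hQ : 0 < Q)
    (h : eLpNorm θ (ENNReal.ofReal Q) volume ≤ M) : ∫⁻ x, ‖θ x‖ₑ ^ Q ≤ (M : ℝ≥0∞) ^ Q := by
  rw [eLpNorm_eq_lintegral_rpow_enorm_toReal (by simpa using hQ) ENNReal.ofReal_ne_top,
    ENNReal.toReal_ofReal hQ.le] at h
  have := ENNReal.rpow_le_rpow h hQ.le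
  rwa [← ENNReal.rpow_mul, one_div, inv_mul_cancel₀ hQ.ne', ENNReal.rpow_one] at this

/-- Interpolation between L¹ and L^q, used at the conjugate exponent r of p: for finite q by |θ|^r ≤
|θ| + |θ|^q, for q = ∞ by taking out r - 1 factors. -/
theorem exists_lintegral_rpow_le {q : ℝ≥0∞} {r : ℝ} (hr : 1 ≤ r) (hrq : ENNReal.ofReal r ≤ q)
    (M : ℝ≥0) : ∃ B : ℝ≥0, ∀ θ : Space d → ℝ, AEStronglyMeasurable θ →
      eLpNorm θ 1 volume ≤ M → eLpNorm θ q volume ≤ M → ∫⁻ x, ‖θ x‖ₑ ^ r ≤ B := by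
  rcases eq_or_ne q ⊤ with rfl | hq
  · refine ⟨M * M ^ (r - 1), fun θ hθ h1 h2 => ?_⟩
    rw [eLpNorm_one_eq_lintegral_enorm] at h1
    rw [eLpNorm_exponent_top] at h2
    have h3 : ∀ᵐ x, ‖θ x‖ₑ ^ r ≤ ‖θ x‖ₑ * (M : ℝ≥0∞) ^ (r - 1) := by
      filter_upwards [ae_le_eLpNormEssSup (f := θ) (μ := volume)] with x hx
      have : ‖θ x‖ₑ ^ r = ‖θ x‖ₑ * ‖θ x‖ₑ ^ (r - 1) := by
        nth_rw 2 [← ENNReal.rpow_one ‖θ x‖ₑ]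
        rw [← ENNReal.rpow_add_of_nonneg _ _ zero_le_one (by linarith)]
        congr 1; ring
      rw [this]
      gcongr
      exact hx.trans h2
    refine (lintegral_mono_ae h3).trans ?_
    rw [lintegral_mul_const'' _ hθ.enorm, ENNReal.coe_mul, ENNReal.coe_rpow_of_nonneg _ (by linarith)]
    gcongr
  · have hQr : r ≤ q.toReal := (ENNReal.ofReal_le_iff_le_toReal hq).1 hrq
    have hQ0 : 0 < q.toReal := by linarith
    refine ⟨M + M ^ q.toReal, fun θ hθ h1 h2 => ?_⟩
    rw [eLpNorm_one_eq_lintegral_enorm] at h1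
    rw [← ENNReal.ofReal_toReal hq] at h2
    have h3 := lintegral_rpow_enorm_le_of_eLpNorm_le hQ0 h2
    calc ∫⁻ x, ‖θ x‖ₑ ^ r ≤ ∫⁻ x, (‖θ x‖ₑ + ‖θ x‖ₑ ^ q.toReal) := by
          refine lintegral_mono fun x => ?_
          rcases le_total ‖θ x‖ₑ 1 with h | h
          · refine le_trans ?_ le_self_add
            exact (ENNReal.rpow_le_rpow_of_exponent_ge h hr).trans_eq (ENNReal.rpow_one _)
          · exact (ENNReal.rpow_le_rpow_of_exponent_le h hQr).trans le_add_self
      _ = (∫⁻ x, ‖θ x‖ₑ) + ∫⁻ x, ‖θ x‖ₑ ^ q.toReal := lintegral_add_left' hθ.enorm _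
      _ ≤ _ := by
          rw [ENNReal.coe_add, ENNReal.coe_rpow_of_nonneg _ hQ0.le]
          gcongr

/-- Hölder's inequality with the interpolated conjugate exponent. -/
theorem exists_lintegral_mul_le {p q : ℝ≥0∞} (hp : 1 < p) (hpt : p ≠ ⊤)
    (hpq : p⁻¹ + q⁻¹ ≤ 1) (M : ℝ≥0) :
    ∃ C : ℝ≥0, ∀ (g : Space d → ℝ≥0∞) (θ : Space d → ℝ), AEMeasurable g →
      AEStronglyMeasurable θ → eLpNorm θ 1 volume ≤ M → eLpNorm θ q volume ≤ M →
      ∫⁻ x, g x * ‖θ x‖ₑ ≤ C * (∫⁻ x, g x ^ p.toReal) ^ (1 / p.toReal) := by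
  have hP : 1 < p.toReal := by
    rw [← ENNReal.toReal_one]
    exact (ENNReal.toReal_lt_toReal ENNReal.one_ne_top hpt).2 hp
  have hc := Real.HolderConjugate.conjExponent hP
  set r := p.toReal.conjExponent
  have hrq : ENNReal.ofReal r ≤ q := by
    have hr : (ENNReal.ofReal r)⁻¹ = 1 - p⁻¹ := by
      have h1 := hc.inv_add_inv_eq_one
      rw [← ENNReal.ofReal_inv_of_pos hc.symm.pos]
      have h2 : r⁻¹ = 1 - p.toReal⁻¹ := by linarith
      rw [h2, ENNReal.ofReal_sub _ (by positivity), ENNReal.ofReal_one,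
        ENNReal.ofReal_inv_of_pos hc.pos, ENNReal.ofReal_toReal hpt]
    rw [← ENNReal.inv_le_inv, hr]
    have hp' : p⁻¹ ≠ ⊤ := by simpa using (zero_lt_one.trans hp).ne'
    rw [add_comm] at hpq
    exact (ENNReal.le_sub_of_add_le_right hp' hpq)
  obtain ⟨B, hB⟩ := exists_lintegral_rpow_le (d := d) hc.symm.lt.le hrq M
  refine ⟨B ^ (1 / r), fun g θ hg hθ h1 h2 => ?_⟩
  have := ENNReal.lintegral_mul_le_Lp_mul_Lq volume hc hg hθ.enorm
  refine (this.trans ?_)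
  rw [mul_comm, ENNReal.coe_rpow_of_nonneg _ (by have := hc.symm.pos; positivity)]
  gcongr
  · have := hc.symm.pos; positivity
  · exact hB θ hθ h1 h2

theorem lintegral_mul_le_of_ae_le {g : Space d → ℝ≥0∞} {θ : Space d → ℝ} {K : ℝ≥0∞} {M : ℝ≥0}
    (hθ : AEStronglyMeasurable θ)
    (hg : ∀ᵐ x, g x ≤ K) (h1 : eLpNorm θ 1 volume ≤ M) : ∫⁻ x, g x * ‖θ x‖ₑ ≤ M * K := by
  rw [eLpNorm_one_eq_lintegral_enorm] at h1
  calc ∫⁻ x, g x * ‖θ x‖ₑ ≤ ∫⁻ x, K * ‖θ x‖ₑ := by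
        refine lintegral_mono_ae ?_
        filter_upwards [hg] with x hx
        gcongr
    _ = K * ∫⁻ x, ‖θ x‖ₑ := lintegral_const_mul'' _ hθ.enorm
    _ ≤ M * K := by rw [mul_comm]; gcongr

theorem exists_lintegral_enorm_mul_le {p q : ℝ≥0∞} (hp : 1 < p) (hpq : p⁻¹ + q⁻¹ ≤ 1) (M : ℝ≥0) :
    ∃ C : ℝ≥0, ∀ {F : Type} [NormedAddCommGroup F] (f : Space d → F) (θ : Space d → ℝ),
      AEStronglyMeasurable f →
      AEStronglyMeasurable θ → eLpNorm θ 1 volume ≤ M → eLpNorm θ q volume ≤ M →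
      ∫⁻ x, ‖f x‖ₑ * ‖θ x‖ₑ ≤ C * eLpNorm f p volume := by
  rcases eq_or_ne p ⊤ with rfl | hpt
  · refine ⟨M, fun f θ hf hθ h1 h2 => ?_⟩
    rw [eLpNorm_exponent_top]
    exact lintegral_mul_le_of_ae_le hθ ae_le_eLpNormEssSup h1
  · obtain ⟨C, hC⟩ := exists_lintegral_mul_le (d := d) hp hpt hpq M
    refine ⟨C, fun f θ hf hθ h1 h2 => ?_⟩
    rw [eLpNorm_eq_lintegral_rpow_enorm_toReal (zero_lt_one.trans hp).ne' hpt]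
    exact hC _ θ hf.enorm hθ h1 h2

/-- At p = ∞ the maximal function is bounded by the essential supremum; otherwise the strong type
estimate is combined with Hölder. This bounds the growth rate of the transport cost due to u₁. -/
theorem exists_lintegral_maxFn_mul_le {p q : ℝ≥0∞} (hp : 1 < p) (hpq : p⁻¹ + q⁻¹ ≤ 1) (M : ℝ≥0) :
    ∃ C : ℝ≥0, ∀ {F : Type} [NormedAddCommGroup F] (f : Space d → F) (θ : Space d → ℝ),
      AEStronglyMeasurable f →
      AEStronglyMeasurable θ → eLpNorm θ 1 volume ≤ M → eLpNorm θ q volume ≤ M →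
      ∫⁻ x, maxFn (fun x => ‖f x‖ₑ) x * ‖θ x‖ₑ ≤ C * eLpNorm f p volume := by
  rcases eq_or_ne p ⊤ with rfl | hpt
  · refine ⟨M, fun f θ hf hθ h1 h2 => ?_⟩
    rw [eLpNorm_exponent_top]
    exact lintegral_mul_le_of_ae_le hθ
      (.of_forall (maxFn_le_of_ae_le ae_le_eLpNormEssSup)) h1
  · obtain ⟨C, hC⟩ := exists_lintegral_mul_le (d := d) hp hpt hpq M
    have hP : 1 < p.toReal := by
      rw [← ENNReal.toReal_one]
      exact (ENNReal.toReal_lt_toReal ENNReal.one_ne_top hpt).2 hp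
    set K := p.toReal * (2 * 4 ^ d) * (1 / (p.toReal - 1)) * 2 ^ (p.toReal - 1)
    refine ⟨C * (Real.toNNReal K) ^ (1 / p.toReal), fun f θ hf hθ h1 h2 => ?_⟩
    rw [eLpNorm_eq_lintegral_rpow_enorm_toReal (zero_lt_one.trans hp).ne' hpt]
    refine (hC _ θ (measurable_maxFn _).aemeasurable hθ h1 h2).trans ?_
    rw [ENNReal.coe_mul, ENNReal.coe_rpow_of_nonneg _ (by positivity), mul_assoc,
      ← ENNReal.mul_rpow_of_nonneg _ _ (by positivity : 0 ≤ 1 / p.toReal)]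
    gcongr
    have hm : AEMeasurable (fun x => ‖f x‖ₑ) := hf.enorm
    rw [maxFn_congr hm.ae_eq_mk]
    refine (lintegral_maxFn_rpow_le hP hm.measurable_mk).trans ?_
    change ENNReal.ofReal K * _ ≤ ENNReal.ofReal K * _
    gcongr 1
    refine (lintegral_congr_ae ?_).le
    filter_upwards [hm.ae_eq_mk] with x hx
    rw [← hx]

end AdvDiff

/-! ### Lebesgue points in time. -/

namespace AdvDiff

open Filter Topology
variable {d : ℕ}

/-- Lebesgue differentiation of the primitive, kept one-sided because only forward steps in time are
taken. -/
theorem ae_forall_setLIntegral_le {T : ℝ} {φ : ℝ → ℝ≥0∞}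
    (hφ : AEMeasurable φ (volume.restrict (Ioo 0 T))) (hi : ∫⁻ t in Ioo 0 T, φ t < ⊤) :
    ∀ᵐ t ∂(volume.restrict (Ioo 0 T)), φ t < ⊤ ∧ ∀ η > (0 : ℝ), ∃ h₀ > (0 : ℝ), t + h₀ < T ∧
      ∀ h, 0 < h → h ≤ h₀ →
        ∫⁻ s in Ioc t (t + h), φ s ≤ ENNReal.ofReal (((φ t).toReal + η) * h) := by
  rcases le_total T 0 with hT | hT
  · simp [Ioo_eq_empty_of_le hT]
  have hint : IntegrableOn (fun s => (φ s).toReal) (Ioo 0 T) :=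
    integrable_toReal_of_lintegral_ne_top hφ hi.ne
  have hint' : IntervalIntegrable (fun s => (φ s).toReal) volume 0 T := by
    rwa [intervalIntegrable_iff_integrableOn_Ioo_of_le hT]
  have hfin := ae_lt_top' hφ hi.ne
  filter_upwards [hfin, ae_restrict_of_ae hint'.ae_hasDerivAt_integral, ae_restrict_mem measurableSet_Ioo]
    with t ht htd htT
  refine ⟨ht, fun η hη => ?_⟩
  have hd := htd (by rw [uIcc_of_le (htT.1.trans htT.2).le]; exact Ioo_subset_Icc_self htT) 0 (by simp)
  have h1 := (hasDerivAt_iff_tendsto_slope_zero.1 hd).mono_left (nhdsWithin_mono 0 (s := Ioi 0)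
    fun x hx => ne_of_gt hx)
  have h2 := h1.eventually (gt_mem_nhds (lt_add_of_pos_right _ hη))
  obtain ⟨ε, hε, hε'⟩ := (mem_nhdsGT_iff_exists_Ioo_subset).1 h2
  have hε0 : (0 : ℝ) < ε := hε
  have hTt : 0 < T - t := by linarith [htT.2]
  refine ⟨min ε (T - t) / 2, by positivity, ?_, fun h hh hh' => ?_⟩
  · linarith [min_le_right ε (T - t)]
  · have hm1 := min_le_left ε (T - t)
    have hm2 := min_le_right ε (T - t)
    have h3 := hε' (show h ∈ Ioo 0 ε from ⟨hh, by linarith⟩)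
    have hsub : Ioc t (t + h) ⊆ Ioo 0 T := fun s hs => ⟨htT.1.trans hs.1, by linarith [hs.2]⟩
    have h4 : ∫ s in t..(t + h), (φ s).toReal < ((φ t).toReal + η) * h := by
      rw [mem_ofPred_eq, smul_eq_mul, ← div_eq_inv_mul, div_lt_iff₀ hh,
        intervalIntegral.integral_interval_sub_left] at h3
      · exact h3
      · exact hint'.mono_set (by
          rw [uIcc_of_le (by linarith [htT.1]), uIcc_of_le hT]
          exact Icc_subset_Icc le_rfl (by linarith))
      · exact hint'.mono_set (by
          rw [uIcc_of_le (by linarith [htT.1]), uIcc_of_le hT]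
          exact Icc_subset_Icc le_rfl (by linarith))
    rw [intervalIntegral.integral_of_le (by linarith),
      integral_toReal (hφ.mono_measure (Measure.restrict_mono hsub le_rfl))
        (ae_mono (Measure.restrict_mono hsub le_rfl) hfin)] at h4
    rw [← ENNReal.ofReal_toReal (a := ∫⁻ s in Ioc t (t + h), φ s)]
    · exact ENNReal.ofReal_le_ofReal h4.le
    · exact ((lintegral_mono_set hsub).trans_lt hi).ne

/-- Almost every time is a Lebesgue point of a function in `L¹((0,T); L¹)`. -/
theorem ae_tendsto_lintegral_sub {F : Type} [NormedAddCommGroup F] [SecondCountableTopology F]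
    {T : ℝ} {f : ℝ → Space d → F}
    (hf : AEStronglyMeasurable (fun z : ℝ × Space d => f z.1 z.2) (spaceTime d T))
    (hi : ∫⁻ t in Ioo 0 T, ∫⁻ x, ‖f t x‖ₑ < ⊤) :
    ∀ᵐ t ∂(volume.restrict (Ioo 0 T)), Integrable (f t) ∧ ∀ η > (0 : ℝ), ∃ h₀ > (0 : ℝ), t + h₀ < T ∧
      ∀ h, 0 < h → h ≤ h₀ →
        ∫⁻ s in Ioc t (t + h), ∫⁻ x, ‖f s x - f t x‖ₑ ≤ ENNReal.ofReal (η * h) := by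
  have : Fact ((1 : ℝ≥0∞) ≠ ⊤) := ⟨ENNReal.one_ne_top⟩
  have hms : ∀ᵐ t ∂(volume.restrict (Ioo 0 T)), AEStronglyMeasurable (f t) volume :=
    AEStronglyMeasurable.prodMk_left (f := fun z : ℝ × Space d => f z.1 z.2) hf
  have hmn : AEMeasurable (fun t => ∫⁻ x, ‖f t x‖ₑ) (volume.restrict (Ioo 0 T)) :=
    AEMeasurable.lintegral_prod_right' (f := fun z : ℝ × Space d => ‖f z.1 z.2‖ₑ) hf.enorm
  have hfin := ae_lt_top' hmn hi.ne
  -- Scalar differentiation is applied to the distances from a countable dense set in L¹, which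
  -- leaves a single null set of times.
  set D : ℕ → Lp F 1 (volume : Measure (Space d)) := TopologicalSpace.denseSeq _ with hD
  have hDi : ∀ n, Integrable (D n) := fun n => L1.integrable_coeFn _
  have hfD : ∀ n, AEStronglyMeasurable (fun z : ℝ × Space d => f z.1 z.2 - D n z.2) (spaceTime d T) := by
    intro n
    refine hf.sub ?_
    exact ((Lp.aestronglyMeasurable (D n)).comp_snd (μ := volume.restrict (Ioo 0 T)))
  have hφ : ∀ n, AEMeasurable (fun t => ∫⁻ x, ‖f t x - D n x‖ₑ) (volume.restrict (Ioo 0 T)) := 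
    fun n => AEMeasurable.lintegral_prod_right' (f := fun z : ℝ × Space d => ‖f z.1 z.2 - D n z.2‖ₑ)
      (hfD n).enorm
  have hφi : ∀ n, ∫⁻ t in Ioo 0 T, ∫⁻ x, ‖f t x - D n x‖ₑ < ⊤ := by
    intro n
    calc ∫⁻ t in Ioo 0 T, ∫⁻ x, ‖f t x - D n x‖ₑ
        ≤ ∫⁻ t in Ioo 0 T, ((∫⁻ x, ‖f t x‖ₑ) + ∫⁻ x, ‖D n x‖ₑ) := by
          refine lintegral_mono fun t => ?_
          rw [← lintegral_add_right' _ (hDi n).1.enorm]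
          exact lintegral_mono fun x => enorm_sub_le
      _ = (∫⁻ t in Ioo 0 T, ∫⁻ x, ‖f t x‖ₑ) + ∫⁻ t in Ioo 0 T, ∫⁻ x, ‖D n x‖ₑ :=
          lintegral_add_right _ measurable_const
      _ < ⊤ := by
          refine ENNReal.add_lt_top.2 ⟨hi, ?_⟩
          rw [lintegral_const]
          exact ENNReal.mul_lt_top (hDi n).2 (by simp)
  filter_upwards [hms, hfin, ae_all_iff.2 fun n => ae_forall_setLIntegral_le (hφ n) (hφi n)]
    with t htm htf htn
  have hti : Integrable (f t) := ⟨htm, htf⟩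
  refine ⟨hti, fun η hη => ?_⟩
  -- The approximation error η/4 enters twice and the differentiation error η/4 once, in total 3η/4.
  obtain ⟨n, hn⟩ := (TopologicalSpace.denseRange_denseSeq _).exists_dist_lt (hti.toL1 (f t))
    (show 0 < η / 4 by positivity)
  have hn' : ∫⁻ x, ‖f t x - D n x‖ₑ ≤ ENNReal.ofReal (η / 4) := by
    rw [← edist_lt_ofReal] at hn
    refine le_trans (le_of_eq ?_) hn.le
    rw [L1.edist_def]
    refine lintegral_congr_ae ?_
    filter_upwards [hti.coeFn_toL1] with x hx
    rw [hx, edist_eq_enorm_sub]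
  obtain ⟨h₀, h0, hT, hh⟩ := (htn n).2 (η / 4) (by positivity)
  refine ⟨h₀, h0, hT, fun h hp hle => ?_⟩
  calc ∫⁻ s in Ioc t (t + h), ∫⁻ x, ‖f s x - f t x‖ₑ
      ≤ ∫⁻ s in Ioc t (t + h), ((∫⁻ x, ‖f s x - D n x‖ₑ) + ∫⁻ x, ‖f t x - D n x‖ₑ) := by
        refine lintegral_mono fun s => ?_
        refine (lintegral_mono fun x => ?_).trans_eq
          (lintegral_add_right' (fun x => ‖f s x - D n x‖ₑ) (htm.sub (hDi n).1).enorm)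
        rw [← sub_sub_sub_cancel_right (f s x) (f t x) (D n x)]
        exact enorm_sub_le
    _ = (∫⁻ s in Ioc t (t + h), ∫⁻ x, ‖f s x - D n x‖ₑ)
        + ∫⁻ s in Ioc t (t + h), ∫⁻ x, ‖f t x - D n x‖ₑ := lintegral_add_right _ measurable_const
    _ ≤ ENNReal.ofReal ((η / 4 + η / 4) * h) + ENNReal.ofReal (η / 4) * ENNReal.ofReal h := by
        gcongr
        · refine (hh h hp hle).trans (ENNReal.ofReal_le_ofReal ?_)
          gcongr
          exact ENNReal.toReal_le_of_le_ofReal (by positivity) hn'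
        · rw [lintegral_const]
          gcongr
          simp
    _ ≤ ENNReal.ofReal (η * h) := by
        rw [← ENNReal.ofReal_mul (by positivity), ← ENNReal.ofReal_add (by positivity) (by positivity)]
        apply ENNReal.ofReal_le_ofReal
        nlinarith [mul_pos hη hp]

end AdvDiff

/-! ### The weak formulation in flux form. -/

namespace AdvDiff

open Filter Topology
open scoped RealInnerProductSpace
variable {d : ℕ}

theorem exists_forall_norm_fderiv_le {ζ : Space d → ℝ} (hζ : ContDiff ℝ (⊤ : ℕ∞) ζ)
    (hζs : HasCompactSupport ζ) : ∃ C : ℝ, ∀ x, ‖fderiv ℝ ζ x‖ ≤ C :=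
  (hζ.continuous_fderiv (by simp)).bounded_above_of_compact_support (hζs.fderiv ℝ)

theorem fderiv_apply_eq_sum_gradOf (L D : Space d →L[ℝ] ℝ) :
    ∑ i, L (EuclideanSpace.basisFun (Fin d) ℝ i) * D (EuclideanSpace.basisFun (Fin d) ℝ i) =
      L (gradOf D) := by
  conv_rhs => rw [← (EuclideanSpace.basisFun (Fin d) ℝ).sum_repr' (gradOf D)]
  rw [map_sum]
  refine Finset.sum_congr rfl fun i _ => ?_
  rw [map_smul, real_inner_comm, inner_gradOf, smul_eq_mul, mul_comm]

theorem laplacian_eq_sum_fderiv {ζ : Space d → ℝ} (hζ : ContDiff ℝ (⊤ : ℕ∞) ζ) (x : Space d) :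
    Laplacian.laplacian ζ x = ∑ i, fderiv ℝ (fun y => fderiv ℝ ζ y
      (EuclideanSpace.basisFun (Fin d) ℝ i)) x (EuclideanSpace.basisFun (Fin d) ℝ i) := by
  rw [InnerProductSpace.laplacian_eq_iteratedFDeriv_orthonormalBasis ζ
    (EuclideanSpace.basisFun (Fin d) ℝ)]
  refine Finset.sum_congr rfl fun i _ => ?_
  have hd : DifferentiableAt ℝ (fderiv ℝ ζ) x :=
    ((hζ.fderiv_right (m := (⊤ : ℕ∞)) (by simp)).differentiable (by simp)) x
  rw [iteratedFDeriv_two_apply, fderiv_clm_apply hd (differentiableAt_const _)]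
  simp

theorem contDiff_fderiv_apply_const {ζ : Space d → ℝ} (hζ : ContDiff ℝ (⊤ : ℕ∞) ζ) (v : Space d) :
    ContDiff ℝ (⊤ : ℕ∞) fun y => fderiv ℝ ζ y v :=
  (hζ.fderiv_right (m := (⊤ : ℕ∞)) (by simp)).clm_apply contDiff_const

theorem hasCompactSupport_fderiv_apply_const {ζ : Space d → ℝ} (hζs : HasCompactSupport ζ)
    (v : Space d) : HasCompactSupport fun y => fderiv ℝ ζ y v :=
  (hζs.fderiv ℝ).comp_left (g := fun L : Space d →L[ℝ] ℝ => L v) rfl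

theorem continuous_laplacian {ζ : Space d → ℝ} (hζ : ContDiff ℝ (⊤ : ℕ∞) ζ) :
    Continuous (Laplacian.laplacian ζ) := by
  rw [funext (laplacian_eq_sum_fderiv hζ)]
  refine continuous_finsetSum _ fun i _ => ?_
  exact (contDiff_fderiv_apply_const (contDiff_fderiv_apply_const hζ _) _).continuous

theorem hasCompactSupport_laplacian {ζ : Space d → ℝ}
    (hζs : HasCompactSupport ζ) : HasCompactSupport (Laplacian.laplacian ζ) := by
  refine HasCompactSupport.intro hζs fun x hx => ?_
  have : ζ =ᶠ[𝓝 x] fun _ => 0 := notMem_tsupport_iff_eventuallyEq.1 hx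
  rw [(InnerProductSpace.laplacian_congr_nhds this).eq_of_nhds]
  simp

/-- The weak derivative is used once in each coordinate, leaving a single derivative on ζ. This puts
the diffusion into the flux. -/
theorem integral_mul_laplacian {θ : Space d → ℝ} {Dθ : Space d → Space d →L[ℝ] ℝ}
    (hw : HasWeakFDeriv θ Dθ) {ζ : Space d → ℝ} (hζ : ContDiff ℝ (⊤ : ℕ∞) ζ)
    (hζs : HasCompactSupport ζ) :
    ∫ x, θ x * Laplacian.laplacian ζ x = - ∫ x, fderiv ℝ ζ x (gradOf (Dθ x)) := by
  set e := EuclideanSpace.basisFun (Fin d) ℝ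
  have h := fun i => hw.integral_eq _ (contDiff_fderiv_apply_const hζ (e i))
    (hasCompactSupport_fderiv_apply_const hζs (e i)) (e i)
  have i1 : ∀ i, Integrable fun x => fderiv ℝ (fun y => fderiv ℝ ζ y (e i)) x (e i) • θ x := fun i =>
    hw.locallyIntegrable.integrable_smul_left_of_hasCompactSupport
      (contDiff_fderiv_apply_const (contDiff_fderiv_apply_const hζ _) _).continuous
      (hasCompactSupport_fderiv_apply_const (hasCompactSupport_fderiv_apply_const hζs _) _)
  have i2 : ∀ i, Integrable fun x => fderiv ℝ ζ x (e i) • Dθ x (e i) := fun i => by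
    have := hw.locallyIntegrable_deriv.integrable_smul_left_of_hasCompactSupport
      (contDiff_fderiv_apply_const hζ (e i)).continuous
      (hasCompactSupport_fderiv_apply_const hζs (e i))
    exact this.apply_continuousLinearMap (e i)
  calc ∫ x, θ x * Laplacian.laplacian ζ x
      = ∫ x, ∑ i, fderiv ℝ (fun y => fderiv ℝ ζ y (e i)) x (e i) • θ x := by
        refine integral_congr_ae (.of_forall fun x => ?_)
        simp only [laplacian_eq_sum_fderiv hζ, smul_eq_mul]
        rw [← Finset.sum_mul, mul_comm]
    _ = - ∫ x, ∑ i, fderiv ℝ ζ x (e i) • Dθ x (e i) := by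
        rw [integral_finsetSum _ fun i _ => i1 i, integral_finsetSum _ fun i _ => i2 i,
          ← Finset.sum_neg_distrib]
        exact Finset.sum_congr rfl fun i _ => h i
    _ = _ := by
        congr 1
        refine integral_congr_ae (.of_forall fun x => ?_)
        simp only [smul_eq_mul]
        exact fderiv_apply_eq_sum_gradOf _ _

/-- The weak formulation tested with a product `χ(t) ζ(x)`. -/
theorem IsDistribSolution.integral_deriv_mul_add {T κ : ℝ} {q : ℝ≥0∞} {u : ℝ → Space d → Space d}
    {θ₀ : Space d → ℝ} {θ : ℝ → Space d → ℝ} {Dθ : ℝ → Space d → Space d →L[ℝ] ℝ}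
    (hs : IsDistribSolution T q κ u θ₀ θ)
    (hθ : Integrable (fun z : ℝ × Space d => θ z.1 z.2) (spaceTime d T))
    (hDθ : Integrable (fun z : ℝ × Space d => Dθ z.1 z.2) (spaceTime d T))
    (hw : ∀ᵐ t ∂(volume.restrict (Ioo 0 T)), HasWeakFDeriv (θ t) (Dθ t))
    (hW : Integrable (fun z : ℝ × Space d => θ z.1 z.2 • u z.1 z.2) (spaceTime d T))
    {χ : ℝ → ℝ} (hχ : ContDiff ℝ (⊤ : ℕ∞) χ) (hχs : HasCompactSupport χ) (hχT : tsupport χ ⊆ Iio T)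
    {ζ : Space d → ℝ} (hζ : ContDiff ℝ (⊤ : ℕ∞) ζ) (hζs : HasCompactSupport ζ) :
    (∫ s in Ioo 0 T, (deriv χ s * (∫ x, θ s x * ζ x) +
      χ s * ∫ x, fderiv ℝ ζ x (θ s x • u s x - κ • gradOf (Dθ s x)))) +
      χ 0 * ∫ x, θ₀ x * ζ x = 0 := by
  have hφ := hs.weak_eq (fun z => χ z.1 * ζ z.2)
    ((hχ.comp contDiff_fst).mul (hζ.comp contDiff_snd)) ?_ ?_
  · obtain ⟨Cχ, hCχ⟩ := hχ.continuous.bounded_above_of_compact_support hχs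
    obtain ⟨Cχ', hCχ'⟩ := (hχ.continuous_deriv (by simp)).bounded_above_of_compact_support hχs.deriv
    obtain ⟨Cζ, hCζ⟩ := hζ.continuous.bounded_above_of_compact_support hζs
    obtain ⟨Cζ', hCζ'⟩ := exists_forall_norm_fderiv_le hζ hζs
    obtain ⟨CL, hCL⟩ := (continuous_laplacian hζ).bounded_above_of_compact_support
      (hasCompactSupport_laplacian hζs)
    have hcχ := hχ.continuous
    have hcχ' := hχ.continuous_deriv (by simp)
    have hcζ := hζ.continuous
    have hcζ' := hζ.continuous_fderiv (by simp)
    have hcL := continuous_laplacian hζ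
    have iA : Integrable (fun z : ℝ × Space d => θ z.1 z.2 * ζ z.2) (spaceTime d T) :=
      hθ.mul_bdd (c := Cζ) (by fun_prop) (.of_forall fun z => hCζ _)
    have iB : Integrable (fun z : ℝ × Space d => fderiv ℝ ζ z.2 (θ z.1 z.2 • u z.1 z.2))
        (spaceTime d T) := by
      refine (hW.norm.const_mul Cζ').mono' ?_ (.of_forall fun z => ?_)
      · exact aestronglyMeasurable_clm_apply (by fun_prop) hW.aestronglyMeasurable
      · exact (ContinuousLinearMap.le_opNorm _ _).trans (by gcongr; exact hCζ' _)
    have iL : Integrable (fun z : ℝ × Space d => θ z.1 z.2 * Laplacian.laplacian ζ z.2)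
        (spaceTime d T) :=
      hθ.mul_bdd (c := CL) (by fun_prop) (.of_forall fun z => hCL _)
    have iG : Integrable (fun z : ℝ × Space d => fderiv ℝ ζ z.2 (gradOf (Dθ z.1 z.2)))
        (spaceTime d T) := by
      have hm := continuous_gradOf.comp_aestronglyMeasurable hDθ.aestronglyMeasurable
      refine (hDθ.norm.const_mul Cζ').mono' ?_ (.of_forall fun z => ?_)
      · exact aestronglyMeasurable_clm_apply (by fun_prop) hm
      · refine (ContinuousLinearMap.le_opNorm _ _).trans ?_
        rw [norm_gradOf]
        gcongr
        exact hCζ' _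
    have iA' : Integrable (fun z : ℝ × Space d => deriv χ z.1 * (θ z.1 z.2 * ζ z.2))
        (spaceTime d T) := iA.bdd_mul (c := Cχ') (by fun_prop) (.of_forall fun z => hCχ' _)
    have iB' : Integrable (fun z : ℝ × Space d => χ z.1 * (fderiv ℝ ζ z.2 (θ z.1 z.2 • u z.1 z.2) +
        κ * (θ z.1 z.2 * Laplacian.laplacian ζ z.2)))
        (spaceTime d T) :=
      (iB.add (iL.const_mul κ)).bdd_mul (c := Cχ) (by fun_prop) (.of_forall fun z => hCχ _)
    have e1 : ∀ z : ℝ × Space d, θ z.1 z.2 * (deriv (fun s => χ s * ζ z.2) z.1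
          + fderiv ℝ (fun y => χ z.1 * ζ y) z.2 (u z.1 z.2)
          + κ * Laplacian.laplacian (fun y => χ z.1 * ζ y) z.2) =
        deriv χ z.1 * (θ z.1 z.2 * ζ z.2) + χ z.1 * (fderiv ℝ ζ z.2 (θ z.1 z.2 • u z.1 z.2) +
        κ * (θ z.1 z.2 * Laplacian.laplacian ζ z.2)) := by
      intro z
      rw [deriv_mul_const ((hχ.differentiable (by simp)) _),
        fderiv_const_mul ((hζ.differentiable (by simp)) _)]
      have hl : Laplacian.laplacian (fun y => χ z.1 * ζ y) z.2 =
          χ z.1 * Laplacian.laplacian ζ z.2 :=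
        InnerProductSpace.laplacian_smul (f := ζ) (χ z.1) (contDiff_infty.1 hζ 2).contDiffAt
      rw [hl]
      simp only [_root_.smul_apply, smul_eq_mul, map_smul]
      ring
    simp only [e1] at hφ
    rw [integral_add iA' iB', spaceTime, integral_prod _ iA', integral_prod _ iB',
      ← integral_add iA'.integral_prod_left iB'.integral_prod_left] at hφ
    have e2 : ∫ x, θ₀ x * (χ 0 * ζ x) = χ 0 * ∫ x, θ₀ x * ζ x := by
      rw [← integral_const_mul]
      congr 1
      ext x
      ring
    rw [e2] at hφ
    refine Eq.trans ?_ hφ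
    congr 1
    refine integral_congr_ae ?_
    filter_upwards [hw, iB.prod_right_ae, iL.prod_right_ae, iG.prod_right_ae] with s hws hB hL hG
    simp only [integral_const_mul]
    congr 2
    rw [integral_add hB (hL.const_mul κ), integral_const_mul, integral_mul_laplacian hws hζ hζs]
    simp only [map_sub, map_smul (_ : Space d →L[ℝ] ℝ) κ]
    rw [integral_sub hB (by exact hG.smul κ), integral_smul, smul_eq_mul]
    ring
  · refine HasCompactSupport.intro (hχs.isCompact.prod hζs.isCompact) fun z hz => ?_
    rw [mem_prod, not_and_or] at hz
    rcases hz with h | h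
    · simp [image_eq_zero_of_notMem_tsupport h]
    · simp [image_eq_zero_of_notMem_tsupport h]
  · refine fun z hz => ⟨hχT ?_, mem_univ _⟩
    have h1 : tsupport (fun z : ℝ × Space d => χ z.1 * ζ z.2) ⊆ Prod.fst ⁻¹' tsupport χ := by
      refine closure_minimal (fun z hz => subset_tsupport _ ?_)
        ((isClosed_tsupport χ).preimage continuous_fst)
      exact left_ne_zero_of_mul hz
    exact h1 hz

end AdvDiff

/-! ### The weak formulation at almost every time. -/

namespace AdvDiff

open Filter Topology
variable {d : ℕ}

/-- Integration by parts without boundary terms: one primitive vanishes at T and the other at 0. -/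
theorem integral_mul_primitive {T : ℝ} (hT : 0 < T) {ψ : ℝ → ℝ} (hψ : Continuous ψ) {b : ℝ → ℝ}
    (hb : IntegrableOn b (Ioo 0 T)) :
    ∫ s in Ioo 0 T, (∫ r in T..s, ψ r) * b s = - ∫ s in Ioo 0 T, ψ s * ∫ r in 0..s, b r := by
  have hbi : IntervalIntegrable b volume 0 T := by
    rwa [intervalIntegrable_iff_integrableOn_Ioo_of_le hT.le]
  have h1 : AbsolutelyContinuousOnInterval (fun s => ∫ r in T..s, ψ r) 0 T :=
    (hψ.intervalIntegrable 0 T).absolutelyContinuousOnInterval_intervalIntegral (by simp)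
  have h2 : AbsolutelyContinuousOnInterval (fun s => ∫ r in 0..s, b r) 0 T :=
    hbi.absolutelyContinuousOnInterval_intervalIntegral (by simp)
  have h3 := h1.integral_mul_deriv_eq_deriv_mul h2
  simp only [intervalIntegral.integral_same, zero_mul, mul_zero, sub_zero, zero_sub,
    Continuous.deriv_integral ψ hψ] at h3
  rw [← integral_Ioc_eq_integral_Ioo, ← integral_Ioc_eq_integral_Ioo,
    ← intervalIntegral.integral_of_le hT.le, ← intervalIntegral.integral_of_le hT.le, ← h3]
  refine intervalIntegral.integral_congr_ae ?_
  filter_upwards [hbi.ae_hasDerivAt_integral] with s hs hsT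
  rw [(hs (uIoc_subset_uIcc hsT) 0 (by simp)).deriv]

/-- A weak form of `a' = b`, `a(0) = a₀` on `(0,T)` determines `a`. -/
theorem ae_eq_add_integral_of_weak {T : ℝ} (hT : 0 < T) {a b : ℝ → ℝ} {a₀ : ℝ}
    (ha : IntegrableOn a (Ioo 0 T)) (hb : IntegrableOn b (Ioo 0 T))
    (h : ∀ χ : ℝ → ℝ, ContDiff ℝ (⊤ : ℕ∞) χ → HasCompactSupport χ → tsupport χ ⊆ Iio T →
      (∫ s in Ioo 0 T, (deriv χ s * a s + χ s * b s)) + χ 0 * a₀ = 0) :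
    ∀ᵐ t ∂(volume.restrict (Ioo 0 T)), a t = a₀ + ∫ s in 0..t, b s := by
  have hbi : IntervalIntegrable b volume 0 T := by
    rwa [intervalIntegrable_iff_integrableOn_Ioo_of_le hT.le]
  have hBc : ContinuousOn (fun t => ∫ s in 0..t, b s) (Icc 0 T) := by
    have := (hbi.absolutelyContinuousOnInterval_intervalIntegral (c := 0) (by simp)).continuousOn
    rwa [uIcc_of_le hT.le] at this
  have hB : IntegrableOn (fun t => ∫ s in 0..t, b s) (Ioo 0 T) :=
    (hBc.integrableOn_Icc).mono_set Ioo_subset_Icc_self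
  have hc : IntegrableOn (fun _ : ℝ => a₀) (Ioo 0 T) := by simp
  have hI : IntegrableOn (fun t => a t - (a₀ + ∫ s in 0..t, b s)) (Ioo 0 T) :=
    ha.sub (hc.add hB)
  suffices hs : ∀ᵐ t, t ∈ Ioo 0 T → a t - (a₀ + ∫ s in 0..t, b s) = 0 by
    rw [ae_restrict_iff' measurableSet_Ioo]
    filter_upwards [hs] with t ht htT
    linarith [ht htT]
  refine isOpen_Ioo.ae_eq_zero_of_integral_contDiff_smul_eq_zero hI.locallyIntegrableOn ?_
  intro ψ hψ hψs hψT
  obtain ⟨Cψ, hCψ⟩ := hψ.continuous.bounded_above_of_compact_support hψs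
  have hψc := hψ.continuous
  have hψi : ∀ x y, IntervalIntegrable ψ volume x y := fun x y => hψc.intervalIntegrable x y
  obtain ⟨c, hcT, hc'⟩ : ∃ c < T, ∀ s, c < s → ψ s = 0 := by
    rcases (tsupport ψ).eq_empty_or_nonempty with he | hne
    · exact ⟨T - 1, by linarith, fun s _ => image_eq_zero_of_notMem_tsupport (by simp [he])⟩
    · obtain ⟨c, hc⟩ := IsCompact.exists_isGreatest hψs hne
      exact ⟨c, (hψT hc.1).2, fun s hs => image_eq_zero_of_notMem_tsupport fun h =>
        (hc.2 h).not_gt hs⟩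
  -- Integrating from T makes Ψ vanish after the support of ψ, as a test function on [0,T) must,
  -- while Ψ(0) may be nonzero and picks up the initial value.
  set Ψ : ℝ → ℝ := fun s => ∫ r in T..s, ψ r with hΨ
  have hΨd : ∀ s, HasDerivAt Ψ (ψ s) s := fun s =>
    intervalIntegral.integral_hasDerivAt_right (hψi _ _)
      hψc.aestronglyMeasurable.stronglyMeasurableAtFilter hψc.continuousAt
  have hΨc : ContDiff ℝ (⊤ : ℕ∞) Ψ := by
    rw [contDiff_infty_iff_deriv]
    refine ⟨fun s => (hΨd s).differentiableAt, ?_⟩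
    rwa [funext fun s => (hΨd s).deriv]
  have hΨ0 : ∀ s, c < s → Ψ s = 0 := by
    intro s hs
    refine intervalIntegral.integral_zero_ae (.of_forall fun r hr => hc' r ?_)
    rcases le_total T s with h | h
    · rw [uIoc_of_le h] at hr; linarith [hr.1]
    · rw [uIoc_of_ge h] at hr; linarith [hr.1]
  -- Ψ is constant, possibly nonzero, far to the left; a bump equal to 1 near [0,T] gives compact
  -- support without changing anything on [0,T].
  let η : ContDiffBump (0 : ℝ) := ⟨T + 1, T + 2, by linarith, by linarith⟩
  have hη1 : ∀ s ∈ Icc 0 T, (η : ℝ → ℝ) =ᶠ[𝓝 s] 1 := fun s hs => by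
    refine η.eventuallyEq_one_of_mem_ball ?_
    rw [mem_ball_zero_iff, Real.norm_eq_abs, abs_of_nonneg hs.1]
    change s < T + 1
    linarith [hs.2]
  have hη : ContDiff ℝ (⊤ : ℕ∞) η := η.contDiff
  have hev : ∀ s ∈ Icc 0 T, (fun s => η s * Ψ s) =ᶠ[𝓝 s] Ψ := fun s hs => by
    filter_upwards [hη1 s hs] with r hr
    rw [hr, Pi.one_apply, one_mul]
  have key := h (fun s => η s * Ψ s) (hη.mul hΨc) η.hasCompactSupport.mul_right ?_
  · have e0 : η 0 * Ψ 0 = Ψ 0 := (hev 0 ⟨le_rfl, hT.le⟩).eq_of_nhds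
    have e1 : ∫ s in Ioo 0 T, (deriv (fun s => η s * Ψ s) s * a s + η s * Ψ s * b s) =
        ∫ s in Ioo 0 T, (ψ s * a s + Ψ s * b s) := by
      refine setIntegral_congr_fun measurableSet_Ioo fun s hs => ?_
      have := hev s (Ioo_subset_Icc_self hs)
      simp only [this.deriv_eq, this.eq_of_nhds, (hΨd s).deriv]
    have iA : IntegrableOn (fun s => ψ s * a s) (Ioo 0 T) :=
      ha.bdd_mul (c := Cψ) (by fun_prop) (.of_forall hCψ)
    have iB : IntegrableOn (fun s => ψ s * ∫ r in 0..s, b r) (Ioo 0 T) :=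
      hB.bdd_mul (c := Cψ) (by fun_prop) (.of_forall hCψ)
    have iC : IntegrableOn (fun s => Ψ s * b s) (Ioo 0 T) :=
      hbi.continuousOn_mul (hΨc.continuous.continuousOn) |>.1.mono_set Ioo_subset_Ioc_self
    have iD : IntegrableOn (fun s => ψ s * a₀) (Ioo 0 T) :=
      (hc.bdd_mul (c := Cψ) (by fun_prop) (.of_forall hCψ))
    rw [e0, e1, integral_add iA iC, integral_mul_primitive hT hψc hb] at key
    have e2 : Ψ 0 = - ∫ s in Ioo 0 T, ψ s := by
      rw [hΨ]
      simp only
      rw [intervalIntegral.integral_symm, intervalIntegral.integral_of_le hT.le,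
        integral_Ioc_eq_integral_Ioo]
    have e3 : ∫ s, ψ s • (a s - (a₀ + ∫ r in 0..s, b r)) =
        ∫ s in Ioo 0 T, (ψ s * a s - (ψ s * a₀ + ψ s * ∫ r in 0..s, b r)) := by
      rw [← setIntegral_eq_integral_of_forall_compl_eq_zero (s := Ioo 0 T)]
      · refine integral_congr_ae (.of_forall fun s => ?_)
        simp only [smul_eq_mul]
        ring
      · intro s hs
        rw [image_eq_zero_of_notMem_tsupport fun h => hs (hψT h), zero_smul]
    rw [e3, integral_sub iA (by exact iD.add iB), integral_add iD iB, integral_mul_const]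
    rw [e2] at key
    linarith
  · refine (closure_minimal ?_ isClosed_Iic : _ ⊆ Iic c).trans fun s hs => lt_of_le_of_lt hs hcT
    intro s hs
    by_contra hn
    exact hs (by simp [hΨ0 s (not_le.1 hn)])

theorem enorm_integral_mul_sub_le {f g ζ : Space d → ℝ} (hf : Integrable f) (hg : Integrable g)
    (hζc : Continuous ζ) {C : ℝ} (hC : ∀ x, ‖ζ x‖ ≤ C) :
    ‖(∫ x, f x * ζ x) - ∫ x, g x * ζ x‖ₑ ≤ ENNReal.ofReal C * ∫⁻ x, ‖f x - g x‖ₑ := by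
  have h1 : Integrable fun x => f x * ζ x := hf.mul_bdd (c := C) (by fun_prop) (.of_forall hC)
  have h2 : Integrable fun x => g x * ζ x := hg.mul_bdd (c := C) (by fun_prop) (.of_forall hC)
  rw [← integral_sub h1 h2, ← lintegral_const_mul' _ _ ENNReal.ofReal_ne_top]
  refine (enorm_integral_le_lintegral_enorm _).trans (lintegral_mono fun x => ?_)
  rw [← sub_mul, enorm_mul, mul_comm]
  gcongr
  rw [← ofReal_norm]
  exact ENNReal.ofReal_le_ofReal (hC x)

/-- The weak formulation at almost every time, with the exceptional set independent of the test
function. -/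
theorem IsDistribSolution.ae_integral_mul_eq {T κ : ℝ} (hT : 0 < T) {q : ℝ≥0∞}
    {u : ℝ → Space d → Space d}
    {θ₀ : Space d → ℝ} {θ : ℝ → Space d → ℝ} {Dθ : ℝ → Space d → Space d →L[ℝ] ℝ}
    (hs : IsDistribSolution T q κ u θ₀ θ)
    (hθ : Integrable (fun z : ℝ × Space d => θ z.1 z.2) (spaceTime d T))
    (hDθ : Integrable (fun z : ℝ × Space d => Dθ z.1 z.2) (spaceTime d T))
    (hw : ∀ᵐ t ∂(volume.restrict (Ioo 0 T)), HasWeakFDeriv (θ t) (Dθ t))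
    (hW : Integrable (fun z : ℝ × Space d => θ z.1 z.2 • u z.1 z.2) (spaceTime d T)) :
    ∀ᵐ t ∂(volume.restrict (Ioo 0 T)), ∀ ζ : Space d → ℝ, ContDiff ℝ (⊤ : ℕ∞) ζ →
      HasCompactSupport ζ →
      ∫ x, θ t x * ζ x = (∫ x, θ₀ x * ζ x) +
        ∫ s in 0..t, ∫ x, fderiv ℝ ζ x (θ s x • u s x - κ • gradOf (Dθ s x)) := by
  have hfin : ∫⁻ t in Ioo 0 T, ∫⁻ x, ‖θ t x‖ₑ < ⊤ := by
    have := hθ.2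
    rwa [HasFiniteIntegral, spaceTime, lintegral_prod _ hθ.1.enorm] at this
  have hθi := hθ.prod_right_ae
  -- The exceptional set is that of the Lebesgue points of θ in L¹, fixed before ζ. For each ζ the
  -- identity holds at almost every later time s and is carried back to t.
  filter_upwards [ae_tendsto_lintegral_sub hθ.1 hfin, ae_restrict_mem measurableSet_Ioo]
    with t ht htT ζ hζ hζs
  obtain ⟨C, hC⟩ := hζ.continuous.bounded_above_of_compact_support hζs
  obtain ⟨C', hC'⟩ := exists_forall_norm_fderiv_le hζ hζs
  have hC0 : 0 ≤ C := (norm_nonneg _).trans (hC 0)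
  have iA : IntegrableOn (fun s => ∫ x, θ s x * ζ x) (Ioo 0 T) := by
    have : Integrable (fun z : ℝ × Space d => θ z.1 z.2 * ζ z.2) (spaceTime d T) :=
      hθ.mul_bdd (c := C) (hζ.continuous.comp continuous_snd).aestronglyMeasurable
        (.of_forall fun z => hC _)
    exact this.integral_prod_left
  have iB : IntegrableOn (fun s => ∫ x, fderiv ℝ ζ x (θ s x • u s x - κ • gradOf (Dθ s x)))
      (Ioo 0 T) := by
    have hm := continuous_gradOf.comp_aestronglyMeasurable hDθ.aestronglyMeasurable
    have hG : Integrable (fun z : ℝ × Space d => gradOf (Dθ z.1 z.2)) (spaceTime d T) := by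
      refine (integrable_norm_iff hm).1 ?_
      exact hDθ.norm.congr (.of_forall fun z => (norm_gradOf _).symm)
    have hF := hW.sub (hG.smul κ)
    have : Integrable (fun z : ℝ × Space d =>
        fderiv ℝ ζ z.2 (θ z.1 z.2 • u z.1 z.2 - κ • gradOf (Dθ z.1 z.2))) (spaceTime d T) := by
      refine (hF.norm.const_mul C').mono' ?_ (.of_forall fun z => ?_)
      · exact aestronglyMeasurable_clm_apply
          ((hζ.continuous_fderiv (by simp)).comp continuous_snd).aestronglyMeasurable
          hF.aestronglyMeasurable
      · exact (ContinuousLinearMap.le_opNorm _ _).trans (mul_le_mul_of_nonneg_right (hC' _) (norm_nonneg _))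
    exact this.integral_prod_left
  have hae := ae_eq_add_integral_of_weak hT iA iB fun χ hχ hχs hχT =>
    hs.integral_deriv_mul_add hθ hDθ hw hW hχ hχs hχT hζ hζs
  set a : ℝ → ℝ := fun s => ∫ x, θ s x * ζ x
  set b : ℝ → ℝ := fun s => ∫ x, fderiv ℝ ζ x (θ s x • u s x - κ • gradOf (Dθ s x))
  set a₀ := ∫ x, θ₀ x * ζ x
  change a t = a₀ + ∫ s in 0..t, b s
  have hBc : ContinuousAt (fun t => ∫ s in 0..t, b s) t := by
    have hbi : IntervalIntegrable b volume 0 T := by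
      rwa [intervalIntegrable_iff_integrableOn_Ioo_of_le hT.le]
    have := (hbi.absolutelyContinuousOnInterval_intervalIntegral (c := 0) (by simp)).continuousOn
    rw [uIcc_of_le hT.le] at this
    exact this.continuousAt (Icc_mem_nhds htT.1 htT.2)
  set B : ℝ → ℝ := fun t => ∫ s in 0..t, b s
  refine eq_of_forall_dist_le fun ε hε => ?_
  -- Half of ε pays for replacing θ(s) by θ(t), half for the continuity of the primitive; C + 1
  -- guards against C = 0.
  obtain ⟨h₀, h0, h0T, hh⟩ := ht.2 (ε / 2 / (C + 1)) (by positivity)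
  obtain ⟨h₁, h1, hh1⟩ := Metric.continuousAt_iff.1 hBc (ε / 2) (by positivity)
  set h := min h₀ (h₁ / 2)
  have hh0 : 0 < h := lt_min h0 (by positivity)
  have hsub : Ioc t (t + h) ⊆ Ioo 0 T := fun s hs =>
    ⟨htT.1.trans hs.1, by linarith [hs.2, min_le_left h₀ (h₁ / 2)]⟩
  have hr := Measure.restrict_mono hsub (le_refl (volume : Measure ℝ))
  have hmain : ∫⁻ s in Ioc t (t + h), ‖a t - (a₀ + B t)‖ₑ ≤
      ∫⁻ s in Ioc t (t + h), (ENNReal.ofReal C * (∫⁻ x, ‖θ s x - θ t x‖ₑ) + ENNReal.ofReal (ε / 2)) := by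
    refine lintegral_mono_ae ?_
    filter_upwards [ae_mono hr hae, ae_mono hr hθi, ae_restrict_mem measurableSet_Ioc] with s h2 h3 h4
    have e : a t - (a₀ + B t) = -(a s - a t) + (B s - B t) := by
      change a s = a₀ + B s at h2
      linarith
    rw [e]
    refine (enorm_add_le _ _).trans ?_
    rw [enorm_neg]
    gcongr
    · exact enorm_integral_mul_sub_le h3 ht.1 hζ.continuous hC
    · rw [← ofReal_norm]
      refine ENNReal.ofReal_le_ofReal ?_
      rw [← dist_eq_norm]
      refine (hh1 ?_).le
      rw [Real.dist_eq, abs_of_pos (by linarith [h4.1])]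
      linarith [h4.2, min_le_right h₀ (h₁ / 2)]
  rw [lintegral_const, lintegral_add_right _ measurable_const,
    lintegral_const_mul' _ _ ENNReal.ofReal_ne_top, lintegral_const] at hmain
  simp only [Measure.restrict_apply MeasurableSet.univ, univ_inter, Real.volume_Ioc,
    add_sub_cancel_left] at hmain
  have h5 := hh h hh0 (min_le_left _ _)
  have h6 : ENNReal.ofReal (|a t - (a₀ + B t)| * h) ≤ ENNReal.ofReal (ε * h) := by
    rw [ENNReal.ofReal_mul (abs_nonneg _), ← Real.norm_eq_abs, ofReal_norm]
    refine hmain.trans ((add_le_add (mul_le_mul_right h5 _) le_rfl).trans ?_)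
    rw [← ENNReal.ofReal_mul hC0, ← ENNReal.ofReal_mul (by positivity),
      ← ENNReal.ofReal_add (by positivity) (by positivity)]
    refine ENNReal.ofReal_le_ofReal ?_
    have : C * (ε / 2 / (C + 1)) ≤ ε / 2 := by
      rw [mul_div_assoc', div_le_iff₀ (by positivity)]
      nlinarith
    nlinarith
  rw [ENNReal.ofReal_le_ofReal_iff (by positivity)] at h6
  exact (Real.dist_eq _ _).trans_le (le_of_mul_le_mul_right h6 hh0)

end AdvDiff

/-! ### Growth in time of the dual norm. -/

namespace AdvDiff

open Filter Topology
variable {d : ℕ}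

theorem ofReal_integral_le_lintegral_ofReal {α : Type*} [MeasurableSpace α] {μ : Measure α}
    {f : α → ℝ} : ENNReal.ofReal (∫ x, f x ∂μ) ≤ ∫⁻ x, ENNReal.ofReal (f x) ∂μ := by
  by_cases hf : Integrable f μ
  · rw [integral_eq_lintegral_pos_part_sub_lintegral_neg_part hf]
    refine (ENNReal.ofReal_le_ofReal (sub_le_self _ ENNReal.toReal_nonneg)).trans ?_
    exact ENNReal.ofReal_toReal_le
  · simp [integral_undef hf]

/-- A function with one-sided modulus `∫ m` and upper right derivative at most `g` almost
everywhere grows at most by `∫ g`. -/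
theorem ofReal_le_add_lintegral_of_step {T : ℝ} {E m : ℝ → ℝ} {g : ℝ → ℝ≥0∞}
    (hm : IntegrableOn m (Ioo 0 T))
    (hE : ∀ s t, 0 ≤ s → s ≤ t → t ≤ T → E t ≤ E s + ∫ r in s..t, m r)
    (hstep : ∀ᵐ t ∂(volume.restrict (Ioo 0 T)), g t ≠ ⊤ → ∀ η > (0 : ℝ), ∃ h₀ > (0 : ℝ), ∀ h, 0 < h →
      h ≤ h₀ → E (t + h) ≤ E t + h * ((g t).toReal + η)) :
    ∀ t ∈ Icc 0 T, ENNReal.ofReal (E t) ≤ ENNReal.ofReal (E 0) + ∫⁻ s in Ioo 0 T, g s := by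
  intro τ hτ
  have hmi : IntervalIntegrable m volume 0 T := by
    rwa [intervalIntegrable_iff_integrableOn_Ioo_of_le (hτ.1.trans hτ.2)]
  have hmi' : ∀ s t, 0 ≤ s → s ≤ t → t ≤ T → IntervalIntegrable m volume s t := by
    intro s t h1 h2 h3
    refine hmi.mono_set ?_
    rw [uIcc_of_le h2, uIcc_of_le (hτ.1.trans hτ.2)]
    exact Icc_subset_Icc h1 h3
  set Φ : ℝ → ℝ := fun t => ∫ r in 0..t, m r with hΦ
  -- Ψ is increasing by `hE`, so E is differentiable almost everywhere although no continuity of E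
  -- is known.
  set Ψ : ℝ → ℝ := fun t => Φ t - E t with hΨ
  have hmono : MonotoneOn Ψ (uIcc 0 τ) := by
    rw [uIcc_of_le hτ.1]
    intro s hs t ht hst
    have h1 := hE s t hs.1 hst (ht.2.trans hτ.2)
    have h2 : Φ t - Φ s = ∫ r in s..t, m r :=
      intervalIntegral.integral_interval_sub_left (hmi' 0 t le_rfl ht.1 (ht.2.trans hτ.2))
        (hmi' 0 s le_rfl hs.1 (hs.2.trans hτ.2))
    simp only [hΨ]
    linarith
  have hI := hmono.intervalIntegral_deriv_mem_uIcc
  have hΨτ : Ψ 0 ≤ Ψ τ := hmono (by simp) (by simp) hτ.1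
  rw [uIcc_of_le (by linarith)] at hI
  have hi := hmono.intervalIntegrable_deriv
  have hsub : Ioo 0 τ ⊆ Ioo 0 T := Ioo_subset_Ioo le_rfl hτ.2
  have hr := Measure.restrict_mono hsub (le_refl (volume : Measure ℝ))
  have hle : ∀ᵐ t ∂(volume.restrict (Ioo 0 τ)), ENNReal.ofReal (m t - deriv Ψ t) ≤ g t := by
    filter_upwards [ae_mono hr hstep, ae_restrict_mem measurableSet_Ioo,
      ae_restrict_of_ae hmono.ae_differentiableWithinAt_of_mem,
      ae_restrict_of_ae hmi.ae_hasDerivAt_integral] with t ht htτ htd htm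
    rw [uIcc_of_le hτ.1] at htd
    rw [uIcc_of_le (hτ.1.trans hτ.2)] at htm
    have htd' := ((htd (Ioo_subset_Icc_self htτ)).differentiableAt
      (Icc_mem_nhds htτ.1 htτ.2)).hasDerivAt
    have htm' := htm (Ioo_subset_Icc_self (hsub htτ)) 0 ⟨le_rfl, hτ.1.trans hτ.2⟩
    have hEd : HasDerivAt E (m t - deriv Ψ t) t := by
      refine (htm'.sub htd').congr_of_eventuallyEq (.of_forall fun s => ?_)
      simp [hΨ, hΦ]
    rcases eq_or_ne (g t) ⊤ with hg | hg
    · simp [hg]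
    rw [← ENNReal.ofReal_toReal hg]
    refine ENNReal.ofReal_le_ofReal (le_of_forall_pos_le_add fun η hη => ?_)
    have h1 := (hasDerivAt_iff_tendsto_slope_zero.1 hEd).mono_left (nhdsWithin_mono 0 (s := Ioi 0)
      fun x hx => ne_of_gt hx)
    refine le_of_tendsto h1 ?_
    obtain ⟨h₀, h0, hh⟩ := ht hg η hη
    filter_upwards [Ioo_mem_nhdsGT h0] with h hh'
    rw [smul_eq_mul, ← div_eq_inv_mul, div_le_iff₀ hh'.1]
    linarith [hh h hh'.1 hh'.2.le]
  -- For increasing Ψ the integral of Ψ' is at most the increment of Ψ. A singular part of Ψ can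
  -- only lower E, so the inequality has the right direction.
  have hsum : E τ - E 0 ≤ ∫ t in Ioo 0 τ, (m t - deriv Ψ t) := by
    rw [← integral_Ioc_eq_integral_Ioo, ← intervalIntegral.integral_of_le hτ.1,
      intervalIntegral.integral_sub (hmi' 0 τ le_rfl hτ.1 hτ.2) hi]
    have := hI.2
    have h0 : Φ 0 = 0 := by simp [hΦ]
    simp only [hΨ, h0] at this ⊢
    linarith
  calc ENNReal.ofReal (E τ) ≤ ENNReal.ofReal (E 0 + ∫ t in Ioo 0 τ, (m t - deriv Ψ t)) :=
        ENNReal.ofReal_le_ofReal (by linarith)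
    _ ≤ ENNReal.ofReal (E 0) + ENNReal.ofReal (∫ t in Ioo 0 τ, (m t - deriv Ψ t)) :=
        ENNReal.ofReal_add_le
    _ ≤ ENNReal.ofReal (E 0) + ∫⁻ s in Ioo 0 T, g s := by
        gcongr
        refine ofReal_integral_le_lintegral_ofReal.trans ((lintegral_mono_ae hle).trans ?_)
        exact lintegral_mono_set hsub

/-- Smooth compactly supported functions that are Lipschitz for the logarithmic cost. -/
def testClass (d : ℕ) (δ : ℝ) : Set (Space d → ℝ) :=
  {ζ | ContDiff ℝ (⊤ : ℕ∞) ζ ∧ HasCompactSupport ζ ∧ LogLip δ ζ}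

theorem zero_mem_testClass {δ : ℝ} (hδ : 0 < δ) : (fun _ => 0) ∈ testClass d δ :=
  ⟨contDiff_const, HasCompactSupport.zero, fun x y => by
    rw [sub_zero]; exact log_div_add_one_nonneg hδ (norm_nonneg _)⟩

theorem norm_fderiv_apply_le_of_mem_testClass {δ : ℝ} (hδ : 0 < δ) {ζ : Space d → ℝ}
    (hζ : ζ ∈ testClass d δ) (x v : Space d) : ‖fderiv ℝ ζ x v‖ ≤ δ⁻¹ * ‖v‖ :=
  (ContinuousLinearMap.le_opNorm _ _).trans
    (mul_le_mul_of_nonneg_right (hζ.2.2.norm_fderiv_le hδ x) (norm_nonneg _))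

theorem integrable_fderiv_apply_of_mem_testClass {α : Type*} [MeasurableSpace α] {μ : Measure α}
    {δ : ℝ} (hδ : 0 < δ) {ζ : Space d → ℝ} (hζ : ζ ∈ testClass d δ) {H : α → Space d}
    {X : α → Space d} (hX : Measurable X) (hH : Integrable H μ) :
    Integrable (fun a => fderiv ℝ ζ (X a) (H a)) μ := by
  refine (hH.norm.const_mul δ⁻¹).mono' ?_
    (.of_forall fun a => norm_fderiv_apply_le_of_mem_testClass hδ hζ _ _)
  exact aestronglyMeasurable_clm_apply
    (((hζ.1.continuous_fderiv (by simp)).measurable.comp hX).aestronglyMeasurable)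
    hH.aestronglyMeasurable

/-- Grönwall-type propagation of the dual norm along a conservation law. -/
theorem ofReal_integral_add_le_of_step {T δ D : ℝ} (hδ : 0 < δ)
    {θ₀ : Space d → ℝ} {θ : ℝ → Space d → ℝ} {H : ℝ → Space d → Space d}
    (hH : Integrable (fun z : ℝ × Space d => H z.1 z.2) (spaceTime d T))
    (hD : ∀ ζ ∈ testClass d δ, ∫ x, θ₀ x * ζ x ≤ D)
    (hL : ∀ᵐ t ∂(volume.restrict (Ioo 0 T)), ∀ ζ ∈ testClass d δ,
      ∫ x, θ t x * ζ x = (∫ x, θ₀ x * ζ x) + ∫ s in 0..t, ∫ x, fderiv ℝ ζ x (H s x))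
    {g : ℝ → ℝ≥0∞}
    (hstep : ∀ᵐ t ∂(volume.restrict (Ioo 0 T)), g t ≠ ⊤ → ∀ E ≥ (0 : ℝ),
      (∀ ζ ∈ testClass d δ, ∫ x, θ t x * ζ x ≤ E) → ∀ η > (0 : ℝ), ∃ h₀ > (0 : ℝ), ∀ h, 0 < h →
        h ≤ h₀ → ∀ ζ ∈ testClass d δ, (∫ x, θ t x * ζ x) + h * (∫ x, fderiv ℝ ζ x (H t x)) ≤
          E + h * ((g t).toReal + η)) :
    ∀ t ∈ Icc 0 T, ∀ ζ ∈ testClass d δ,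
      ENNReal.ofReal ((∫ x, θ₀ x * ζ x) + ∫ s in 0..t, ∫ x, fderiv ℝ ζ x (H s x)) ≤
        ENNReal.ofReal D + ∫⁻ s in Ioo 0 T, g s := by
  set L : ℝ → testClass d δ → ℝ := fun t ζ =>
    (∫ x, θ₀ x * (ζ : Space d → ℝ) x) + ∫ s in 0..t, ∫ x, fderiv ℝ ζ x (H s x)
  -- Since |∇ζ| ≤ 1/δ, this is an integrable rate for L(·, ζ) common to all ζ, hence also for the
  -- supremum.
  set m : ℝ → ℝ := fun s => δ⁻¹ * ∫ x, ‖H s x‖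
  have hm : IntegrableOn m (Ioo 0 T) := hH.norm.integral_prod_left.const_mul δ⁻¹
  have hbi : ∀ ζ ∈ testClass d δ, IntegrableOn (fun s => ∫ x, fderiv ℝ ζ x (H s x)) (Ioo 0 T) :=
    fun ζ hζ =>
      (integrable_fderiv_apply_of_mem_testClass hδ hζ measurable_snd hH).integral_prod_left
  have hHi := hH.prod_right_ae
  have hint : ∀ {f : ℝ → ℝ}, IntegrableOn f (Ioo 0 T) → ∀ s t, 0 ≤ s → s ≤ t → t ≤ T →
      IntervalIntegrable f volume s t := by
    intro f hf s t h1 h2 h3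
    rw [intervalIntegrable_iff_integrableOn_Ioo_of_le h2]
    exact hf.mono_set (Ioo_subset_Ioo h1 h3)
  have hLd : ∀ ζ s t, 0 ≤ s → s ≤ t → t ≤ T →
      L t ζ = L s ζ + ∫ r in s..t, ∫ x, fderiv ℝ ζ x (H r x) := by
    intro ζ s t h1 h2 h3
    have := intervalIntegral.integral_interval_sub_left
      (hint (hbi ζ ζ.2) 0 t le_rfl (h1.trans h2) h3) (hint (hbi ζ ζ.2) 0 s le_rfl h1 (h2.trans h3))
    simp only [L]
    linarith
  have hLm : ∀ ζ s t, 0 ≤ s → s ≤ t → t ≤ T → L t ζ ≤ L s ζ + ∫ r in s..t, m r := by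
    intro ζ s t h1 h2 h3
    rw [hLd ζ s t h1 h2 h3]
    gcongr
    rw [intervalIntegral.integral_of_le h2, intervalIntegral.integral_of_le h2,
      integral_Ioc_eq_integral_Ioo, integral_Ioc_eq_integral_Ioo]
    have hsub : Ioo s t ⊆ Ioo 0 T := Ioo_subset_Ioo h1 h3
    refine integral_mono_ae ((hbi ζ ζ.2).mono_set hsub) (hm.mono_set hsub) ?_
    filter_upwards [ae_mono (Measure.restrict_mono hsub (le_refl (volume : Measure ℝ))) hHi]
      with r hr
    simp only [m]
    rw [← integral_const_mul]
    refine (le_abs_self _).trans ?_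
    exact norm_integral_le_of_norm_le (G := ℝ) (hr.norm.const_mul δ⁻¹)
      (.of_forall fun x => norm_fderiv_apply_le_of_mem_testClass hδ ζ.2 _ _)
  have hbdd : ∀ t ∈ Icc 0 T, BddAbove (range (L t)) := by
    intro t ht
    refine ⟨D + ∫ r in 0..t, m r, ?_⟩
    rintro _ ⟨ζ, rfl⟩
    refine (hLm ζ 0 t le_rfl ht.1 ht.2).trans ?_
    gcongr
    simpa [L] using hD ζ ζ.2
  have hne : Nonempty (testClass d δ) := ⟨⟨_, zero_mem_testClass hδ⟩⟩
  have hfin : ∫⁻ t in Ioo 0 T, ∫⁻ x, ‖H t x‖ₑ < ⊤ := by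
    have := hH.2
    rwa [HasFiniteIntegral, spaceTime, lintegral_prod _ hH.1.enorm] at this
  have key := ofReal_le_add_lintegral_of_step (E := fun t => ⨆ ζ, L t ζ) (g := g) hm ?_ ?_
  · intro t ht ζ hζ
    calc ENNReal.ofReal (L t ⟨ζ, hζ⟩) ≤ ENNReal.ofReal (⨆ ζ, L t ζ) :=
          ENNReal.ofReal_le_ofReal (le_ciSup (hbdd t ht) ⟨ζ, hζ⟩)
      _ ≤ ENNReal.ofReal (⨆ ζ, L 0 ζ) + ∫⁻ s in Ioo 0 T, g s := key t ht
      _ ≤ ENNReal.ofReal D + ∫⁻ s in Ioo 0 T, g s := by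
          gcongr
          exact ciSup_le fun ζ => by simpa [L] using hD ζ ζ.2
  · intro s t h1 h2 h3
    refine ciSup_le fun ζ => (hLm ζ s t h1 h2 h3).trans ?_
    gcongr
    exact le_ciSup (hbdd s ⟨h1, h2.trans h3⟩) ζ
  · filter_upwards [hL, hstep, ae_tendsto_lintegral_sub hH.1 hfin, ae_restrict_mem measurableSet_Ioo]
      with t htL hts htl htT hg η hη
    have htL' : ∀ ζ : testClass d δ, ∫ x, θ t x * (ζ : Space d → ℝ) x = L t ζ := fun ζ =>
      htL ζ ζ.2
    have hb := hbdd t (Ioo_subset_Icc_self htT)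
    have hE0 : 0 ≤ ⨆ ζ, L t ζ := by
      refine le_trans (le_of_eq ?_) (le_ciSup hb ⟨_, zero_mem_testClass hδ⟩)
      rw [← htL']
      simp
    -- Half of η is spent on the step with frozen flux, half on replacing the flux over [t, t + h]
    -- by its value at t; the factor δ below compensates the gradient bound 1/δ.
    obtain ⟨h₀, h0, hh⟩ := hts hg _ hE0
      (fun ζ hζ => (htL' ⟨ζ, hζ⟩).trans_le (le_ciSup hb ⟨ζ, hζ⟩)) (η / 2) (by positivity)
    obtain ⟨h₁, h1, h1T, hh1⟩ := htl.2 (δ * (η / 2)) (by positivity)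
    refine ⟨min h₀ h₁, lt_min h0 h1, fun h hp hle => ciSup_le fun ζ => ?_⟩
    have hth : t + h ≤ T := by linarith [min_le_right h₀ h₁]
    have a1 := hh h hp (hle.trans (min_le_left _ _)) ζ ζ.2
    have a2 := hh1 h hp (hle.trans (min_le_right _ _))
    rw [htL'] at a1
    rw [hLd ζ t (t + h) htT.1.le (by linarith) hth]
    have hsub : Ioc t (t + h) ⊆ Ioo 0 T := fun s hs =>
      ⟨htT.1.trans hs.1, by linarith [hs.2, min_le_right h₀ h₁]⟩
    have hr := Measure.restrict_mono hsub (le_refl (volume : Measure ℝ))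
    have a3 : (∫ r in t..(t + h), ∫ x, fderiv ℝ ζ x (H r x)) - h * (∫ x, fderiv ℝ ζ x (H t x)) ≤
        h * (η / 2) := by
      have e : h * (∫ x, fderiv ℝ ζ x (H t x)) = ∫ r in t..(t + h), ∫ x, fderiv ℝ ζ x (H t x) := by
        simp
      rw [e, ← intervalIntegral.integral_sub (hint (hbi ζ ζ.2) _ _ htT.1.le (by linarith) hth)
        (by simp), intervalIntegral.integral_of_le (by linarith)]
      rw [← ENNReal.ofReal_le_ofReal_iff (by positivity)]
      refine ofReal_integral_le_lintegral_ofReal.trans ?_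
      calc ∫⁻ r in Ioc t (t + h), ENNReal.ofReal ((∫ x, fderiv ℝ ζ x (H r x)) -
            ∫ x, fderiv ℝ ζ x (H t x))
          ≤ ∫⁻ r in Ioc t (t + h), ENNReal.ofReal δ⁻¹ * ∫⁻ x, ‖H r x - H t x‖ₑ := by
            refine lintegral_mono_ae ?_
            filter_upwards [ae_mono hr hHi] with r hri
            rw [← integral_sub
              (by exact integrable_fderiv_apply_of_mem_testClass hδ ζ.2 measurable_id hri)
              (by exact integrable_fderiv_apply_of_mem_testClass hδ ζ.2 measurable_id htl.1),
              ← lintegral_const_mul' _ _ ENNReal.ofReal_ne_top]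
            refine ofReal_integral_le_lintegral_ofReal.trans (lintegral_mono fun x => ?_)
            rw [← map_sub, ← ofReal_norm, ← ENNReal.ofReal_mul (by positivity)]
            exact ENNReal.ofReal_le_ofReal ((le_abs_self _).trans
              (norm_fderiv_apply_le_of_mem_testClass hδ ζ.2 _ _))
        _ ≤ ENNReal.ofReal δ⁻¹ * ENNReal.ofReal (δ * (η / 2) * h) := by
            rw [lintegral_const_mul' _ _ ENNReal.ofReal_ne_top]
            gcongr
        _ = ENNReal.ofReal (h * (η / 2)) := by
            rw [← ENNReal.ofReal_mul (by positivity)]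
            congr 1
            field_simp
    linarith

end AdvDiff

/-! ### The dual estimate for the difference of two solutions. -/

namespace AdvDiff

open Filter Topology
variable {d : ℕ}

theorem HasWeakFDeriv.sub {F : Type} [NormedAddCommGroup F] [NormedSpace ℝ F] {f g : Space d → F}
    {Df Dg : Space d → Space d →L[ℝ] F} (hf : HasWeakFDeriv f Df) (hg : HasWeakFDeriv g Dg) :
    HasWeakFDeriv (fun x => f x - g x) (fun x => Df x - Dg x) where
  locallyIntegrable := hf.locallyIntegrable.sub hg.locallyIntegrable
  locallyIntegrable_deriv := hf.locallyIntegrable_deriv.sub hg.locallyIntegrable_deriv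
  integral_eq φ hφ hφs v := by
    have i1 : ∀ {f : Space d → F}, LocallyIntegrable f →
        Integrable fun x => fderiv ℝ φ x v • f x := fun h =>
      h.integrable_smul_left_of_hasCompactSupport (contDiff_fderiv_apply_const hφ v).continuous
        (hasCompactSupport_fderiv_apply_const hφs v)
    have i2 : ∀ {D : Space d → Space d →L[ℝ] F}, LocallyIntegrable D →
        Integrable fun x => φ x • D x v := fun h =>
      (h.integrable_smul_left_of_hasCompactSupport hφ.continuous hφs).apply_continuousLinearMap v
    simp only [smul_sub, _root_.sub_apply]
    rw [integral_sub (i1 hf.locallyIntegrable) (i1 hg.locallyIntegrable),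
      integral_sub (i2 hf.locallyIntegrable_deriv) (i2 hg.locallyIntegrable_deriv),
      hf.integral_eq φ hφ hφs v, hg.integral_eq φ hφ hφs v]
    abel

theorem integrable_spaceTime_of_normL1Lp {F : Type} [NormedAddCommGroup F] {T : ℝ}
    {f : ℝ → Space d → F}
    (hf : AEStronglyMeasurable (fun z : ℝ × Space d => f z.1 z.2) (spaceTime d T))
    (h : normL1Lp T 1 f < ⊤) : Integrable (fun z : ℝ × Space d => f z.1 z.2) (spaceTime d T) := by
  refine ⟨hf, ?_⟩
  rw [HasFiniteIntegral, spaceTime, lintegral_prod _ hf.enorm]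
  simpa only [normL1Lp, eLpNorm_one_eq_lintegral_enorm] using h

theorem ae_eLpNorm_le {F : Type} [NormedAddCommGroup F] {T : ℝ} {q M : ℝ≥0∞} {f : ℝ → Space d → F}
    (h : normLinftyLq T q f ≤ M) :
    ∀ᵐ t ∂(volume.restrict (Ioo 0 T)), eLpNorm (f t) q volume ≤ M := by
  filter_upwards [ENNReal.ae_le_essSup fun t => eLpNorm (f t) q volume] with t ht
  exact ht.trans h

theorem integrable_smul_spaceTime {F : Type} [NormedAddCommGroup F] [NormedSpace ℝ F] {T : ℝ}
    {p q : ℝ≥0∞} {M C : ℝ≥0} {θ : ℝ → Space d → ℝ} {f : ℝ → Space d → F}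
    (hC : ∀ (f : Space d → F) (θ : Space d → ℝ), AEStronglyMeasurable f →
      AEStronglyMeasurable θ → eLpNorm θ 1 volume ≤ M → eLpNorm θ q volume ≤ M →
      ∫⁻ x, ‖f x‖ₑ * ‖θ x‖ₑ ≤ C * eLpNorm f p volume)
    (hf : AEStronglyMeasurable (fun z : ℝ × Space d => f z.1 z.2) (spaceTime d T))
    (hfn : normL1Lp T p f < ⊤)
    (hθ : AEStronglyMeasurable (fun z : ℝ × Space d => θ z.1 z.2) (spaceTime d T))
    (h1 : normLinftyLq T 1 θ ≤ M) (hq : normLinftyLq T q θ ≤ M) :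
    Integrable (fun z : ℝ × Space d => θ z.1 z.2 • f z.1 z.2) (spaceTime d T) := by
  have hm := hθ.smul hf
  refine ⟨hm, ?_⟩
  have hf' := AEStronglyMeasurable.prodMk_left (f := fun z : ℝ × Space d => f z.1 z.2) hf
  have hθ' := AEStronglyMeasurable.prodMk_left (f := fun z : ℝ × Space d => θ z.1 z.2) hθ
  calc ∫⁻ z, ‖θ z.1 z.2 • f z.1 z.2‖ₑ ∂(spaceTime d T)
      = ∫⁻ t in Ioo 0 T, ∫⁻ x, ‖θ t x • f t x‖ₑ := lintegral_prod _ hm.enorm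
    _ ≤ ∫⁻ t in Ioo 0 T, C * eLpNorm (f t) p volume := by
        refine lintegral_mono_ae ?_
        filter_upwards [hf', hθ', ae_eLpNorm_le h1, ae_eLpNorm_le hq] with t a1 a2 a3 a4
        refine le_trans (le_of_eq ?_) (hC (f t) (θ t) a1 a2 a3 a4)
        exact lintegral_congr fun x => by rw [enorm_smul, mul_comm]
    _ = C * normL1Lp T p f := lintegral_const_mul' _ _ ENNReal.coe_ne_top
    _ < ⊤ := ENNReal.mul_lt_top ENNReal.coe_lt_top hfn

/-- The difference of the solutions, tested with functions that are Lipschitz for the logarithmic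
cost, is controlled by the data. -/
theorem exists_forall_dual_le (hd : 1 ≤ d) {p q : ℝ≥0∞} (hp : 1 < p) (hq : 1 ≤ q)
    (hpq : p⁻¹ + q⁻¹ ≤ 1) (M G : ℝ≥0) :
    ∃ C : ℝ≥0, ∀ (T κ₁ κ₂ δ : ℝ), 0 < T → 0 < κ₁ → 0 < δ →
      ∀ (u₁ u₂ : ℝ → Space d → Space d) (Du₁ Du₂ : ℝ → Space d → Space d →L[ℝ] Space d)
        (θ₁₀ θ₂₀ : Space d → ℝ) (θ₁ θ₂ : ℝ → Space d → ℝ)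
        (Dθ₁ Dθ₂ : ℝ → Space d → Space d →L[ℝ] ℝ),
      MemL1W1p T p u₁ Du₁ → MemL1W1p T p u₂ Du₂ →
      Integrable θ₁₀ → Integrable θ₂₀ →
      IsDistribSolution T q κ₁ u₁ θ₁₀ θ₁ → IsDistribSolution T q κ₂ u₂ θ₂₀ θ₂ →
      MemL1W1p T 1 θ₁ Dθ₁ → MemL1W1p T 1 θ₂ Dθ₂ →
      normLinftyLq T 1 θ₁ ≤ M → normLinftyLq T q θ₁ ≤ M →
      normLinftyLq T 1 θ₂ ≤ M → normLinftyLq T q θ₂ ≤ M →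
      normL1Lp T p Du₁ ≤ G →
      ∃ L : ℝ → (Space d → ℝ) → ℝ,
        (∀ ζ ∈ testClass d δ, ContinuousOn (fun t => L t ζ) (Icc 0 T)) ∧
        (∀ᵐ t ∂(volume.restrict (Ioo 0 T)), ∀ ζ ∈ testClass d δ,
          ∫ x, (θ₁ t x - θ₂ t x) * ζ x = L t ζ) ∧
        ∀ t ∈ Icc 0 T, ∀ ζ ∈ testClass d δ, ENNReal.ofReal (L t ζ) ≤
          C * (logKR δ θ₁₀ θ₂₀ + 1 +
            (normL1Lp T p (fun t x => u₁ t x - u₂ t x)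
              + ENNReal.ofReal |κ₁ - κ₂| * normL1Lp T 1 Dθ₂) / ENNReal.ofReal δ) := by
  obtain ⟨CH, hCH⟩ := exists_lintegral_enorm_mul_le (d := d) hp hpq M
  -- The maximal estimate is applied to θ₁ - θ₂, whose norms are at most 2M.
  obtain ⟨Cm, hCm⟩ := exists_lintegral_maxFn_mul_le (d := d) hp hpq (2 * M)
  refine ⟨1 + 8 ^ d * Cm * G + CH, ?_⟩
  intro T κ₁ κ₂ δ hT hκ₁ hδ u₁ u₂ Du₁ Du₂ θ₁₀ θ₂₀ θ₁ θ₂ Dθ₁ Dθ₂ hu₁ hu₂ hθ₁₀ hθ₂₀ hs₁ hs₂ hθ₁ hθ₂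
    hM₁ hq₁ hM₂ hq₂ hG
  have iθ₁ := integrable_spaceTime_of_normL1Lp hθ₁.aestronglyMeasurable hθ₁.norm_lt_top
  have iθ₂ := integrable_spaceTime_of_normL1Lp hθ₂.aestronglyMeasurable hθ₂.norm_lt_top
  have iD₁ := integrable_spaceTime_of_normL1Lp hθ₁.aestronglyMeasurable_deriv hθ₁.norm_deriv_lt_top
  have iD₂ := integrable_spaceTime_of_normL1Lp hθ₂.aestronglyMeasurable_deriv hθ₂.norm_deriv_lt_top
  have iW₁ := integrable_smul_spaceTime hCH hu₁.aestronglyMeasurable hu₁.norm_lt_top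
    hθ₁.aestronglyMeasurable hM₁ hq₁
  have iW₂ := integrable_smul_spaceTime hCH hu₂.aestronglyMeasurable hu₂.norm_lt_top
    hθ₂.aestronglyMeasurable hM₂ hq₂
  have iW₁₂ := integrable_smul_spaceTime hCH hu₁.aestronglyMeasurable hu₁.norm_lt_top
    hθ₂.aestronglyMeasurable hM₂ hq₂
  have iG : ∀ {D : ℝ × Space d → Space d →L[ℝ] ℝ}, Integrable D (spaceTime d T) →
      Integrable (fun z => gradOf (D z)) (spaceTime d T) := fun h =>
    (integrable_norm_iff (continuous_gradOf.comp_aestronglyMeasurable h.1)).1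
      (h.norm.congr (.of_forall fun z => (norm_gradOf _).symm))
  set H₁ : ℝ → Space d → Space d := fun s x => θ₁ s x • u₁ s x - κ₁ • gradOf (Dθ₁ s x)
  set H₂ : ℝ → Space d → Space d := fun s x => θ₂ s x • u₂ s x - κ₂ • gradOf (Dθ₂ s x)
  have iH₁ : Integrable (fun z : ℝ × Space d => H₁ z.1 z.2) (spaceTime d T) :=
    iW₁.sub ((iG iD₁).smul κ₁)
  have iH₂ : Integrable (fun z : ℝ × Space d => H₂ z.1 z.2) (spaceTime d T) :=
    iW₂.sub ((iG iD₂).smul κ₂)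
  have iH : Integrable (fun z : ℝ × Space d => H₁ z.1 z.2 - H₂ z.1 z.2) (spaceTime d T) :=
    iH₁.sub iH₂
  have hL₁ := hs₁.ae_integral_mul_eq hT iθ₁ iD₁ hθ₁.hasWeakFDeriv iW₁
  have hL₂ := hs₂.ae_integral_mul_eq hT iθ₂ iD₂ hθ₂.hasWeakFDeriv iW₂
  have hbi : ∀ {H : ℝ → Space d → Space d},
      Integrable (fun z : ℝ × Space d => H z.1 z.2) (spaceTime d T) → ∀ ζ ∈ testClass d δ,
      ∀ t ∈ Icc 0 T, IntervalIntegrable (fun s => ∫ x, fderiv ℝ ζ x (H s x)) volume 0 t := by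
    intro H hH ζ hζ t ht
    rw [intervalIntegrable_iff_integrableOn_Ioo_of_le ht.1]
    exact IntegrableOn.mono_set
      (integrable_fderiv_apply_of_mem_testClass hδ hζ measurable_snd hH).integral_prod_left
      (Ioo_subset_Ioo le_rfl ht.2)
  have hmul : ∀ {f : Space d → ℝ}, Integrable f → ∀ ζ ∈ testClass d δ,
      Integrable fun x => f x * ζ x := by
    intro f hf ζ hζ
    obtain ⟨C, hC⟩ := hζ.1.continuous.bounded_above_of_compact_support hζ.2.1
    exact hf.mul_bdd (c := C) hζ.1.continuous.aestronglyMeasurable (.of_forall hC)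
  set L : ℝ → (Space d → ℝ) → ℝ := fun t ζ => (∫ x, (θ₁₀ x - θ₂₀ x) * ζ x) +
    ∫ s in 0..t, ∫ x, fderiv ℝ ζ x (H₁ s x - H₂ s x)
  have hL : ∀ᵐ t ∂(volume.restrict (Ioo 0 T)), ∀ ζ ∈ testClass d δ,
      ∫ x, (θ₁ t x - θ₂ t x) * ζ x = L t ζ := by
    filter_upwards [hL₁, hL₂, iθ₁.prod_right_ae, iθ₂.prod_right_ae,
      ae_restrict_mem measurableSet_Ioo] with t h1 h2 h3 h4 ht ζ hζ
    have ht' := Ioo_subset_Icc_self ht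
    simp only [L, sub_mul]
    rw [integral_sub (hmul h3 ζ hζ) (hmul h4 ζ hζ), integral_sub (hmul hθ₁₀ ζ hζ) (hmul hθ₂₀ ζ hζ),
      h1 ζ hζ.1 hζ.2.1, h2 ζ hζ.1 hζ.2.1, add_sub_add_comm]
    congr 1
    rw [← intervalIntegral.integral_sub (hbi iH₁ ζ hζ t ht') (hbi iH₂ ζ hζ t ht'),
      intervalIntegral.integral_of_le ht.1.le, intervalIntegral.integral_of_le ht.1.le,
      integral_Ioc_eq_integral_Ioo, integral_Ioc_eq_integral_Ioo]
    refine integral_congr_ae ?_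
    have hsub : Ioo 0 t ⊆ Ioo 0 T := Ioo_subset_Ioo le_rfl ht.2.le
    have hr := Measure.restrict_mono hsub (le_refl (volume : Measure ℝ))
    filter_upwards [ae_mono hr iH₁.prod_right_ae, ae_mono hr iH₂.prod_right_ae] with s hs1 hs2
    simp only [map_sub]
    rw [integral_sub (by exact integrable_fderiv_apply_of_mem_testClass hδ hζ measurable_id hs1)
      (by exact integrable_fderiv_apply_of_mem_testClass hδ hζ measurable_id hs2)]
  refine ⟨L, fun ζ hζ => ?_, hL, ?_⟩
  · refine continuousOn_const.add ?_
    have := ((hbi (H := fun s x => H₁ s x - H₂ s x) iH ζ hζ T ⟨hT.le, le_rfl⟩).absolutelyContinuousOnInterval_intervalIntegral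
      (c := 0) (by simp)).continuousOn
    rwa [uIcc_of_le hT.le] at this
  rcases eq_or_ne (logKR δ θ₁₀ θ₂₀) ⊤ with hK | hK
  · intro t _ ζ _
    rw [hK, top_add, top_add, ENNReal.mul_top]
    · exact le_top
    · positivity
  have i0 : Integrable fun x => θ₁₀ x - θ₂₀ x := hθ₁₀.sub hθ₂₀
  have hD : ∀ ζ ∈ testClass d δ, ∫ x, (θ₁₀ x - θ₂₀ x) * ζ x ≤ (logKR δ θ₁₀ θ₂₀).toReal := by
    intro ζ hζ
    obtain ⟨C, hC⟩ := hζ.1.continuous.bounded_above_of_compact_support hζ.2.1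
    exact (ENNReal.ofReal_le_iff_le_toReal hK).1 (ofReal_integral_mul_le_logKR hδ i0 hζ.2.2 hC)
  -- The L¹ norm of the residual flux caused by different velocities and diffusivities.
  set r : ℝ → ℝ≥0∞ := fun t => ∫⁻ x, ‖θ₂ t x • (u₁ t x - u₂ t x) - (κ₁ - κ₂) • gradOf (Dθ₂ t x)‖ₑ
  -- The growth rate: separation by u₁, free of δ, plus the residual flux tested with gradients of
  -- size at most 1/δ.
  set g : ℝ → ℝ≥0∞ := fun t => 8 ^ d * Cm * eLpNorm (Du₁ t) p volume + ENNReal.ofReal δ⁻¹ * r t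
  have iR : Integrable (fun z : ℝ × Space d =>
      θ₂ z.1 z.2 • (u₁ z.1 z.2 - u₂ z.1 z.2) - (κ₁ - κ₂) • gradOf (Dθ₂ z.1 z.2)) (spaceTime d T) := by
    simp only [smul_sub]
    exact (iW₁₂.sub iW₂).sub ((iG iD₂).smul (κ₁ - κ₂))
  have hrm : AEMeasurable r (volume.restrict (Ioo 0 T)) :=
    AEMeasurable.lintegral_prod_right' (f := fun z : ℝ × Space d =>
      ‖θ₂ z.1 z.2 • (u₁ z.1 z.2 - u₂ z.1 z.2) - (κ₁ - κ₂) • gradOf (Dθ₂ z.1 z.2)‖ₑ) iR.1.enorm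
  have hr : ∫⁻ t in Ioo 0 T, r t ≤ CH * normL1Lp T p (fun t x => u₁ t x - u₂ t x)
      + ENNReal.ofReal |κ₁ - κ₂| * normL1Lp T 1 Dθ₂ := by
    have hum := hu₁.aestronglyMeasurable.sub hu₂.aestronglyMeasurable
    have hDm := iD₂.1
    calc ∫⁻ t in Ioo 0 T, r t ≤ ∫⁻ t in Ioo 0 T,
          (CH * eLpNorm (fun x => u₁ t x - u₂ t x) p volume +
            ENNReal.ofReal |κ₁ - κ₂| * eLpNorm (Dθ₂ t) 1 volume) := by
          refine lintegral_mono_ae ?_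
          filter_upwards [AEStronglyMeasurable.prodMk_left (f := fun z : ℝ × Space d =>
              u₁ z.1 z.2 - u₂ z.1 z.2) hum, iθ₂.1.prodMk_left, iD₂.1.prodMk_left,
            ae_eLpNorm_le hM₂, ae_eLpNorm_le hq₂] with t a1 a2 a3 a4 a5
          refine le_trans ?_ (add_le_add_left (hCH (fun x => u₁ t x - u₂ t x) (θ₂ t) a1 a2 a4 a5) _)
          rw [eLpNorm_one_eq_lintegral_enorm, ← lintegral_const_mul' _ _ ENNReal.ofReal_ne_top]
          refine (lintegral_mono fun x => enorm_sub_le.trans (le_of_eq ?_)).trans_eq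
            (lintegral_add_left' (f := fun x => ‖u₁ t x - u₂ t x‖ₑ * ‖θ₂ t x‖ₑ)
              (a1.enorm.mul a2.enorm) _)
          rw [enorm_smul, enorm_smul, mul_comm, ← ofReal_norm (gradOf _), norm_gradOf, ofReal_norm,
            ← ofReal_norm (κ₁ - κ₂), Real.norm_eq_abs]
      _ = _ := by
          rw [lintegral_add_right', lintegral_const_mul' _ _ ENNReal.coe_ne_top,
            lintegral_const_mul' _ _ ENNReal.ofReal_ne_top]
          · rfl
          · simp only [eLpNorm_one_eq_lintegral_enorm]
            exact (AEMeasurable.lintegral_prod_right' (f := fun z : ℝ × Space d =>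
              ‖Dθ₂ z.1 z.2‖ₑ) hDm.enorm).const_mul _
  have hgi : ENNReal.ofReal (logKR δ θ₁₀ θ₂₀).toReal + ∫⁻ s in Ioo 0 T, g s ≤
      ((1 + 8 ^ d * Cm * G + CH : ℝ≥0) : ℝ≥0∞) * (logKR δ θ₁₀ θ₂₀ + 1 +
        (normL1Lp T p (fun t x => u₁ t x - u₂ t x)
          + ENNReal.ofReal |κ₁ - κ₂| * normL1Lp T 1 Dθ₂) / ENNReal.ofReal δ) := by
    rw [ENNReal.ofReal_toReal hK]
    have e1 : ∫⁻ s in Ioo 0 T, g s = 8 ^ d * Cm * normL1Lp T p Du₁ +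
        ENNReal.ofReal δ⁻¹ * ∫⁻ t in Ioo 0 T, r t := by
      simp only [g]
      rw [lintegral_add_right' _ (hrm.const_mul _),
        lintegral_const_mul' _ _ (ENNReal.mul_ne_top (by simp) ENNReal.coe_ne_top),
        lintegral_const_mul' _ _ ENNReal.ofReal_ne_top]
      rfl
    rw [e1, div_eq_mul_inv, ← ENNReal.ofReal_inv_of_pos hδ]
    set K := logKR δ θ₁₀ θ₂₀
    set U := normL1Lp T p (fun t x => u₁ t x - u₂ t x)
    set V := ENNReal.ofReal |κ₁ - κ₂| * normL1Lp T 1 Dθ₂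
    set w := ENNReal.ofReal δ⁻¹
    push_cast
    have t1 : K ≤ (1 + 8 ^ d * Cm * G + CH) * K := by
      refine (one_mul K).symm.trans_le ?_
      gcongr
      rw [add_assoc]
      exact le_self_add
    have t2 : 8 ^ d * Cm * normL1Lp T p Du₁ ≤ (1 + 8 ^ d * Cm * G + CH) * 1 := by
      rw [mul_one]
      refine le_trans ?_ (le_trans le_add_self le_self_add)
      gcongr
    have t3 : w * ∫⁻ t in Ioo 0 T, r t ≤ (1 + 8 ^ d * Cm * G + CH) * ((U + V) * w) := by
      calc w * ∫⁻ t in Ioo 0 T, r t ≤ w * ((1 + 8 ^ d * Cm * G + CH) * U +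
            (1 + 8 ^ d * Cm * G + CH) * V) := by
            gcongr
            refine hr.trans (add_le_add ?_ ?_)
            · gcongr
              exact le_add_self
            · refine (one_mul V).symm.trans_le ?_
              gcongr
              rw [add_assoc]
              exact le_self_add
        _ = _ := by ring
    calc _ ≤ (1 + 8 ^ d * Cm * G + CH) * K + ((1 + 8 ^ d * Cm * G + CH) * 1 +
          (1 + 8 ^ d * Cm * G + CH) * ((U + V) * w)) := by gcongr
      _ = _ := by ring
  have key := ofReal_integral_add_le_of_step (θ := fun t x => θ₁ t x - θ₂ t x) (g := g)
    hδ iH hD hL ?_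
  · exact fun t ht ζ hζ => (key t ht ζ hζ).trans hgi
  filter_upwards [iθ₁.prod_right_ae, iθ₂.prod_right_ae, iD₁.prod_right_ae, iD₂.prod_right_ae,
    iW₁.prod_right_ae, iW₁₂.prod_right_ae, hu₁.hasWeakFDeriv, hθ₁.hasWeakFDeriv, hθ₂.hasWeakFDeriv,
    iR.prod_right_ae, ae_eLpNorm_le hM₁, ae_eLpNorm_le hM₂, ae_eLpNorm_le hq₁, ae_eLpNorm_le hq₂,
    hu₁.aestronglyMeasurable.prodMk_left, hu₁.aestronglyMeasurable_deriv.prodMk_left]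
    with t jθ₁ jθ₂ jD₁ jD₂ jW₁ jW₁₂ wu w₁ w₂ jR m₁ m₂ n₁ n₂ um Dum hgt E hE0 hE η hη
  obtain ⟨S, hS, hS'⟩ := ae_enorm_sub_le_maxFn wu
  set A := (8 ^ d * Cm * eLpNorm (Du₁ t) p volume).toReal
  have hgt' := ENNReal.add_ne_top.1 hgt
  have hθm : Integrable fun x => θ₁ t x - θ₂ t x := jθ₁.sub jθ₂
  have hnorm : ∀ {q : ℝ≥0∞}, 1 ≤ q → eLpNorm (θ₁ t) q volume ≤ M → eLpNorm (θ₂ t) q volume ≤ M →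
      eLpNorm (fun x => θ₁ t x - θ₂ t x) q volume ≤ (2 * M : ℝ≥0) := by
    intro q hq h1 h2
    refine (eLpNorm_sub_le jθ₁.1 jθ₂.1 hq).trans ?_
    push_cast
    rw [two_mul]
    exact add_le_add h1 h2
  have hWm : Integrable fun x => (θ₁ t x - θ₂ t x) • u₁ t x := by
    simp only [sub_smul]
    exact jW₁.sub jW₁₂
  have hA : ∫⁻ x, ENNReal.ofReal (8 ^ d) * maxFn (fun x => ‖Du₁ t x‖ₑ) x * ‖θ₁ t x - θ₂ t x‖ₑ ≤
      ENNReal.ofReal A := by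
    rw [ENNReal.ofReal_toReal hgt'.1]
    simp only [mul_assoc]
    rw [lintegral_const_mul' _ _ ENNReal.ofReal_ne_top, ENNReal.ofReal_pow (by norm_num),
      ENNReal.ofReal_ofNat]
    gcongr
    exact hCm (Du₁ t) (fun x => θ₁ t x - θ₂ t x) Dum hθm.1 (hnorm le_rfl m₁ m₂) (hnorm hq n₁ n₂)
  obtain ⟨h₀, h0, hh⟩ := exists_step_estimate hd (θ := fun x => θ₁ t x - θ₂ t x)
    (Dθ := fun x => Dθ₁ t x - Dθ₂ t x) hθm (jD₁.sub jD₂) (w₁.sub w₂) um hWm hκ₁ hδ hη hE0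
    ENNReal.toReal_nonneg (fun ζ h1 h2 h3 => hE ζ ⟨h1, h2, h3⟩)
    ((measurable_maxFn _).const_mul _).aemeasurable hS hS' hA
  refine ⟨h₀, h0, fun h hp hle ζ hζ => ?_⟩
  have a1 := hh h hp hle ζ hζ.1 hζ.2.1 hζ.2.2
  have iF : Integrable fun x => (θ₁ t x - θ₂ t x) • u₁ t x - κ₁ • gradOf (Dθ₁ t x - Dθ₂ t x) := by
    refine hWm.sub (Integrable.smul κ₁ ?_)
    refine (integrable_norm_iff (continuous_gradOf.comp_aestronglyMeasurable
      (jD₁.sub jD₂).1)).1 ?_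
    exact (jD₁.sub jD₂).norm.congr (.of_forall fun z => (norm_gradOf _).symm)
  -- The difference of the fluxes splits into the flux of θ₁ - θ₂ driven by u₁ and κ₁, to which the
  -- transport step applies, and the residual.
  have e1 : ∫ x, fderiv ℝ ζ x (H₁ t x - H₂ t x) =
      (∫ x, fderiv ℝ ζ x ((θ₁ t x - θ₂ t x) • u₁ t x - κ₁ • gradOf (Dθ₁ t x - Dθ₂ t x))) +
      ∫ x, fderiv ℝ ζ x (θ₂ t x • (u₁ t x - u₂ t x) - (κ₁ - κ₂) • gradOf (Dθ₂ t x)) := by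
    rw [← integral_add
      (by exact integrable_fderiv_apply_of_mem_testClass hδ hζ measurable_id iF)
      (by exact integrable_fderiv_apply_of_mem_testClass hδ hζ measurable_id jR)]
    refine integral_congr_ae (.of_forall fun x => ?_)
    simp only [H₁, H₂, gradOf, map_sub, map_smul, sub_smul, smul_sub]
    ring
  have e2 : ∫ x, fderiv ℝ ζ x (θ₂ t x • (u₁ t x - u₂ t x) - (κ₁ - κ₂) • gradOf (Dθ₂ t x)) ≤
      δ⁻¹ * (r t).toReal := by
    simp only [r]
    rw [← integral_norm_eq_lintegral_enorm jR.1, ← integral_const_mul]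
    exact (le_abs_self _).trans (norm_integral_le_of_norm_le (G := ℝ) (jR.norm.const_mul δ⁻¹)
      (.of_forall fun x => norm_fderiv_apply_le_of_mem_testClass hδ hζ _ _))
  have e3 : (g t).toReal = A + δ⁻¹ * (r t).toReal := by
    simp only [g]
    rw [ENNReal.toReal_add hgt'.1 hgt'.2, ENNReal.toReal_mul (a := ENNReal.ofReal δ⁻¹),
      ENNReal.toReal_ofReal (by positivity)]
  rw [e1, e3]
  have := mul_le_mul_of_nonneg_left e2 hp.le
  linarith

end AdvDiff

/-! ### Back to the transport distance. -/

namespace AdvDiff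

open Filter Topology
variable {d : ℕ}

theorem logKR_le_of_forall_testClass {δ : ℝ} (hδ : 0 < δ) {f g : Space d → ℝ}
    (hf : Integrable fun x => f x - g x) {B : ℝ≥0∞}
    (hB : ∀ ζ ∈ testClass d δ, ENNReal.ofReal (∫ x, (f x - g x) * ζ x) ≤ B) :
    logKR δ f g ≤ B := by
  rcases eq_or_ne B ⊤ with rfl | hBt
  · exact le_top
  rw [← ENNReal.ofReal_toReal hBt]
  exact logKR_le_of_forall hδ hf fun ζ h1 h2 h3 =>
    (ENNReal.ofReal_le_iff_le_toReal hBt).1 (hB ζ ⟨h1, h2, h3⟩)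

/-- Both sides are continuous on [0,T] and agree almost everywhere, hence everywhere, endpoints
included. -/
theorem IsWeaklyContinuousRep.eqOn_of_ae_eq {T δ : ℝ} (hT : 0 < T) {θ₁ θ₂ v₁ v₂ : ℝ → Space d → ℝ}
    (h₁ : IsWeaklyContinuousRep T θ₁ v₁) (h₂ : IsWeaklyContinuousRep T θ₂ v₂)
    {L : ℝ → (Space d → ℝ) → ℝ}
    (hLc : ∀ ζ ∈ testClass d δ, ContinuousOn (fun t => L t ζ) (Icc 0 T))
    (hL : ∀ᵐ t ∂(volume.restrict (Ioo 0 T)), ∀ ζ ∈ testClass d δ,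
      ∫ x, (θ₁ t x - θ₂ t x) * ζ x = L t ζ) :
    ∀ t ∈ Icc 0 T, ∀ ζ ∈ testClass d δ, ∫ x, (v₁ t x - v₂ t x) * ζ x = L t ζ := by
  intro t ht ζ hζ
  have hsplit : ∀ t ∈ Icc 0 T, ∫ x, (v₁ t x - v₂ t x) * ζ x =
      (∫ x, v₁ t x * ζ x) - ∫ x, v₂ t x * ζ x := by
    intro t ht
    obtain ⟨C, hC⟩ := hζ.1.continuous.bounded_above_of_compact_support hζ.2.1
    have hmul : ∀ {f : Space d → ℝ}, Integrable f → Integrable fun x => f x * ζ x := fun hf =>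
      hf.mul_bdd (c := C) hζ.1.continuous.aestronglyMeasurable (.of_forall hC)
    simp only [sub_mul]
    exact integral_sub (hmul (h₁.integrable t ht)) (hmul (h₂.integrable t ht))
  have hc : ContinuousOn (fun t => ∫ x, (v₁ t x - v₂ t x) * ζ x) (Icc 0 T) :=
    ((h₁.continuousOn ζ hζ.1 hζ.2.1).sub (h₂.continuousOn ζ hζ.1 hζ.2.1)).congr hsplit
  refine Measure.eqOn_Icc_of_ae_eq volume hT.ne ?_ hc (hLc ζ hζ) ht
  rw [← restrict_Ioo_eq_restrict_Icc]
  filter_upwards [hL, h₁.ae_eq, h₂.ae_eq] with s hs e1 e2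
  rw [← hs ζ hζ]
  refine integral_congr_ae ?_
  filter_upwards [e1, e2] with x hx1 hx2
  rw [hx1, hx2]

end AdvDiff

open AdvDiff
theorem theorem1 (d : ℕ) (hd : 1 ≤ d) (p q : ℝ≥0∞) (hp : 1 < p) (hq : 1 < q)
    (hpq : p⁻¹ + q⁻¹ ≤ 1) (M G : ℝ≥0) :
    ∃ C : ℝ≥0, ∀ (T κ₁ κ₂ δ : ℝ), 0 < T → 0 < κ₁ → 0 < κ₂ → 0 < δ →
      ∀ (u₁ u₂ : ℝ → Space d → Space d) (Du₁ Du₂ : ℝ → Space d → Space d →L[ℝ] Space d)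
        (θ₁₀ θ₂₀ : Space d → ℝ) (θ₁ θ₂ : ℝ → Space d → ℝ)
        (Dθ₁ Dθ₂ : ℝ → Space d → Space d →L[ℝ] ℝ),
      MemL1W1p T p u₁ Du₁ → MemL1W1p T p u₂ Du₂ →
      MemLp θ₁₀ 1 volume → MemLp θ₁₀ q volume →
      MemLp θ₂₀ 1 volume → MemLp θ₂₀ q volume →
      IsDistribSolution T q κ₁ u₁ θ₁₀ θ₁ → IsDistribSolution T q κ₂ u₂ θ₂₀ θ₂ →
      MemL1W1p T 1 θ₁ Dθ₁ → MemL1W1p T 1 θ₂ Dθ₂ →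
      normLinftyLq T 1 θ₁ ≤ M → normLinftyLq T q θ₁ ≤ M →
      normLinftyLq T 1 θ₂ ≤ M → normLinftyLq T q θ₂ ≤ M →
      normL1Lp T p Du₁ ≤ G →
      (essSup (fun t => logKR δ (θ₁ t) (θ₂ t)) (volume.restrict (Ioo 0 T)) ≤
        C * (logKR δ θ₁₀ θ₂₀ + 1 +
          (normL1Lp T p (fun t x => u₁ t x - u₂ t x)
            + ENNReal.ofReal |κ₁ - κ₂| * normL1Lp T 1 Dθ₂) / ENNReal.ofReal δ)) ∧
      (∀ v₁ v₂ : ℝ → Space d → ℝ,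
        IsWeaklyContinuousRep T θ₁ v₁ → IsWeaklyContinuousRep T θ₂ v₂ →
        (⨆ t ∈ Icc 0 T, logKR δ (v₁ t) (v₂ t)) ≤
          C * (logKR δ θ₁₀ θ₂₀ + 1 +
            (normL1Lp T p (fun t x => u₁ t x - u₂ t x)
              + ENNReal.ofReal |κ₁ - κ₂| * normL1Lp T 1 Dθ₂) / ENNReal.ofReal δ)) := by
  obtain ⟨C, hC⟩ := exists_forall_dual_le hd hp hq.le hpq M G
  refine ⟨C, ?_⟩
  intro T κ₁ κ₂ δ hT hκ₁ _ hδ u₁ u₂ Du₁ Du₂ θ₁₀ θ₂₀ θ₁ θ₂ Dθ₁ Dθ₂ hu₁ hu₂ h₁₀ _ h₂₀ _ hs₁ hs₂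
    hθ₁ hθ₂ hM₁ hq₁ hM₂ hq₂ hG
  obtain ⟨L, hLc, hL, hB⟩ := hC T κ₁ κ₂ δ hT hκ₁ hδ u₁ u₂ Du₁ Du₂ θ₁₀ θ₂₀ θ₁ θ₂ Dθ₁ Dθ₂ hu₁ hu₂
    (memLp_one_iff_integrable.1 h₁₀) (memLp_one_iff_integrable.1 h₂₀) hs₁ hs₂ hθ₁ hθ₂
    hM₁ hq₁ hM₂ hq₂ hG
  refine ⟨essSup_le_of_ae_le _ ?_, fun v₁ v₂ hv₁ hv₂ => iSup₂_le fun t ht => ?_⟩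
  · have iθ₁ := integrable_spaceTime_of_normL1Lp hθ₁.aestronglyMeasurable hθ₁.norm_lt_top
    have iθ₂ := integrable_spaceTime_of_normL1Lp hθ₂.aestronglyMeasurable hθ₂.norm_lt_top
    filter_upwards [hL, iθ₁.prod_right_ae, iθ₂.prod_right_ae,
      ae_restrict_mem measurableSet_Ioo] with t htL h1 h2 ht
    refine logKR_le_of_forall_testClass hδ (h1.sub h2) fun ζ hζ => ?_
    rw [htL ζ hζ]
    exact hB t (Ioo_subset_Icc_self ht) ζ hζ
  · refine logKR_le_of_forall_testClass hδ ((hv₁.integrable t ht).sub (hv₂.integrable t ht))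
      fun ζ hζ => ?_
    rw [hv₁.eqOn_of_ae_eq hT hv₂ hLc hL t ht ζ hζ]
    exact hB t ht ζ hζ
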